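/- Let $k$ be an algebraically closed field and let $\Lambda = kQ/I$ be a finite-dimensional gentle algebra: $Q$ is a finite quiver, $I$ is an admissible ideal generated by paths of length two, at most two arrows start and at most two arrows end at each vertex, and for each arrow $a$ there is at most one arrow $b$ with $ba$ a path outside $I$, at most one arrow $c$ with $ac$ a path outside $I$, at most one arrow $b$ with $ba$ a path in $I$, and at most one arrow $c$ with $ac$ a path in $I$. Paths are read from right to left, $s(p)$ and $e(p)$ are the start and the end of $p$, and a path $p$ in $(Q,I)$ (a path without subpaths in $I$) gives by right multiplication a map $P(e(p)) \to P(s(p))$ between the left modules $P(x) = \Lambda e_x$; maps are composed from left to right. A homotopy letter is a nontrivial path $p$ in $(Q,I)$ (direct) or a formal inverse $\overline{p}$ of one (inverse). A homotopy string is a composable sequence $\sigma = \cdots\sigma_{i+1}\sigma_{i}\cdots$ of homotopy letters (finite, possibly trivial, or infinite to the left and/or to the right) in which two neighbouring letters of the same direction meet in a relation of $I$, and the arrows at which two neighbouring letters of opposite direction meet do not cancel; if it is infinite to the left (right) it ends there in direct (inverse) letters of length one. A homotopy band is a cyclic sequence of $n>0$ homotopy letters with the same conditions at all $n$ places, with equally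 many direct and inverse letters, and not a proper power. The string complex $P^\bullet_\sigma$ is the direct sum of the $P(x)$ over the nodes (the ends of the letters) of $\sigma$, each placed in a degree so that every letter $p$ or $\overline p$ contributes the component $p$ of the differential, of degree $1$. The band complex $B^\bullet_{\tau,\mu}$, $\mu \in k^*$, is defined in the same way from the cyclic word, the component of one direct letter being multiplied by $\mu$. Let $\sigma$ be a homotopy string and $\tau$ a homotopy band, both with chosen degrees. Fix a node of $\sigma$ and a node of $\tau$ of the same degree, and write $\sigma = \beta\sigma_L\sigma_R\alpha$ and, up to cyclic permutation, $\tau = \delta\tau_L\tau_R\gamma$, where $\sigma_L,\sigma_R$ and $\tau_L,\tau_R$ are the homotopy letters to the left and to the right of these nodes ($\sigma_L$ or $\sigma_R$ is empty if the node is an end of $\sigma$). Let $f$ be a nontrivial path in $(Q,I)$ from the vertex of the node of $\tau$ to the vertex of the node of $\sigma$ such that the map with single component $f$ between the corresponding projectives is a single map $f^\bullet\colon P^\bullet_\sigma\to B^\bullet_{\tau,\mu}$, i.e. $\sigma_L f \in I$ if $\sigma_L$ is direct, $f\overline{\tau_L} \in I$ if $\tau_L$ is inverse, $\overline{\sigma_R}f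 \in I$ if $\sigma_R$ is inverse and $f\tau_R \in I$ if $\tau_R$ is direct. Suppose that $\sigma$ and $\tau$ are compatibly oriented for $f^\bullet$, that is: (i) $\sigma_L$ and $\tau_L$ do not contain $f$ as a subletter (it is enough that $\overline{\sigma_L}\neq f g$ for every possibly trivial path $g$ if $\sigma_L$ is inverse, and $\tau_L\neq g f$ for every possibly trivial path $g$ if $\tau_L$ is direct); (ii) $\sigma_L f = 0$ if $\sigma_L$ is direct, and $f\overline{\tau_L}=0$ if $\tau_L$ is inverse; (iii) $\tau_R=\overline f\,\overline{f_L}$ and, if $\sigma_R$ is not empty, $\sigma_R=f f_R$, for possibly trivial paths $f_L$, $f_R$ in $(Q,I)$. Suppose also that $f^\bullet$ is not zero in the homotopy category. Then the word $$c=\begin{cases}\beta\,\sigma_L\, f\,\overline{\tau_L}\,\overline{\delta}\,\overline{\gamma} & \text{if } \sigma_R=\emptyset,\\ \beta\,\sigma_L\, f\,\overline{\tau_L}\,\overline{\delta}\,\overline{\gamma}\;\overline{\tau_R}\,\overline{f}\,\sigma_R\,\alpha & \text{if } \sigma_R\neq\emptyset,\end{cases}$$ where $\overline{\tau_R}\,\overline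 f\,\sigma_R = f_L f f_R$ is one direct homotopy letter, is a homotopy string, and the mapping cone of $f^\bullet$ is isomorphic to $P^\bullet_c$ in the homotopy category of complexes of $\Lambda$-modules. Here the nodes of $c$ that come from $\tau$ keep their degrees, and those that come from $\sigma$ have their degrees lowered by one. -/

import Mathlib

open CategoryTheory

universe u v w

set_option linter.unusedSectionVars false

namespace Gentle

/-! ### Quivers with quadratic monomial relations, and gentle algebras -/

section Quiver

variable {V : Type v} [Quiver.{w} V]

/-- The arrows of the quiver: `a.left` is the start `s(a)` and `a.right` is the end `e(a)`. -/
abbrev Arr (V : Type v) [Quiver.{w} V] := Quiver.Total V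

/-- `(Q, I)` is gentle, where `Q` is a quiver with finitely many vertices and `I` is the ideal
of the path algebra generated by the paths `ba` of length two with `rel b a`.  Paths are written
from right to left, so `ba` is a path if and only if `s(b) = e(a)`. -/
structure IsGentle (rel : Arr V → Arr V → Prop) : Prop where
  /-- the relations are paths of length two -/
  composable : ∀ b a, rel b a → b.left = a.right
  /-- at most two arrows start at each vertex -/
  out_le : ∀ x : V, {a : Arr V | a.left = x}.encard ≤ 2
  /-- at most two arrows end at each vertex -/
  in_le : ∀ x : V, {a : Arr V | a.right = x}.encard ≤ 2
  /-- at most one `b` with `ba` a path outside `I` -/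
  post_free : ∀ a : Arr V, {b : Arr V | b.left = a.right ∧ ¬ rel b a}.Subsingleton
  /-- at most one `c` with `ac` a path outside `I` -/
  pre_free : ∀ a : Arr V, {c : Arr V | a.left = c.right ∧ ¬ rel a c}.Subsingleton
  /-- at most one `b` with `ba` a path inside `I` -/
  post_rel : ∀ a : Arr V, {b : Arr V | rel b a}.Subsingleton
  /-- at most one `c` with `ac` a path inside `I` -/
  pre_rel : ∀ a : Arr V, {c : Arr V | rel a c}.Subsingleton
  /-- all sufficiently long paths lie in `I`; as `I` is generated by paths of length two, this
  says that `I` is admissible, and that the quotient is finite-dimensional -/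
  admissible : ∃ N : ℕ, ∀ l : List (Arr V),
    l.IsChain (fun b a => b.left = a.right ∧ ¬ rel b a) → l.length ≤ N

/-- `l = [a_m, …, a_1]` is a nontrivial path `a_m ⋯ a_1` in `(Q, I)`, i.e. a path of `Q` without
subpaths in `I`, which ends at `x` and starts at `y`. -/
structure IsPath (rel : Arr V → Arr V → Prop) (x y : V) (l : List (Arr V)) : Prop where
  ne_nil : l ≠ []
  chain : l.IsChain (fun b a => b.left = a.right ∧ ¬ rel b a)
  ends : ∀ a ∈ l.head?, a.right = x
  starts : ∀ a ∈ l.getLast?, a.left = y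

/-- The path `l` has a subpath in `I`. -/
def HasRel (rel : Arr V → Arr V → Prop) (l : List (Arr V)) : Prop :=
  ∃ b a, rel b a ∧ [b, a] <:+: l

end Quiver

section Algebra

variable (k : Type u) [Field k] {V : Type v} [Fintype V] [Quiver.{w} V]

/-- The defining relations of `kQ/I` on the generators `e_x` (the trivial paths, `x` a vertex) and
`a` (the arrows). -/
inductive AlgRel (rel : Arr V → Arr V → Prop) :
    FreeAlgebra k (V ⊕ Arr V) → FreeAlgebra k (V ⊕ Arr V) → Prop
  | idem (x : V) : AlgRel rel
      (FreeAlgebra.ι k (Sum.inl x) * FreeAlgebra.ι k (Sum.inl x)) (FreeAlgebra.ι k (Sum.inl x))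
  | orth (x y : V) (h : x ≠ y) : AlgRel rel
      (FreeAlgebra.ι k (Sum.inl x) * FreeAlgebra.ι k (Sum.inl y)) 0
  | one : AlgRel rel (∑ x : V, FreeAlgebra.ι k (Sum.inl x)) 1
  | end_mul (a : Arr V) : AlgRel rel
      (FreeAlgebra.ι k (Sum.inl a.right) * FreeAlgebra.ι k (Sum.inr a)) (FreeAlgebra.ι k (Sum.inr a))
  | mul_start (a : Arr V) : AlgRel rel
      (FreeAlgebra.ι k (Sum.inr a) * FreeAlgebra.ι k (Sum.inl a.left)) (FreeAlgebra.ι k (Sum.inr a))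
  | zero (b a : Arr V) (h : rel b a) : AlgRel rel
      (FreeAlgebra.ι k (Sum.inr b) * FreeAlgebra.ι k (Sum.inr a)) 0

/-- The algebra `Λ = kQ/I`. -/
def Alg (rel : Arr V → Arr V → Prop) : Type (max u v w) := RingQuot (AlgRel k rel)

noncomputable instance (rel : Arr V → Arr V → Prop) : Ring (Alg k rel) :=
  inferInstanceAs (Ring (RingQuot (AlgRel k rel)))

noncomputable instance (rel : Arr V → Arr V → Prop) : Algebra k (Alg k rel) :=
  inferInstanceAs (Algebra k (RingQuot (AlgRel k rel)))

variable (rel : Arr V → Arr V → Prop)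

/-- The class in `Λ` of the trivial path at `x`. -/
noncomputable def idem (x : V) : Alg k rel :=
  RingQuot.mkAlgHom k (AlgRel k rel) (FreeAlgebra.ι k (Sum.inl x))

/-- The class in `Λ` of an arrow. -/
noncomputable def arr (a : Arr V) : Alg k rel :=
  RingQuot.mkAlgHom k (AlgRel k rel) (FreeAlgebra.ι k (Sum.inr a))

/-- The class in `Λ` of a nontrivial path. -/
noncomputable def eval (l : List (Arr V)) : Alg k rel := (l.map (arr k rel)).prod

/-- The projective left module `P(x) = Λ e_x`. -/
noncomputable def P (x : V) : Submodule (Alg k rel) (Alg k rel) := Ideal.span {idem k rel x}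

theorem arr_mul_arr {b a : Arr V} (h : rel b a) : arr k rel b * arr k rel a = 0 := by
  have := RingQuot.mkAlgHom_rel k (AlgRel.zero (k := k) b a h)
  rw [map_mul, map_zero] at this
  exact this

theorem arr_mul_idem (a : Arr V) : arr k rel a * idem k rel a.left = arr k rel a := by
  have := RingQuot.mkAlgHom_rel k (AlgRel.mul_start (k := k) (rel := rel) a)
  rw [map_mul] at this
  exact this

theorem eval_append (l m : List (Arr V)) :
    eval k rel (l ++ m) = eval k rel l * eval k rel m := by
  simp [eval]

theorem eval_eq_zero {l : List (Arr V)} (h : HasRel rel l) : eval k rel l = 0 := by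
  obtain ⟨b, a, hr, s, t, rfl⟩ := h
  rw [eval_append, eval_append]
  have : eval k rel [b, a] = 0 := by simp [eval, arr_mul_arr k rel hr]
  rw [this, mul_zero, zero_mul]

theorem smul_mem_P {x : V} {c : Alg k rel} (h : c ∈ P k rel x) (g : Alg k rel) :
    g * c ∈ P k rel x := (P k rel x).smul_mem g h

theorem eval_mem_P {x y : V} {l : List (Arr V)} (h : IsPath rel x y l) :
    eval k rel l ∈ P k rel y := by
  obtain ⟨m, a, rfl⟩ : ∃ m a, l = m ++ [a] := by
    rcases List.eq_nil_or_concat l with h0 | ⟨m, a, h0⟩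
    · exact absurd h0 h.ne_nil
    · exact ⟨m, a, by simpa using h0⟩
  have ha : a.left = y := h.starts a (by simp)
  rw [eval_append]
  apply smul_mem_P
  have : eval k rel [a] = arr k rel a * idem k rel y := by
    rw [← ha, arr_mul_idem]; simp [eval]
  rw [this]
  exact smul_mem_P k rel (Submodule.subset_span rfl) _

end Algebra

/-! ### Homotopy strings and bands -/

section Words

variable {V : Type v} [Quiver.{w} V]

/-- A homotopy letter: the path `path` itself if `direct` holds, and its formal inverse
otherwise. -/
structure Letter (V : Type v) [Quiver.{w} V] where
  direct : Bool
  path : List (Arr V)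

/-- The inverse homotopy letter. -/
def Letter.inv (l : Letter V) : Letter V := ⟨!l.direct, l.path⟩

/-- The letter `l` is a nontrivial homotopy letter with left end `x` and right end `y`. -/
def Letter.Joins (rel : Arr V → Arr V → Prop) (l : Letter V) (x y : V) : Prop :=
  if l.direct then IsPath rel x y l.path else IsPath rel y x l.path

/-- The homotopy letters `l` and `r` may stand next to each other, in the order `l r`, in the
decomposition of a walk into homotopy letters: if they have the same direction, the two arrows
that meet form a relation; if they have opposite directions, these two arrows do not cancel. -/
def Letter.Adj (rel : Arr V → Arr V → Prop) (l r : Letter V) : Prop :=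
  match l.direct, r.direct with
  | true, true => ∃ b ∈ l.path.getLast?, ∃ a ∈ r.path.head?, rel b a
  | false, false => ∃ b ∈ r.path.getLast?, ∃ a ∈ l.path.head?, rel b a
  | true, false => l.path.getLast? ≠ r.path.getLast?
  | false, true => l.path.head? ≠ r.path.head?

/-- The data of a word of homotopy letters with cohomological degrees.  The unfolded diagram has
vertices `vtx i` in degree `deg i` for `i ∈ node`; as usual the diagram is drawn with the indices
decreasing from left to right, and `letter i` stands between the nodes `i` (on its left) and
`i - 1` (on its right), whenever both are nodes.  The values elsewhere have no meaning.
The index set is `ℤ` for strings and `ℤ/n` for bands. -/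
structure Word (V : Type v) [Quiver.{w} V] (ι : Type) where
  node : Set ι
  vtx : ι → V
  deg : ι → ℤ
  letter : ι → Letter V

variable {ι : Type} [CommRing ι]

/-- The letter between the nodes `i` and `i - 1` exists. -/
def Word.HasLetter (σ : Word V ι) (i : ι) : Prop := i ∈ σ.node ∧ i - 1 ∈ σ.node

/-- `σ` is a walk, decomposed into its homotopy letters, with a compatible grading: the degree goes
up by one along direct homotopy letters, and down by one along inverse ones. -/
structure Word.IsWalk (rel : Arr V → Arr V → Prop) (σ : Word V ι) : Prop where
  joins : ∀ i, σ.HasLetter i → (σ.letter i).Joins rel (σ.vtx i) (σ.vtx (i - 1))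
  adj : ∀ i, σ.HasLetter (i + 1) → σ.HasLetter i → (σ.letter (i + 1)).Adj rel (σ.letter i)
  deg_eq : ∀ i, σ.HasLetter i →
    σ.deg (i - 1) = if (σ.letter i).direct then σ.deg i + 1 else σ.deg i - 1

/-- `σ` is a (trivial, finite, left infinite, right infinite or two-sided infinite) homotopy
string, with a grading. -/
structure Word.IsHomotopyString (rel : Arr V → Arr V → Prop) (σ : Word V ℤ) : Prop
    extends σ.IsWalk rel where
  nonempty : σ.node.Nonempty
  interval : σ.node.OrdConnected
  /-- if `σ` is infinite to the left, it ends there in a direct antipath -/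
  left_inf : ¬ BddAbove σ.node →
    ∃ m, ∀ i, m ≤ i → (σ.letter i).direct = true ∧ (σ.letter i).path.length = 1
  /-- if `σ` is infinite to the right, it ends there in an inverse antipath -/
  right_inf : ¬ BddBelow σ.node →
    ∃ m, ∀ i, i ≤ m → (σ.letter i).direct = false ∧ (σ.letter i).path.length = 1

/-- `τ` is a homotopy band with `n` homotopy letters, with a grading, considered as a cyclic word
(that is, up to cyclic permutation). -/
structure Word.IsHomotopyBand (rel : Arr V → Arr V → Prop) {n : ℕ} (τ : Word V (ZMod n)) : Prop
    extends τ.IsWalk rel where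
  pos : 0 < n
  node_eq : τ.node = Set.univ
  balanced : {i | (τ.letter i).direct = true}.ncard = {i | (τ.letter i).direct = false}.ncard
  /-- the band is not a proper power -/
  primitive : ∀ d : ZMod n, (∀ i, τ.letter (i + d) = τ.letter i) → d = 0

end Words

/-! ### String and band complexes -/

section Complexes

variable (k : Type u) [Field k] {V : Type v} [Fintype V] [Quiver.{w} V]
  (rel : Arr V → Arr V → Prop) {ι : Type} [CommRing ι]

/-- The degree `n` term `⨁_{deg i = n} P(vtx i)` of the complex of a word, inside `⨁_i Λ`. -/
noncomputable def term (σ : Word V ι) (n : ℤ) : Submodule (Alg k rel) (ι →₀ Alg k rel) where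
  carrier := {g | ∀ i, g i ∈ P k rel (σ.vtx i) ∧ (g i ≠ 0 → i ∈ σ.node ∧ σ.deg i = n)}
  zero_mem' := fun i => ⟨Submodule.zero_mem _, fun h => absurd rfl h⟩
  add_mem' := by
    intro a b ha hb i
    refine ⟨Submodule.add_mem _ (ha i).1 (hb i).1, fun h => ?_⟩
    by_cases h1 : a i = 0
    · refine (hb i).2 fun h2 => h ?_
      rw [Finsupp.add_apply, h1, h2, add_zero]
    · exact (ha i).2 h1
  smul_mem' := by
    intro c a ha i
    refine ⟨Submodule.smul_mem _ c (ha i).1, fun h => (ha i).2 fun h1 => h ?_⟩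
    rw [Finsupp.smul_apply, h1, smul_zero]

open Classical in
/-- The row of the differential at the node `i`: a direct letter between `i` and `i - 1` gives a map
`P(vtx i) → P(vtx (i - 1))`, and an inverse letter between `i + 1` and `i` gives a map
`P(vtx i) → P(vtx (i + 1))`.  Both are right multiplication by the path of the letter, multiplied
by the scalar `c` placed on the letter. -/
noncomputable def row (c : ι → k) (σ : Word V ι) (i : ι) : ι →₀ Alg k rel :=
  (if σ.HasLetter i ∧ (σ.letter i).direct = true then
    Finsupp.single (i - 1) (c i • eval k rel (σ.letter i).path) else 0) +
  (if σ.HasLetter (i + 1) ∧ (σ.letter (i + 1)).direct = false then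
    Finsupp.single (i + 1) (c (i + 1) • eval k rel (σ.letter (i + 1)).path) else 0)

/-- The differential `(g_i)_i ↦ ∑_i g_i • row i` in all degrees at once. -/
noncomputable def diff (c : ι → k) (σ : Word V ι) :
    (ι →₀ Alg k rel) →ₗ[Alg k rel] (ι →₀ Alg k rel) :=
  Finsupp.linearCombination (Alg k rel) (row k rel c σ)

theorem single_mem_term {σ : Word V ι} {n : ℤ} {i : ι} {x : Alg k rel}
    (hx : x ∈ P k rel (σ.vtx i)) (hi : i ∈ σ.node) (hn : σ.deg i = n) :
    Finsupp.single i x ∈ term k rel σ n := by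
  intro j
  by_cases h : i = j
  · subst h
    rw [Finsupp.single_eq_same]
    exact ⟨hx, fun _ => ⟨hi, hn⟩⟩
  · rw [Finsupp.single_eq_of_ne (Ne.symm h)]
    exact ⟨Submodule.zero_mem _, fun h => absurd rfl h⟩

theorem ksmul_mem_P {x : V} {a : Alg k rel} (h : a ∈ P k rel x) (c : k) : c • a ∈ P k rel x := by
  have : c • a = (algebraMap k (Alg k rel) c) * a := Algebra.smul_def c a
  rw [this]
  exact smul_mem_P k rel h _

theorem row_mem {σ : Word V ι} (hσ : σ.IsWalk rel) (c : ι → k) (i : ι) :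
    row k rel c σ i ∈ term k rel σ (σ.deg i + 1) := by
  refine Submodule.add_mem _ ?_ ?_
  · split_ifs with h
    · have hj := hσ.joins i h.1
      have hd := hσ.deg_eq i h.1
      rw [Letter.Joins, if_pos h.2] at hj
      rw [if_pos h.2] at hd
      exact single_mem_term k rel (ksmul_mem_P k rel (eval_mem_P k rel hj) _) h.1.2 hd
    · exact Submodule.zero_mem _
  · split_ifs with h
    · have hn : ¬ (σ.letter (i + 1)).direct = true := by rw [h.2]; simp
      have hj := hσ.joins (i + 1) h.1
      have hd := hσ.deg_eq (i + 1) h.1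
      rw [Letter.Joins, if_neg hn] at hj
      rw [if_neg hn, add_sub_cancel_right] at hd
      refine single_mem_term k rel (ksmul_mem_P k rel (eval_mem_P k rel hj) _) h.1.1 ?_
      rw [hd]; ring
    · exact Submodule.zero_mem _

theorem diff_mem {σ : Word V ι} (hσ : σ.IsWalk rel) (c : ι → k) {m n : ℤ} (h : m + 1 = n)
    {g : ι →₀ Alg k rel} (hg : g ∈ term k rel σ m) : diff k rel c σ g ∈ term k rel σ n := by
  rw [diff, Finsupp.linearCombination_apply]
  refine Submodule.sum_mem _ fun i hi => Submodule.smul_mem _ _ ?_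
  have h2 := ((hg i).2 (Finsupp.mem_support_iff.1 hi)).2
  have := row_mem k rel hσ c i
  rwa [h2, h] at this

theorem hasRel_append {l r : List (Arr V)}
    (h : ∃ b ∈ l.getLast?, ∃ a ∈ r.head?, rel b a) : HasRel rel (l ++ r) := by
  obtain ⟨b, hb, a, ha, hr⟩ := h
  obtain ⟨s, rfl⟩ := List.mem_getLast?_eq_getLast hb |> fun ⟨h, e⟩ =>
    (⟨l.dropLast, by rw [e, List.dropLast_append_getLast h]⟩ : ∃ s, l = s ++ [b])
  obtain ⟨t, rfl⟩ : ∃ t, r = a :: t := ⟨r.tail, (List.eq_cons_of_mem_head? ha)⟩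
  exact ⟨b, a, hr, s, t, by simp⟩

theorem diff_single (c : ι → k) (σ : Word V ι) (i : ι) (x : Alg k rel) :
    diff k rel c σ (Finsupp.single i x) = x • row k rel c σ i := by
  rw [diff, Finsupp.linearCombination_single]

open Classical in
theorem diff_row {σ : Word V ι} (hσ : σ.IsWalk rel) (c : ι → k) (i : ι) :
    diff k rel c σ (row k rel c σ i) = 0 := by
  have key : ∀ (r s : k) (l m : List (Arr V)) (j : ι),
      (∃ b ∈ l.getLast?, ∃ a ∈ m.head?, rel b a) →
      (r • eval k rel l) • Finsupp.single j (s • eval k rel m) = 0 := by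
    intro r s l m j h
    rw [Finsupp.smul_single, smul_eq_mul, smul_mul_smul_comm, ← eval_append,
      eval_eq_zero k rel (hasRel_append rel h), smul_zero, Finsupp.single_zero]
  rw [row, map_add]
  have h1 : diff k rel c σ (if σ.HasLetter i ∧ (σ.letter i).direct = true then
      Finsupp.single (i - 1) (c i • eval k rel (σ.letter i).path) else 0) = 0 := by
    split_ifs with h
    · rw [diff_single, row, sub_add_cancel, smul_add, if_neg (c := _ ∧ _ = false), smul_zero,
        add_zero]
      · split_ifs with h'
        · apply key
          have := hσ.adj (i - 1)
          rw [sub_add_cancel] at this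
          have := this h.1 h'.1
          rw [Letter.Adj, h.2, h'.2] at this
          exact this
        · exact smul_zero _
      · rintro ⟨-, h2⟩
        rw [h.2] at h2
        exact Bool.noConfusion h2
    · exact map_zero _
  have h2 : diff k rel c σ (if σ.HasLetter (i + 1) ∧ (σ.letter (i + 1)).direct = false then
      Finsupp.single (i + 1) (c (i + 1) • eval k rel (σ.letter (i + 1)).path) else 0) = 0 := by
    split_ifs with h
    · rw [diff_single, row, smul_add, if_neg (c := _ ∧ _ = true), smul_zero, zero_add]
      · split_ifs with h'
        · apply key
          have := hσ.adj (i + 1) h'.1 h.1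
          rw [Letter.Adj, h.2, h'.2] at this
          exact this
        · exact smul_zero _
      · rintro ⟨-, h2⟩
        rw [h.2] at h2
        exact Bool.noConfusion h2
    · exact map_zero _
  rw [h1, h2, add_zero]

theorem diff_diff {σ : Word V ι} (hσ : σ.IsWalk rel) (c : ι → k) (g : ι →₀ Alg k rel) :
    diff k rel c σ (diff k rel c σ g) = 0 := by
  have : (diff k rel c σ).comp (diff k rel c σ) = 0 := by
    apply Finsupp.lhom_ext
    intro i x
    rw [LinearMap.comp_apply, diff_single, map_smul, diff_row k rel hσ, smul_zero]
    rfl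
  exact LinearMap.congr_fun this g

/-- The complex of a word with scalars `c i` placed on its letters. -/
noncomputable def wordComplex (c : ι → k) (σ : Word V ι) (hσ : σ.IsWalk rel) :
    CochainComplex (ModuleCat.{max u v w} (Alg k rel)) ℤ where
  X n := ModuleCat.of (Alg k rel) (term k rel σ n)
  d m n := if h : m + 1 = n then
      ModuleCat.ofHom ((diff k rel c σ).restrict fun _ hg => diff_mem k rel hσ c h hg)
    else 0
  shape m n h := dif_neg h
  d_comp_d' l m n hl hm := by
    have hl' : l + 1 = m := hl
    have hm' : m + 1 = n := hm
    rw [dif_pos hl', dif_pos hm']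
    apply ModuleCat.hom_ext
    apply LinearMap.ext
    intro g
    apply Subtype.ext
    exact diff_diff k rel hσ c g.1

/-- The string complex `P_σ`. -/
noncomputable def stringComplex (σ : Word V ℤ) (hσ : σ.IsHomotopyString rel) :
    CochainComplex (ModuleCat.{max u v w} (Alg k rel)) ℤ :=
  wordComplex k rel (fun _ => 1) σ hσ.toIsWalk

open Classical in
/-- The band complex `B_{τ,μ}`, with the scalar `μ` placed on the `j`-th homotopy letter. -/
noncomputable def bandComplex {n : ℕ} (τ : Word V (ZMod n)) (hτ : τ.IsHomotopyBand rel)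
    (μ : k) (j : ZMod n) : CochainComplex (ModuleCat.{max u v w} (Alg k rel)) ℤ :=
  wordComplex k rel (fun i => if i = j then μ else 1) τ hτ.toIsWalk

/-! ### Single maps -/

section SingleMaps

variable {V : Type v} [Quiver.{w} V]

/-- The nontrivial path `f` in `(Q, I)`, placed between the node `p` of `σ` and the node `q` of `τ`,
defines a single map `Q_σ → Q_τ`.  With `σ_L = letter (p + 1)` and `σ_R = letter p` in `σ`, and
`τ_L = letter (q + 1)` and `τ_R = letter q` in `τ` (each of which may fail to exist), the last four
fields say that every product of `f` with the differential of `σ` or `τ` has a subpath in `I`. -/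
structure IsSingleMap {ι κ : Type} [CommRing ι] [CommRing κ] (rel : Arr V → Arr V → Prop)
    (σ : Word V ι) (τ : Word V κ) (p : ι) (q : κ) (f : List (Arr V)) : Prop where
  mem_left : p ∈ σ.node
  mem_right : q ∈ τ.node
  deg_eq : σ.deg p = τ.deg q
  isPath : IsPath rel (σ.vtx p) (τ.vtx q) f
  l1 : σ.HasLetter (p + 1) → (σ.letter (p + 1)).direct = true →
    HasRel rel ((σ.letter (p + 1)).path ++ f)
  l2 : τ.HasLetter (q + 1) → (τ.letter (q + 1)).direct = false →
    HasRel rel (f ++ (τ.letter (q + 1)).path)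
  r1 : σ.HasLetter p → (σ.letter p).direct = false → HasRel rel ((σ.letter p).path ++ f)
  r2 : τ.HasLetter q → (τ.letter q).direct = true → HasRel rel (f ++ (τ.letter q).path)

/-- `σ = β σ_L σ_R α` and `τ = δ τ_L τ_R γ` are compatibly oriented for the single map with
component `f`, where the letters are named as in `IsSingleMap`.  Any of the four letters may be
empty.  The condition that `σ_L f = 0` if `σ_L` is direct and `f τ_L⁻¹ = 0` if `τ_L` is
inverse is contained in `IsSingleMap`. -/
structure CompatiblyOriented {ι κ : Type} [CommRing ι] [CommRing κ]
    (σ : Word V ι) (τ : Word V κ) (p : ι) (q : κ) (f : List (Arr V)) : Prop where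
  /-- `σ_L` does not contain `f` as a subletter; only an occurrence of `f` that begins at the node
  `p` is excluded here -/
  left_σ : σ.HasLetter (p + 1) → (σ.letter (p + 1)).direct = false →
    ¬ f <+: (σ.letter (p + 1)).path
  /-- `τ_L` does not contain `f` as a subletter; only an occurrence of `f` that ends at the node
  `q` is excluded here -/
  left_τ : τ.HasLetter (q + 1) → (τ.letter (q + 1)).direct = true →
    ¬ f <:+ (τ.letter (q + 1)).path
  /-- `σ_R = f f_R` for a possibly trivial path `f_R` -/
  right_σ : σ.HasLetter p → (σ.letter p).direct = true ∧ f <+: (σ.letter p).path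
  /-- `τ_R⁻¹ = f_L f` for a possibly trivial path `f_L` -/
  right_τ : τ.HasLetter q → (τ.letter q).direct = false ∧ f <:+ (τ.letter q).path

end SingleMaps

variable {κ : Type} [CommRing κ]

open Classical in
/-- Right multiplication by `f` from the node `p` to the node `q`, and zero elsewhere. -/
noncomputable def singleTotal (p : ι) (q : κ) (f : List (Arr V)) :
    (ι →₀ Alg k rel) →ₗ[Alg k rel] (κ →₀ Alg k rel) :=
  Finsupp.linearCombination (Alg k rel)
    (fun i => if i = p then Finsupp.single q (eval k rel f) else 0)

theorem singleTotal_mem {σ : Word V ι} {τ : Word V κ} {p : ι} {q : κ} {f : List (Arr V)}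
    (hf : IsSingleMap rel σ τ p q f) {n : ℤ} {g : ι →₀ Alg k rel} (hg : g ∈ term k rel σ n) :
    singleTotal k rel p q f g ∈ term k rel τ n := by
  rw [singleTotal, Finsupp.linearCombination_apply]
  refine Submodule.sum_mem _ fun i hi => Submodule.smul_mem _ _ ?_
  have h2 := ((hg i).2 (Finsupp.mem_support_iff.1 hi)).2
  split_ifs with h
  · subst h
    exact single_mem_term k rel (eval_mem_P k rel hf.isPath) hf.mem_right (hf.deg_eq ▸ h2)
  · exact Submodule.zero_mem _

open Classical in
theorem singleTotal_diff {σ : Word V ι} {τ : Word V κ} {p : ι} {q : κ} {f : List (Arr V)}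
    (hf : IsSingleMap rel σ τ p q f) (c : ι → k) (g : ι →₀ Alg k rel) :
    singleTotal k rel p q f (diff k rel c σ g) = 0 := by
  have key : ∀ (r : k) (l : List (Arr V)) (j : ι), (j = p → HasRel rel (l ++ f)) →
      singleTotal k rel p q f (Finsupp.single j (r • eval k rel l)) = 0 := by
    intro r l j h
    rw [singleTotal, Finsupp.linearCombination_single]
    split_ifs with hj
    · rw [Finsupp.smul_single, smul_eq_mul, smul_mul_assoc, ← eval_append,
        eval_eq_zero k rel (h hj), smul_zero, Finsupp.single_zero]
    · exact smul_zero _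
  have : (singleTotal k rel p q f).comp (diff k rel c σ) = 0 := by
    apply Finsupp.lhom_ext
    intro i x
    rw [LinearMap.comp_apply, diff_single, map_smul, row, map_add]
    have h1 : singleTotal k rel p q f (if σ.HasLetter i ∧ (σ.letter i).direct = true then
        Finsupp.single (i - 1) (c i • eval k rel (σ.letter i).path) else 0) = 0 := by
      split_ifs with h
      · refine key _ _ _ fun hj => ?_
        obtain rfl : i = p + 1 := by rw [← hj]; ring
        exact hf.l1 h.1 h.2
      · exact map_zero _
    have h2 : singleTotal k rel p q f
        (if σ.HasLetter (i + 1) ∧ (σ.letter (i + 1)).direct = false then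
        Finsupp.single (i + 1) (c (i + 1) • eval k rel (σ.letter (i + 1)).path) else 0) = 0 := by
      split_ifs with h
      · refine key _ _ _ fun hj => ?_
        subst hj
        exact hf.r1 h.1 h.2
      · exact map_zero _
    rw [h1, h2, add_zero, smul_zero]
    rfl
  exact LinearMap.congr_fun this g

open Classical in
theorem diff_singleTotal {σ : Word V ι} {τ : Word V κ} {p : ι} {q : κ} {f : List (Arr V)}
    (hf : IsSingleMap rel σ τ p q f) (c : κ → k) (g : ι →₀ Alg k rel) :
    diff k rel c τ (singleTotal k rel p q f g) = 0 := by
  have key : diff k rel c τ (Finsupp.single q (eval k rel f)) = 0 := by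
    rw [diff_single, row, smul_add]
    have h1 : eval k rel f • (if τ.HasLetter q ∧ (τ.letter q).direct = true then
        Finsupp.single (q - 1) (c q • eval k rel (τ.letter q).path) else 0) = 0 := by
      split_ifs with h
      · rw [Finsupp.smul_single, smul_eq_mul, mul_smul_comm, ← eval_append,
          eval_eq_zero k rel (hf.r2 h.1 h.2), smul_zero, Finsupp.single_zero]
      · exact smul_zero _
    have h2 : eval k rel f • (if τ.HasLetter (q + 1) ∧ (τ.letter (q + 1)).direct = false then
        Finsupp.single (q + 1) (c (q + 1) • eval k rel (τ.letter (q + 1)).path) else 0) = 0 := by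
      split_ifs with h
      · rw [Finsupp.smul_single, smul_eq_mul, mul_smul_comm, ← eval_append,
          eval_eq_zero k rel (hf.l2 h.1 h.2), smul_zero, Finsupp.single_zero]
      · exact smul_zero _
    rw [h1, h2, add_zero]
  have : (diff k rel c τ).comp (singleTotal k rel p q f) = 0 := by
    apply Finsupp.lhom_ext
    intro i x
    rw [LinearMap.comp_apply, singleTotal, Finsupp.linearCombination_single, map_smul]
    split_ifs with h
    · rw [key, smul_zero]
      rfl
    · rw [map_zero, smul_zero]
      rfl
  exact LinearMap.congr_fun this g

/-- The cochain map with the single component `f : P(vtx p) → P(vtx q)`. -/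
noncomputable def wordSingleMap {σ : Word V ι} {τ : Word V κ} {p : ι} {q : κ} {f : List (Arr V)}
    (c : ι → k) (c' : κ → k) (hσ : σ.IsWalk rel) (hτ : τ.IsWalk rel)
    (hf : IsSingleMap rel σ τ p q f) :
    wordComplex k rel c σ hσ ⟶ wordComplex k rel c' τ hτ where
  f n := ModuleCat.ofHom
    ((singleTotal k rel p q f).restrict fun _ hg => singleTotal_mem k rel hf (n := n) hg)
  comm' m n h := by
    have h' : m + 1 = n := h
    simp only [wordComplex, dif_pos h']
    apply ModuleCat.hom_ext
    apply LinearMap.ext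
    intro g
    apply Subtype.ext
    exact (diff_singleTotal k rel hf c' g.1).trans (singleTotal_diff k rel hf c g.1).symm

/-- The single map `P_σ → B_{τ,μ}` with single component `f`. -/
noncomputable def singleMap {n : ℕ} {σ : Word V ℤ} {τ : Word V (ZMod n)} {p : ℤ} {q : ZMod n}
    {f : List (Arr V)} (hσ : σ.IsHomotopyString rel) (hτ : τ.IsHomotopyBand rel) (μ : k)
    (j : ZMod n) (hf : IsSingleMap rel σ τ p q f) :
    stringComplex k rel σ hσ ⟶ bandComplex k rel τ hτ μ j :=
  wordSingleMap k rel _ _ hσ.toIsWalk hτ.toIsWalk hf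

end Complexes

/-! ### The homotopy string of the mapping cone -/

section Cone

variable {V : Type v} [Quiver.{w} V]

/-- The word `β σ_L f τ_L⁻¹ δ⁻¹ γ⁻¹` if `σ_R` is empty, and
`β σ_L f τ_L⁻¹ δ⁻¹ γ⁻¹ (τ_R⁻¹ f⁻¹ σ_R) α` otherwise, where `σ = β σ_L σ_R α` and the cyclic word
`τ = δ τ_L τ_R γ` are cut at the nodes `p` and `q`, and where
`τ_R⁻¹ f⁻¹ σ_R = f_L f f⁻¹ f f_R = f_L f f_R` is one direct homotopy letter.  From left to right its
nodes are:
* the nodes `i ≥ p` of `σ`, with their indices;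
* the nodes `q, q + 1, …, q + (n - 1) = q - 1` of `τ`, with the indices `p - 1, …, p - n`;
* the nodes `i < p` of `σ`, if any, with the indices `i - n`.
The nodes of `σ` have moved down by one degree, as in the mapping cone. -/
def coneWord {n : ℕ} (σ : Word V ℤ) (τ : Word V (ZMod n)) (p : ℤ) (q : ZMod n)
    (f : List (Arr V)) : Word V ℤ where
  node := {i | (p ≤ i ∧ i ∈ σ.node) ∨ (p - n ≤ i ∧ i < p) ∨ (i < p - n ∧ i + n ∈ σ.node)}
  vtx i :=
    if p ≤ i then σ.vtx i
    else if p - n ≤ i then τ.vtx (q + (p - 1 - i : ℤ))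
    else σ.vtx (i + n)
  deg i :=
    if p ≤ i then σ.deg i - 1
    else if p - n ≤ i then τ.deg (q + (p - 1 - i : ℤ))
    else σ.deg (i + n) - 1
  letter i :=
    if p < i then σ.letter i
    else if i = p then ⟨true, f⟩
    else if p - n < i then (τ.letter (q + (p - i : ℤ))).inv
    else if i = p - n then ⟨true, (τ.letter q).path ++ (σ.letter p).path.drop f.length⟩
    else σ.letter (i + n)

end Cone

end Gentle

namespace Gentle

/-! ### Combinatorics of paths -/

section Lists

variable {α : Type*} {r : α → α → Prop}

/-! The terms of the cone of $f^\bullet$ are those of $P_\sigma[1]\oplus B_{\tau,\mu}$, and the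
nodes of $c$ are exactly the nodes of $\sigma$ and one turn of $\overline\tau$. Sending every node
of $c$ to the node it comes from is bijective but not a chain map: around the two gluing places, $c$
has the letters $f$ and $f_Lff_R$, where $\sigma$ and $\tau$ have $ff_R$ and $f_Lf$. The map is
therefore corrected by two graph maps from $P_c$ to $P_\sigma[1]$. The first, with coefficients `a`,
is the identity on the nodes $i\ge p$ and is continued to the right. The second, with coefficients
`b`, is the identity on the right part of $\sigma$ (after a shift by $n$), has component $f_L$ at
$p$, and is continued to the left. Together with the projection onto the band, alternating signs and
suitable scalars, they form a chain map to the cone.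

Why `a` and `b` exist (`exists_right`, `exists_left`): the only hard cases are $f_R$ trivial, where
`a` must go on past $\sigma_R=f$, and $f_L$ trivial, where `b` must go on past
$\overline{\tau_R}=f$. There the periodic unrolled word of $\overline\tau$ has to be compared with
$\sigma$. By gentleness, two words that continue the same letter have comparable letters where they
first differ, so a graph map in one of the two directions ends there (`ends_or_ends`,
`ends_or_exists_rightTail`). A map towards $\sigma$ is what is needed. A map from $\sigma$ to the
unrolled band, cut off at $p$ and folded onto $\tau$, is a homotopy with boundary $f$ after
normalization (`quotient_map_eq_zero_of_coefficients`), which contradicts $f^\bullet\neq 0$. If the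
words never differ, the identity also gives such a homotopy. The left side follows by reversing the
words.

Why the map is bijective (`ofString_add_ofBand`): composed with the naive inverse it becomes
$(1+R)(1+L)$, where $R$ moves nodes to the right by $n$ with coefficients from `a`, and $L$ to the
left with coefficients from `b`. Both are nilpotent because `a` and `b` vanish far out. Hence the
cone is isomorphic to $P_c$ already as a complex.

That $c$ is a homotopy string is inherited from $\sigma$ and $\tau$, except that $\sigma_L$ must not
cancel with $f$ and must meet it in a relation if it is direct; see `exists_glueable`. -/

theorem prefix_or_prefix_of_head? (hr : ∀ a, {c | r a c}.Subsingleton) :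
    ∀ {l m : List α}, l.IsChain r → m.IsChain r → l.head? = m.head? → l <+: m ∨ m <+: l
  | [], _, _, _, _ => Or.inl (List.nil_prefix)
  | _ :: _, [], _, _, _ => Or.inr (List.nil_prefix)
  | a :: l, b :: m, hl, hm, h => by
    obtain rfl : a = b := by simpa using h
    have key : l <+: m ∨ m <+: l := by
      rcases l with _ | ⟨x, l⟩
      · exact Or.inl List.nil_prefix
      rcases m with _ | ⟨y, m⟩
      · exact Or.inr List.nil_prefix
      rw [List.isChain_cons_cons] at hl hm
      exact prefix_or_prefix_of_head? hr hl.2 hm.2 (by simpa using hr a hl.1 hm.1)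
    simpa [List.cons_prefix_cons] using key

theorem suffix_or_suffix_of_getLast? (hr : ∀ a, {b | r b a}.Subsingleton) {l m : List α}
    (hl : l.IsChain r) (hm : m.IsChain r) (h : l.getLast? = m.getLast?) :
    l <:+ m ∨ m <:+ l := by
  rw [← List.reverse_prefix, ← List.reverse_prefix]
  refine prefix_or_prefix_of_head? (r := fun a b => r b a) hr ?_ ?_ (by simpa using h)
  · exact List.isChain_reverse.2 hl
  · exact List.isChain_reverse.2 hm

end Lists

/-! ### Paths in a gentle quiver -/

section Paths

variable {V : Type v} [Quiver.{w} V] {rel : Arr V → Arr V → Prop}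

theorem IsPath.exists_head {x y : V} {l : List (Arr V)} (h : IsPath rel x y l) :
    ∃ a, l.head? = some a ∧ a.right = x := by
  obtain ⟨a, m, rfl⟩ := List.exists_cons_of_ne_nil h.ne_nil
  exact ⟨a, rfl, h.ends a rfl⟩

theorem IsPath.exists_getLast {x y : V} {l : List (Arr V)} (h : IsPath rel x y l) :
    ∃ a, l.getLast? = some a ∧ a.left = y := by
  have := List.getLast?_eq_some_getLast h.ne_nil
  exact ⟨_, this, h.starts _ this⟩

theorem IsPath.of_append_right {x y : V} {l m : List (Arr V)} (h : IsPath rel x y (l ++ m))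
    (hm : m ≠ []) : ∃ z, IsPath rel z y m := by
  obtain ⟨a, t, rfl⟩ := List.exists_cons_of_ne_nil hm
  refine ⟨a.right, hm, (List.isChain_append.1 h.chain).2.1, by simp, fun b hb => h.starts b ?_⟩
  rw [List.getLast?_append_of_ne_nil _ hm]
  exact hb

theorem IsPath.of_append_left {x y x' y' : V} {l m : List (Arr V)} (h : IsPath rel x y (l ++ m))
    (hm : IsPath rel x' y' m) (hl : l ≠ []) : IsPath rel x x' l := by
  refine ⟨hl, (List.isChain_append.1 h.chain).1, fun a ha => h.ends a ?_, fun b hb => ?_⟩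
  · rw [List.head?_append_of_ne_nil _ hl]
    exact ha
  · obtain ⟨a, ha, rfl⟩ := hm.exists_head
    exact ((List.isChain_append.1 h.chain).2.2 b hb a ha).1

/-- Two nontrivial paths which overlap in a nontrivial path can be glued. -/
theorem IsPath.glue {x y z t : V} {l f m : List (Arr V)} (hf : f ≠ [])
    (h₁ : IsPath rel x y (l ++ f)) (h₂ : IsPath rel z t (f ++ m)) :
    IsPath rel x t (l ++ f ++ m) := by
  refine ⟨by simp [hf], ?_, fun a ha => h₁.ends a ?_, fun b hb => h₂.starts b ?_⟩
  · refine List.isChain_append.2 ⟨h₁.chain, (List.isChain_append.1 h₂.chain).2.1, ?_⟩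
    intro b hb a ha
    rw [List.getLast?_append_of_ne_nil _ hf] at hb
    exact (List.isChain_append.1 h₂.chain).2.2 b hb a ha
  · rwa [List.head?_append_of_ne_nil _ (by simp [hf])] at ha
  · rw [List.append_assoc, List.getLast?_append_of_ne_nil _ (by simp [hf])] at hb
    exact hb

/-- Neither path contains a relation, so the relation must sit at the junction. This converts the
vanishing conditions of a single map into the adjacency condition for letters. -/
theorem rel_of_hasRel_append {x y z t : V} {l m : List (Arr V)} (hl : IsPath rel x y l)
    (hm : IsPath rel z t m) (h : HasRel rel (l ++ m)) :
    ∃ b ∈ l.getLast?, ∃ a ∈ m.head?, rel b a := by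
  by_contra hc
  push Not at hc
  have hch : (l ++ m).IsChain (fun b a => ¬ rel b a) :=
    List.isChain_append.2 ⟨hl.chain.imp fun _ _ h => h.2, hm.chain.imp fun _ _ h => h.2, hc⟩
  obtain ⟨b, a, hr, hi⟩ := h
  have := hch.infix hi
  simp at this
  exact this hr

theorem IsPath.not_rel_of_append {x y : V} {l m : List (Arr V)} (h : IsPath rel x y (l ++ m))
    {b a : Arr V} (hb : l.getLast? = some b) (ha : m.head? = some a) :
    b.left = a.right ∧ ¬ rel b a :=
  (List.isChain_append.1 h.chain).2.2 b hb a ha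

/-- This is how the bound of two arrows at a vertex enters: two letters that both do not cancel with
a given third one must begin with the same arrow. -/
theorem eq_of_three {S : Set (Arr V)} (hS : S.encard ≤ 2) {a b c : Arr V} (ha : a ∈ S)
    (hb : b ∈ S) (hc : c ∈ S) (hab : a ≠ b) (hac : a ≠ c) : b = c := by
  by_contra hbc
  have h3 : ({a, b, c} : Set (Arr V)).encard = 3 := Set.encard_eq_three.2
    ⟨a, b, c, hab, hac, hbc, rfl⟩
  have := (Set.encard_le_encard (show ({a, b, c} : Set (Arr V)) ⊆ S by
    rintro x (rfl | rfl | rfl) <;> assumption)).trans hS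
  rw [h3] at this
  exact absurd this (by decide)

/-- Letters that may stand to the right of the same letter are comparable, if they have the same
direction. -/
theorem IsGentle.comparable (hg : IsGentle rel) {L l m : Letter V} {s x y y' : V}
    (hL : L.Joins rel s x) (hl : l.Joins rel x y) (hm : m.Joins rel x y')
    (h₁ : L.Adj rel l) (h₂ : L.Adj rel m) (hlm : l.direct = m.direct) :
    (l.direct = true → l.path <+: m.path ∨ m.path <+: l.path) ∧
    (l.direct = false → l.path <:+ m.path ∨ m.path <:+ l.path) := by
  have pre {a b a' b'} {l m : List (Arr V)} (hl : IsPath rel a b l) (hm : IsPath rel a' b' m)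
      (h : l.head? = m.head?) : l <+: m ∨ m <+: l :=
    prefix_or_prefix_of_head? hg.pre_free hl.chain hm.chain h
  have suf {a b a' b'} {l m : List (Arr V)} (hl : IsPath rel a b l) (hm : IsPath rel a' b' m)
      (h : l.getLast? = m.getLast?) : l <:+ m ∨ m <:+ l :=
    suffix_or_suffix_of_getLast? hg.post_free hl.chain hm.chain h
  obtain ⟨dL, L⟩ := L
  obtain ⟨dl, l⟩ := l
  obtain ⟨dm, m⟩ := m
  obtain rfl : dl = dm := hlm
  cases dL <;> cases dl <;> simp [Letter.Joins, Letter.Adj] at hL hl hm h₁ h₂ ⊢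
  · obtain ⟨b, hb, a, ha, hr⟩ := h₁
    obtain ⟨b', hb', a', ha', hr'⟩ := h₂
    rw [ha] at ha'
    obtain rfl : a = a' := by simpa using ha'
    exact suf hl hm (by rw [hb, hb', hg.post_rel a hr hr'])
  · obtain ⟨a, ha, hax⟩ := hL.exists_head
    obtain ⟨b, hb, hbx⟩ := hl.exists_head
    obtain ⟨c, hc, hcx⟩ := hm.exists_head
    rw [ha, hb] at h₁
    rw [ha, hc] at h₂
    refine pre hl hm ?_
    rw [hb, hc, eq_of_three (hg.in_le x) hax hbx hcx (by simpa using h₁) (by simpa using h₂)]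
  · obtain ⟨a, ha, hax⟩ := hL.exists_getLast
    obtain ⟨b, hb, hbx⟩ := hl.exists_getLast
    obtain ⟨c, hc, hcx⟩ := hm.exists_getLast
    rw [ha, hb] at h₁
    rw [ha, hc] at h₂
    refine suf hl hm ?_
    rw [hb, hc, eq_of_three (hg.out_le x) hax hbx hcx (by simpa using h₁) (by simpa using h₂)]
  · obtain ⟨b, hb, a, ha, hr⟩ := h₁
    obtain ⟨b', hb', a', ha', hr'⟩ := h₂
    rw [hb] at hb'
    obtain rfl : b = b' := by simpa using hb'
    exact pre hl hm (by rw [ha, ha', hg.pre_rel b hr hr'])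

/-- If `x w` is a path outside `I`, and `z` starts with another arrow than `x` at the same vertex,
then `z w` lies in `I`. -/
theorem IsGentle.rel_of_getLast_ne (hg : IsGentle rel) {s t s' s'' y : V}
    {x w z : List (Arr V)} (hxw : IsPath rel s t (x ++ w)) (hx : IsPath rel s'' y x) (hw : w ≠ [])
    (hz : IsPath rel s' y z) (hne : x.getLast? ≠ z.getLast?) :
    ∃ b ∈ z.getLast?, ∃ a ∈ w.head?, rel b a := by
  obtain ⟨b, hb, hby⟩ := hx.exists_getLast
  obtain ⟨c, hc, hcy⟩ := hz.exists_getLast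
  obtain ⟨a, m, rfl⟩ := List.exists_cons_of_ne_nil hw
  have h := hxw.not_rel_of_append hb (a := a) rfl
  refine ⟨c, hc, a, rfl, ?_⟩
  by_contra hr
  exact hne (by rw [hb, hc, hg.post_free a h ⟨by rw [hcy, ← hby, h.1], hr⟩])

/-- If `w y` is a path outside `I`, and `z` ends with another arrow than `y` at the same vertex,
then `w z` lies in `I`. -/
theorem IsGentle.rel_of_head_ne (hg : IsGentle rel) {s t t' t'' x : V} {w y z : List (Arr V)}
    (hwy : IsPath rel s t (w ++ y)) (hy : IsPath rel x t'' y) (hw : w ≠ [])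
    (hz : IsPath rel x t' z) (hne : y.head? ≠ z.head?) :
    ∃ b ∈ w.getLast?, ∃ a ∈ z.head?, rel b a := by
  obtain ⟨b, hb, hby⟩ := hy.exists_head
  obtain ⟨c, hc, hcy⟩ := hz.exists_head
  have ha := List.getLast?_eq_some_getLast hw
  have h := hwy.not_rel_of_append ha hb
  refine ⟨_, ha, c, hc, ?_⟩
  by_contra hr
  exact hne (by rw [hb, hc, hg.pre_free _ h ⟨by rw [hcy, ← hby, h.1], hr⟩])

end Paths

/-! ### Maps between words with the same indices -/

section WordMaps

variable {V : Type v} [Quiver.{w} V] {rel : Arr V → Arr V → Prop}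

@[simp] theorem Letter.inv_inv (l : Letter V) : l.inv.inv = l := by
  simp [Letter.inv]

@[simp] theorem Letter.inv_direct (l : Letter V) : l.inv.direct = !l.direct := rfl

@[simp] theorem Letter.inv_path (l : Letter V) : l.inv.path = l.path := rfl

theorem Letter.Joins.inv {l : Letter V} {x y : V} (h : l.Joins rel x y) : l.inv.Joins rel y x := by
  obtain ⟨d, l⟩ := l
  cases d <;> simpa [Letter.Joins] using h

theorem Letter.Adj.inv {l r : Letter V} (h : l.Adj rel r) : r.inv.Adj rel l.inv := by
  obtain ⟨d, l⟩ := l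
  obtain ⟨d', r⟩ := r
  cases d <;> cases d' <;> simp only [Letter.Adj, Letter.inv, Bool.not_true, Bool.not_false] at h ⊢
  exacts [h, h.symm, h.symm, h]

theorem IsPath.ends_unique {x y x' y' : V} {l : List (Arr V)} (h : IsPath rel x y l)
    (h' : IsPath rel x' y' l) : x = x' ∧ y = y' := by
  obtain ⟨a, ha, rfl⟩ := h.exists_head
  obtain ⟨b, hb, rfl⟩ := h.exists_getLast
  exact ⟨h'.ends a ha, h'.starts b hb⟩

theorem Letter.Joins.ends_unique {l : Letter V} {x y x' y' : V} (h : l.Joins rel x y)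
    (h' : l.Joins rel x' y') : x = x' ∧ y = y' := by
  unfold Letter.Joins at h h'
  split_ifs at h h'
  · exact h.ends_unique h'
  · exact (h.ends_unique h').symm

theorem Letter.Joins.of_direct {l : Letter V} {x y : V} (h : l.Joins rel x y)
    (hl : l.direct = true) : IsPath rel x y l.path := by
  rwa [Letter.Joins, if_pos hl] at h

theorem Letter.Joins.of_inverse {l : Letter V} {x y : V} (h : l.Joins rel x y)
    (hl : l.direct = false) : IsPath rel y x l.path := by
  rwa [Letter.Joins, if_neg (by simp [hl])] at h

/-- The word `u` read from right to left. -/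
def Word.reverse (u : Word V ℤ) : Word V ℤ where
  node := {i | -i ∈ u.node}
  vtx i := u.vtx (-i)
  deg i := u.deg (-i)
  letter i := (u.letter (1 - i)).inv

theorem Word.hasLetter_reverse {u : Word V ℤ} {i : ℤ} :
    u.reverse.HasLetter i ↔ u.HasLetter (1 - i) := by
  have h1 : -(i - 1) = 1 - i := by ring
  have h2 : 1 - i - 1 = -i := by ring
  simp only [Word.HasLetter, Word.reverse, Set.mem_ofPred_eq, h1, h2]
  exact and_comm

theorem Word.IsWalk.reverse {u : Word V ℤ} (hu : u.IsWalk rel) : u.reverse.IsWalk rel where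
  joins i h := by
    have := (hu.joins _ (Word.hasLetter_reverse.1 h)).inv
    rw [show 1 - i - 1 = -i by ring] at this
    simpa only [Word.reverse, show -(i - 1) = 1 - i by ring] using this
  adj i h h' := by
    rw [Word.hasLetter_reverse] at h h'
    have := hu.adj (1 - (i + 1)) (by rwa [show 1 - (i + 1) + 1 = 1 - i by ring]) h
    rw [show 1 - (i + 1) + 1 = 1 - i by ring] at this
    exact this.inv
  deg_eq i h := by
    have := hu.deg_eq _ (Word.hasLetter_reverse.1 h)
    rw [show 1 - i - 1 = -i by ring] at this
    simp only [Word.reverse, show -(i - 1) = 1 - i by ring, this, Letter.inv_direct]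
    cases (u.letter (1 - i)).direct <;> simp

/-- The words `u` and `v` have the same `i`-th letter. -/
structure Word.AgreeAt (u v : Word V ℤ) (i : ℤ) : Prop where
  left : u.HasLetter i
  right : v.HasLetter i
  letter : u.letter i = v.letter i

/-- The words `u` and `v` have the same vertex at the node `i` of `u`, in degrees that differ
by `δ`. -/
structure Word.MatchAt (δ : ℤ) (u v : Word V ℤ) (i : ℤ) : Prop where
  node : i ∈ v.node
  vtx : u.vtx i = v.vtx i
  deg : v.deg i = u.deg i + δ

theorem Word.MatchAt.symm {δ : ℤ} {u v : Word V ℤ} {i : ℤ} (h : u.MatchAt δ v i)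
    (hi : i ∈ u.node) : v.MatchAt (-δ) u i :=
  ⟨hi, h.vtx.symm, by rw [h.deg]; ring⟩

theorem Word.AgreeAt.matchAt_pred {δ : ℤ} {u v : Word V ℤ} {i : ℤ} (h : u.AgreeAt v i)
    (hu : u.IsWalk rel) (hv : v.IsWalk rel) (hm : u.MatchAt δ v i) :
    u.MatchAt δ v (i - 1) := by
  refine ⟨h.right.2, ((hu.joins i h.left).ends_unique (h.letter ▸ hv.joins i h.right)).2, ?_⟩
  rw [hv.deg_eq i h.right, hu.deg_eq i h.left, h.letter, hm.deg]
  split_ifs <;> ring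

theorem Word.matchAt_of_agreeAt {δ : ℤ} {u v : Word V ℤ} {m : ℤ}
    (hu : u.IsWalk rel) (hv : v.IsWalk rel) (hm : u.MatchAt δ v m) (hmu : m ∈ u.node) {j : ℤ}
    (hj : j ≤ m) (h : ∀ i, j < i → i ≤ m → u.AgreeAt v i) : u.MatchAt δ v j ∧ j ∈ u.node := by
  induction j, hj using Int.leInductionDown with
  | base => exact ⟨hm, hmu⟩
  | pred j hj ih =>
    have hj' := h j (by omega) hj
    exact ⟨hj'.matchAt_pred hu hv (ih fun i h1 h2 => h i (by omega) h2).1, hj'.left.2⟩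

end WordMaps

/-! ### Diagonal maps between words, and the comparison of two words -/

section WordMaps

variable (k : Type u) [Field k] {V : Type v} [Fintype V] [Quiver.{w} V]
  (rel : Arr V → Arr V → Prop) {ι : Type} [CommRing ι]

open Classical in
/-- The element of `Λ` given by the `i`-th letter if that letter exists and is direct. -/
noncomputable def Word.fwd (u : Word V ι) (i : ι) : Alg k rel :=
  if u.HasLetter i ∧ (u.letter i).direct = true then eval k rel (u.letter i).path else 0

open Classical in
/-- The element of `Λ` given by the `i`-th letter if that letter exists and is inverse. -/
noncomputable def Word.bwd (u : Word V ι) (i : ι) : Alg k rel :=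
  if u.HasLetter i ∧ (u.letter i).direct = false then eval k rel (u.letter i).path else 0

/-- With elements of $\Lambda$ that vanish for a missing letter or a letter of the other direction,
the chain map conditions become uniform identities in $\Lambda$ without case distinctions. -/
theorem row_eq (c : ι → k) (u : Word V ι) (i : ι) :
    row k rel c u i = Finsupp.single (i - 1) (c i • u.fwd k rel i) +
      Finsupp.single (i + 1) (c (i + 1) • u.bwd k rel (i + 1)) := by
  unfold row Word.fwd Word.bwd
  congr 1 <;> split_ifs <;> simp

variable {rel}

theorem Word.fwd_of_direct {u : Word V ι} {i : ι} (h : u.HasLetter i)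
    (hd : (u.letter i).direct = true) : u.fwd k rel i = eval k rel (u.letter i).path :=
  if_pos ⟨h, hd⟩

theorem Word.fwd_of_inverse {u : Word V ι} {i : ι} (hd : (u.letter i).direct = false) :
    u.fwd k rel i = 0 := if_neg (by simp [hd])

theorem Word.fwd_of_not {u : Word V ι} {i : ι} (h : ¬ u.HasLetter i) :
    u.fwd k rel i = 0 := if_neg (by simp [h])

theorem Word.bwd_of_inverse {u : Word V ι} {i : ι} (h : u.HasLetter i)
    (hd : (u.letter i).direct = false) : u.bwd k rel i = eval k rel (u.letter i).path :=
  if_pos ⟨h, hd⟩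

theorem Word.bwd_of_direct {u : Word V ι} {i : ι} (hd : (u.letter i).direct = true) :
    u.bwd k rel i = 0 := if_neg (by simp [hd])

theorem Word.bwd_of_not {u : Word V ι} {i : ι} (h : ¬ u.HasLetter i) :
    u.bwd k rel i = 0 := if_neg (by simp [h])

theorem Word.fwd_congr {κ : Type} [CommRing κ] {u : Word V ι} {v : Word V κ} {i : ι} {j : κ}
    (h : u.HasLetter i ↔ v.HasLetter j) (h' : u.letter i = v.letter j) :
    u.fwd k rel i = v.fwd k rel j := by
  classical
  exact if_congr (by rw [h, h']) (by rw [h']) rfl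

theorem Word.bwd_congr {κ : Type} [CommRing κ] {u : Word V ι} {v : Word V κ} {i : ι} {j : κ}
    (h : u.HasLetter i ↔ v.HasLetter j) (h' : u.letter i = v.letter j) :
    u.bwd k rel i = v.bwd k rel j := by
  classical
  exact if_congr (by rw [h, h']) (by rw [h']) rfl

theorem Word.fwd_of_inv {κ : Type} [CommRing κ] {u : Word V ι} {v : Word V κ} {i : ι} {j : κ}
    (h : u.HasLetter i ↔ v.HasLetter j) (h' : u.letter i = (v.letter j).inv) :
    u.fwd k rel i = v.bwd k rel j := by
  classical
  exact if_congr (by rw [h, h']; simp) (by rw [h', Letter.inv_path]) rfl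

theorem Word.bwd_of_inv {κ : Type} [CommRing κ] {u : Word V ι} {v : Word V κ} {i : ι} {j : κ}
    (h : u.HasLetter i ↔ v.HasLetter j) (h' : u.letter i = (v.letter j).inv) :
    u.bwd k rel i = v.fwd k rel j := by
  classical
  exact if_congr (by rw [h, h']; simp) (by rw [h', Letter.inv_path]) rfl

theorem Word.fwd_reverse (u : Word V ℤ) (i : ℤ) :
    u.reverse.fwd k rel i = u.bwd k rel (1 - i) :=
  Word.fwd_of_inv k Word.hasLetter_reverse rfl

theorem Word.bwd_reverse (u : Word V ℤ) (i : ℤ) :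
    u.reverse.bwd k rel i = u.fwd k rel (1 - i) :=
  Word.bwd_of_inv k Word.hasLetter_reverse rfl

theorem eval_mul_eval_eq_zero {l m : List (Arr V)}
    (h : ∃ b ∈ l.getLast?, ∃ a ∈ m.head?, rel b a) : eval k rel l * eval k rel m = 0 := by
  rw [← eval_append]
  exact eval_eq_zero k rel (hasRel_append rel h)

variable (rel)

/-- The diagonal map with coefficients `a i` from `u` to `v` commutes with the differentials at
the `i`-th letters. -/
structure CommAt (u v : Word V ℤ) (a : ℤ → Alg k rel) (i : ℤ) : Prop where
  fwd : u.fwd k rel i * a (i - 1) = a i * v.fwd k rel i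
  bwd : u.bwd k rel i * a i = a (i - 1) * v.bwd k rel i

/-- The element `x` of `Λ` gives a map of degree `δ` from the node `i` of `u` to the node `i`
of `v`. -/
def CompatAt (δ : ℤ) (u v : Word V ℤ) (x : Alg k rel) (i : ℤ) : Prop :=
  i ∈ u.node → x ≠ 0 → i ∈ v.node ∧ v.deg i = u.deg i + δ ∧
    ∀ g ∈ P k rel (u.vtx i), g * x ∈ P k rel (v.vtx i)

/-- A diagonal map from `u` to `v`, which is the identity at the node `i`, can be continued by `w`
at the node `i - 1` and by zero further to the right. -/
structure Ends (δ : ℤ) (u v : Word V ℤ) (i : ℤ) (w : Alg k rel) : Prop where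
  fwd : u.fwd k rel i * w = v.fwd k rel i
  bwd : u.bwd k rel i = w * v.bwd k rel i
  next_fwd : w * v.fwd k rel (i - 1) = 0
  next_bwd : u.bwd k rel (i - 1) * w = 0
  compat : CompatAt k rel δ u v w (i - 1)

/-- A diagonal map from the right part of `u` to that of `v`, which is the identity at `m`. -/
structure RightTail (δ : ℤ) (u v : Word V ℤ) (m : ℤ) (a : ℤ → Alg k rel) : Prop where
  one : a m = 1
  comm : ∀ i ≤ m, CommAt k rel u v a i
  compat : ∀ i ≤ m, CompatAt k rel δ u v (a i) i

variable {k rel}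

theorem CommAt.of_agreeAt {u v : Word V ℤ} {a : ℤ → Alg k rel} {i : ℤ}
    (h : u.HasLetter i ↔ v.HasLetter i) (h' : u.letter i = v.letter i) (h1 : a i = 1)
    (h2 : a (i - 1) = 1) : CommAt k rel u v a i :=
  ⟨by rw [h1, h2, mul_one, one_mul, Word.fwd_congr k h h'],
    by rw [h1, h2, mul_one, one_mul, Word.bwd_congr k h h']⟩

theorem CommAt.of_zero {u v : Word V ℤ} {a : ℤ → Alg k rel} {i : ℤ} (h1 : a i = 0)
    (h2 : a (i - 1) = 0) : CommAt k rel u v a i :=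
  ⟨by rw [h1, h2, mul_zero, zero_mul], by rw [h1, h2, mul_zero, zero_mul]⟩

theorem CompatAt.zero {δ : ℤ} {u v : Word V ℤ} {i : ℤ} : CompatAt k rel δ u v 0 i :=
  fun _ h => absurd rfl h

theorem Word.MatchAt.compatAt {δ : ℤ} {u v : Word V ℤ} {i : ℤ} (h : u.MatchAt δ v i) :
    CompatAt k rel δ u v 1 i :=
  fun _ _ => ⟨h.node, h.deg, fun g hg => by rwa [mul_one, ← h.vtx]⟩

/-- The coefficients are $1$ down to the node $j$, then $w$ at $j-1$, then $0$. The vanishing beyond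
$j-1$ is recorded because nilpotency depends on it later. -/
theorem exists_rightTail_of_ends {δ : ℤ} {u v : Word V ℤ} {m j : ℤ} {w : Alg k rel}
    (hu : u.IsWalk rel) (hv : v.IsWalk rel) (hm : m ∈ u.node → u.MatchAt δ v m) (hj : j ≤ m)
    (h : ∀ i, j < i → i ≤ m → u.AgreeAt v i) (he : Ends k rel δ u v j w) :
    ∃ a, RightTail k rel δ u v m a ∧ a (j - 1) = w ∧ ∀ i < j - 1, a i = 0 := by
  set a : ℤ → Alg k rel := fun i => if j ≤ i then 1 else if i = j - 1 then w else 0 with ha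
  have a1 : ∀ i, j ≤ i → a i = 1 := fun i hi => if_pos hi
  have a2 : a (j - 1) = w := by simp [ha]
  have a3 : ∀ i < j - 1, a i = 0 := fun i hi => by
    rw [ha]
    simp only
    rw [if_neg (by omega), if_neg (by omega)]
  refine ⟨a, ⟨a1 m hj, fun i hi => ?_, fun i hi => ?_⟩, a2, a3⟩
  -- The letter $i$ sees the coefficients at $i$ and $i-1$. So $w$ enters only at the letters $j$
  -- and $j-1$, which are what the fields of `Ends` cover.
  · rcases lt_trichotomy i j with hij | rfl | hij
    · rcases eq_or_lt_of_le (show i ≤ j - 1 by omega) with rfl | hij'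
      · refine ⟨?_, ?_⟩
        · rw [a2, a3 _ (by omega), mul_zero, he.next_fwd]
        · rw [a2, a3 _ (by omega), zero_mul, he.next_bwd]
      · exact .of_zero (a3 _ hij') (a3 _ (by omega))
    · refine ⟨?_, ?_⟩
      · rw [a2, a1 _ le_rfl, one_mul, he.fwd]
      · rw [a2, a1 _ le_rfl, mul_one, he.bwd]
    · have := h i hij hi
      exact .of_agreeAt (iff_of_true this.left this.right) this.letter (a1 _ hij.le)
        (a1 _ (by omega))
  · rcases lt_trichotomy i (j - 1) with hij | rfl | hij
    · rw [a3 i hij]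
      exact .zero
    · rw [a2]
      exact he.compat
    · rw [a1 i (by omega)]
      intro hi'
      have hmu : m ∈ u.node := by
        rcases eq_or_lt_of_le hi with rfl | hi
        · exact hi'
        · exact (h m (by omega) le_rfl).left.1
      exact (Word.matchAt_of_agreeAt hu hv (hm hmu) hmu hi
        (fun l h1 h2 => h l (by omega) h2)).1.compatAt hi'

theorem exists_rightTail_of_agreeAt {δ : ℤ} {u v : Word V ℤ} {m : ℤ}
    (hu : u.IsWalk rel) (hv : v.IsWalk rel) (hm : u.MatchAt δ v m) (hmu : m ∈ u.node)
    (h : ∀ i ≤ m, u.AgreeAt v i) : RightTail k rel δ u v m (fun _ => 1) where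
  one := rfl
  comm i hi := .of_agreeAt (iff_of_true (h i hi).left (h i hi).right) (h i hi).letter rfl rfl
  compat _ hi := (Word.matchAt_of_agreeAt hu hv hm hmu hi (fun l _ h2 => h l h2)).1.compatAt

/-- The map may stop at once if the next letter of `u` puts nothing into the node $i$ and the next
letter of `v` takes nothing out of it. -/
theorem ends_zero {δ : ℤ} {u v : Word V ℤ} {i : ℤ} (hu : u.bwd k rel i = 0)
    (hv : v.fwd k rel i = 0) : Ends k rel δ u v i 0 :=
  ⟨by rw [mul_zero, hv], by rw [zero_mul, hu], zero_mul _, mul_zero _, .zero⟩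

/-- For direct letters the map goes from the shorter letter to the longer one, and `w` is the
remainder. The next letter kills `w` on both sides: a direct letter of `v` meets the end of `w` in a
relation, and an inverse letter of `u` does not cancel with the letter before it, so gentleness
forces a relation with `w`. -/
theorem ends_of_direct (hg : IsGentle rel) {δ : ℤ} {u v : Word V ℤ} {i : ℤ}
    (hu : u.IsWalk rel) (hv : v.IsWalk rel) (hm : v.deg i = u.deg i + δ)
    (hui : u.HasLetter i) (hvi : v.HasLetter i) (hud : (u.letter i).direct = true)
    (hvd : (v.letter i).direct = true) {w : List (Arr V)} (hw : w ≠ [])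
    (h : (v.letter i).path = (u.letter i).path ++ w) : Ends k rel δ u v i (eval k rel w) := by
  have pu := (hu.joins i hui).of_direct hud
  have pv := (hv.joins i hvi).of_direct hvd
  refine ⟨?_, ?_, ?_, ?_, fun _ _ => ⟨hvi.2, ?_, fun g _ => smul_mem_P k rel ?_ g⟩⟩
  · rw [Word.fwd_of_direct k hui hud, Word.fwd_of_direct k hvi hvd, h, eval_append]
  · rw [Word.bwd_of_direct k hud, Word.bwd_of_direct k hvd, mul_zero]
  · by_cases hd : v.HasLetter (i - 1) ∧ (v.letter (i - 1)).direct = true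
    · have := hv.adj (i - 1)
      rw [sub_add_cancel] at this
      have := this hvi hd.1
      rw [Letter.Adj, hvd, hd.2] at this
      simp only [h, List.getLast?_append_of_ne_nil _ hw] at this
      rw [Word.fwd_of_direct k hd.1 hd.2]
      exact eval_mul_eval_eq_zero k this
    · rw [Word.fwd, if_neg hd, mul_zero]
  · by_cases hd : u.HasLetter (i - 1) ∧ (u.letter (i - 1)).direct = false
    · have := hu.adj (i - 1)
      rw [sub_add_cancel] at this
      have := this hui hd.1
      rw [Letter.Adj, hud, hd.2] at this
      rw [Word.bwd_of_inverse k hd.1 hd.2]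
      exact eval_mul_eval_eq_zero k (hg.rel_of_getLast_ne (h ▸ pv) pu hw
        ((hu.joins _ hd.1).of_inverse hd.2) this)
    · rw [Word.bwd, if_neg hd, zero_mul]
  · rw [hu.deg_eq i hui, hv.deg_eq i hvi, if_pos hud, if_pos hvd, hm]
    ring
  · obtain ⟨z, hz⟩ := (h ▸ pv).of_append_right hw
    exact eval_mem_P k rel hz

/-- For inverse letters the roles are exchanged: the map goes from the longer letter to the shorter
one, and the two arguments for the next letter trade places. -/
theorem ends_of_inverse (hg : IsGentle rel) {δ : ℤ} {u v : Word V ℤ} {i : ℤ}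
    (hu : u.IsWalk rel) (hv : v.IsWalk rel) (hm : u.MatchAt δ v i)
    (hui : u.HasLetter i) (hvi : v.HasLetter i) (hud : (u.letter i).direct = false)
    (hvd : (v.letter i).direct = false) {w : List (Arr V)} (hw : w ≠ [])
    (h : (u.letter i).path = w ++ (v.letter i).path) : Ends k rel δ u v i (eval k rel w) := by
  have pu := (hu.joins i hui).of_inverse hud
  have pv := (hv.joins i hvi).of_inverse hvd
  rw [h, hm.vtx] at pu
  refine ⟨?_, ?_, ?_, ?_, fun _ _ => ⟨hvi.2, ?_, fun g _ => smul_mem_P k rel ?_ g⟩⟩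
  · rw [Word.fwd_of_inverse k hud, Word.fwd_of_inverse k hvd, zero_mul]
  · rw [Word.bwd_of_inverse k hui hud, Word.bwd_of_inverse k hvi hvd, h, eval_append]
  · by_cases hd : v.HasLetter (i - 1) ∧ (v.letter (i - 1)).direct = true
    · have := hv.adj (i - 1)
      rw [sub_add_cancel] at this
      have := this hvi hd.1
      rw [Letter.Adj, hvd, hd.2] at this
      rw [Word.fwd_of_direct k hd.1 hd.2]
      exact eval_mul_eval_eq_zero k (hg.rel_of_head_ne pu pv hw
        ((hv.joins _ hd.1).of_direct hd.2) this)
    · rw [Word.fwd, if_neg hd, mul_zero]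
  · by_cases hd : u.HasLetter (i - 1) ∧ (u.letter (i - 1)).direct = false
    · have := hu.adj (i - 1)
      rw [sub_add_cancel] at this
      have := this hui hd.1
      rw [Letter.Adj, hud, hd.2] at this
      simp only [h, List.head?_append_of_ne_nil _ hw] at this
      rw [Word.bwd_of_inverse k hd.1 hd.2]
      exact eval_mul_eval_eq_zero k this
    · rw [Word.bwd, if_neg hd, zero_mul]
  · rw [hu.deg_eq i hui, hv.deg_eq i hvi, if_neg (c := (u.letter i).direct = true) (by simp [hud]),
      if_neg (c := (v.letter i).direct = true) (by simp [hvd]), hm.deg]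
    ring
  · exact eval_mem_P k rel (pu.of_append_left pv hw)

/-- At a disagreement exactly the direction of the letters decides. If a letter is missing or the
directions differ, the zero continuation works, from the word whose letter is direct or missing to
the one whose letter is inverse or missing. For equal directions the letters are comparable, and the
quotient of the longer by the shorter is the last component. -/
theorem ends_or_ends (hg : IsGentle rel) {δ : ℤ} {u v : Word V ℤ} {i : ℤ}
    (hu : u.IsWalk rel) (hv : v.IsWalk rel) (hm : u.MatchAt δ v i) (hmu : i ∈ u.node)
    (hn : ¬ u.AgreeAt v i)
    (hc : u.HasLetter i → v.HasLetter i → (u.letter i).direct = (v.letter i).direct →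
      ((u.letter i).direct = true →
        (u.letter i).path <+: (v.letter i).path ∨ (v.letter i).path <+: (u.letter i).path) ∧
      ((u.letter i).direct = false →
        (u.letter i).path <:+ (v.letter i).path ∨ (v.letter i).path <:+ (u.letter i).path)) :
    (∃ w, Ends k rel δ u v i w) ∨ ∃ w, Ends k rel (-δ) v u i w := by
  by_cases hui : u.HasLetter i; swap
  · cases hvd : (v.letter i).direct
    · exact Or.inl ⟨0, ends_zero (Word.bwd_of_not k hui) (Word.fwd_of_inverse k hvd)⟩
    · exact Or.inr ⟨0, ends_zero (Word.bwd_of_direct k hvd) (Word.fwd_of_not k hui)⟩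
  by_cases hvi : v.HasLetter i; swap
  · cases hud : (u.letter i).direct
    · exact Or.inr ⟨0, ends_zero (Word.bwd_of_not k hvi) (Word.fwd_of_inverse k hud)⟩
    · exact Or.inl ⟨0, ends_zero (Word.bwd_of_direct k hud) (Word.fwd_of_not k hvi)⟩
  have hne : (u.letter i).direct = (v.letter i).direct →
      (u.letter i).path ≠ (v.letter i).path := by
    intro h1 h2
    refine hn ⟨hui, hvi, ?_⟩
    cases hu' : u.letter i
    cases hv' : v.letter i
    simp_all
  have hms := hm.symm hmu
  specialize hc hui hvi
  cases hud : (u.letter i).direct <;> cases hvd : (v.letter i).direct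
  · rw [hud, hvd] at hne hc
    rcases (hc rfl).2 rfl with ⟨w, hw⟩ | ⟨w, hw⟩
    · refine Or.inr ⟨_, ends_of_inverse hg hv hu hms hvi hui hvd hud ?_ hw.symm⟩
      rintro rfl
      exact hne rfl hw
    · refine Or.inl ⟨_, ends_of_inverse hg hu hv hm hui hvi hud hvd ?_ hw.symm⟩
      rintro rfl
      exact hne rfl hw.symm
  · exact Or.inr ⟨0, ends_zero (Word.bwd_of_direct k hvd) (Word.fwd_of_inverse k hud)⟩
  · exact Or.inl ⟨0, ends_zero (Word.bwd_of_direct k hud) (Word.fwd_of_inverse k hvd)⟩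
  · rw [hud, hvd] at hne hc
    rcases (hc rfl).1 rfl with ⟨w, hw⟩ | ⟨w, hw⟩
    · refine Or.inl ⟨_, ends_of_direct hg hu hv hm.deg hui hvi hud hvd ?_ hw.symm⟩
      rintro rfl
      exact hne rfl (by simpa using hw)
    · refine Or.inr ⟨_, ends_of_direct hg hv hu hms.deg hvi hui hvd hud ?_ hw.symm⟩
      rintro rfl
      exact hne rfl (by simpa using hw.symm)

/-- Two words that start at the same vertex, after the same letter, can be compared: there is a
map from the first to the second which ends after finitely many nodes, or a map back. -/
theorem ends_or_exists_rightTail (hg : IsGentle rel) {δ : ℤ} {u v : Word V ℤ} {m : ℤ}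
    (hu : u.IsWalk rel) (hv : v.IsWalk rel) (hm : u.MatchAt δ v m) (hmu : m ∈ u.node)
    {L : Letter V} {s : V} (hL : L.Joins rel s (u.vtx m))
    (hLu : u.HasLetter m → L.Adj rel (u.letter m))
    (hLv : v.HasLetter m → L.Adj rel (v.letter m)) :
    (∃ j ≤ m, (∀ i, j < i → i ≤ m → u.AgreeAt v i) ∧ ∃ w, Ends k rel δ u v j w) ∨
      ∃ b, RightTail k rel (-δ) v u m b := by
  -- Words that agree forever are put into the second alternative, since the first one asks for a
  -- map that ends after finitely many nodes.
  by_cases hall : ∀ i ≤ m, u.AgreeAt v i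
  · exact Or.inr ⟨_, exists_rightTail_of_agreeAt hv hu (hm.symm hmu) hm.node fun i hi =>
      ⟨(hall i hi).right, (hall i hi).left, (hall i hi).letter.symm⟩⟩
  push Not at hall
  -- Indices decrease to the right, so the greatest index of disagreement is the first one met.
  obtain ⟨j, ⟨hj, hja⟩, hmax⟩ := Int.exists_greatest_of_bdd
    (P := fun i => i ≤ m ∧ ¬ u.AgreeAt v i) ⟨m, fun _ h => h.1⟩ hall
  have hag : ∀ i, j < i → i ≤ m → u.AgreeAt v i := fun i h1 h2 => by
    by_contra h3
    exact absurd (hmax i ⟨h2, h3⟩) (by omega)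
  obtain ⟨hmj, hju⟩ := Word.matchAt_of_agreeAt hu hv hm hmu hj hag
  -- The two letters at $j$ follow a common letter: the given `L` if $j=m$, and the letter $j+1$,
  -- where the words still agree, otherwise. This is what makes them comparable.
  have hL' : ∃ L : Letter V, ∃ s, L.Joins rel s (u.vtx j) ∧
      (u.HasLetter j → L.Adj rel (u.letter j)) ∧ (v.HasLetter j → L.Adj rel (v.letter j)) := by
    rcases eq_or_lt_of_le hj with rfl | hj'
    · exact ⟨L, s, hL, hLu, hLv⟩
    · have ha := hag (j + 1) (by omega) (by omega)
      refine ⟨u.letter (j + 1), u.vtx (j + 1), ?_, hu.adj j ha.left, ?_⟩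
      · simpa using hu.joins _ ha.left
      · rw [ha.letter]
        exact hv.adj j ha.right
  obtain ⟨L', s', hL', hLu', hLv'⟩ := hL'
  rcases ends_or_ends (k := k) hg hu hv hmj hju hja fun h1 h2 h3 =>
      hg.comparable hL' (hu.joins j h1) (hmj.vtx ▸ hv.joins j h2) (hLu' h1) (hLv' h2) h3 with
    ⟨w, hw⟩ | ⟨w, hw⟩
  · exact Or.inl ⟨j, hj, hag, w, hw⟩
  · obtain ⟨b, hb, -⟩ := exists_rightTail_of_ends hv hu (fun _ => hm.symm hmu) hj
      (fun i h1 h2 => ⟨(hag i h1 h2).right, (hag i h1 h2).left, (hag i h1 h2).letter.symm⟩) hw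
    exact Or.inr ⟨b, hb⟩

end WordMaps

/-! ### Chain maps and homotopies from matrices of elements of `Λ` -/

section Total

variable {k : Type u} [Field k] {V : Type v} [Fintype V] [Quiver.{w} V]
  {rel : Arr V → Arr V → Prop} {ι κ ℓ : Type} [CommRing ι] [CommRing κ] [CommRing ℓ]

theorem smul_single_mem_term {u : Word V ι} {v : Word V κ} {m n : ℤ} {i : ι} {j : κ}
    {x y : Alg k rel} (hi : i ∈ u.node) (hm : u.deg i = m) (hx : x ∈ P k rel (u.vtx i))
    (h : i ∈ u.node → y ≠ 0 → j ∈ v.node ∧ (u.deg i = m → v.deg j = n) ∧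
      ∀ g ∈ P k rel (u.vtx i), g * y ∈ P k rel (v.vtx j)) :
    x • Finsupp.single j y ∈ term k rel v n := by
  by_cases hy : y = 0
  · rw [hy, Finsupp.single_zero, smul_zero]
    exact Submodule.zero_mem _
  · obtain ⟨h1, h2, h3⟩ := h hi hy
    rw [Finsupp.smul_single, smul_eq_mul]
    exact single_mem_term k rel (h3 x hx) h1 (h2 hm)

theorem linearCombination_mem_term {u : Word V ι} {v : Word V κ} {m n : ℤ}
    {r : ι → κ →₀ Alg k rel}
    (h : ∀ i ∈ u.node, u.deg i = m → ∀ x ∈ P k rel (u.vtx i), x • r i ∈ term k rel v n)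
    {g : ι →₀ Alg k rel} (hg : g ∈ term k rel u m) :
    Finsupp.linearCombination (Alg k rel) r g ∈ term k rel v n := by
  rw [Finsupp.linearCombination_apply]
  refine Submodule.sum_mem _ fun i hi => ?_
  have h2 := (hg i).2 (Finsupp.mem_support_iff.1 hi)
  exact h i h2.1 h2.2 _ (hg i).1

/-- A linear map that preserves the terms in the degrees `m` and `n`, as a morphism. -/
noncomputable def restrictHom {u : Word V ι} {v : Word V κ} {c : ι → k} {c' : κ → k}
    {hu : u.IsWalk rel} {hv : v.IsWalk rel} (Φ : (ι →₀ Alg k rel) →ₗ[Alg k rel] (κ →₀ Alg k rel))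
    {m n : ℤ} (h : ∀ g ∈ term k rel u m, Φ g ∈ term k rel v n) :
    (wordComplex k rel c u hu).X m ⟶ (wordComplex k rel c' v hv).X n :=
  ModuleCat.ofHom (Φ.restrict h)

theorem wordComplex_d {u : Word V ι} {c : ι → k} {hu : u.IsWalk rel} {m n : ℤ} (h : m + 1 = n) :
    (wordComplex k rel c u hu).d m n = restrictHom (diff k rel c u)
      fun _ hg => diff_mem k rel hu c h hg :=
  dif_pos h

theorem hom_ext_of_total {u : Word V ι} {v : Word V κ} {c : ι → k} {c' : κ → k}
    {hu : u.IsWalk rel} {hv : v.IsWalk rel} {m n : ℤ}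
    {φ ψ : (wordComplex k rel c u hu).X m ⟶ (wordComplex k rel c' v hv).X n}
    (h : ∀ g : term k rel u m,
      Subtype.val (p := (· ∈ term k rel v n)) (φ.hom g) =
        Subtype.val (p := (· ∈ term k rel v n)) (ψ.hom g)) : φ = ψ :=
  ModuleCat.hom_ext (LinearMap.ext fun g => Subtype.ext (h g))

/-- A single map that is the boundary of a map of degree `-1` is zero in the homotopy category. -/
theorem quotient_map_wordSingleMap_eq_zero {u : Word V ι} {v : Word V κ} {p : ι} {q : κ}
    {f : List (Arr V)} {c : ι → k} {c' : κ → k} {hu : u.IsWalk rel} {hv : v.IsWalk rel}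
    {hf : IsSingleMap rel u v p q f} (H : (ι →₀ Alg k rel) →ₗ[Alg k rel] (κ →₀ Alg k rel))
    (hH : ∀ m n, n + 1 = m → ∀ g ∈ term k rel u m, H g ∈ term k rel v n)
    (h : ∀ i, H (row k rel c u i) + diff k rel c' v (H (Finsupp.single i 1)) =
      singleTotal k rel p q f (Finsupp.single i 1)) :
    (HomotopyCategory.quotient (ModuleCat.{max u v w} (Alg k rel)) (ComplexShape.up ℤ)).map
      (wordSingleMap k rel c c' hu hv hf) = 0 := by
  have h' : H.comp (diff k rel c u) + (diff k rel c' v).comp H = singleTotal k rel p q f := by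
    apply Finsupp.lhom_ext
    intro i x
    have h1 : (Finsupp.single i x : ι →₀ Alg k rel) = x • Finsupp.single i 1 := by simp
    rw [h1, map_smul, map_smul, ← h i]
    simp only [LinearMap.add_apply, LinearMap.comp_apply, diff_single, one_smul]
  have ho : Homotopy (wordSingleMap k rel c c' hu hv hf) 0 :=
    { hom := fun m n => if hmn : n + 1 = m then restrictHom H (hH m n hmn) else 0
      zero := fun m n hmn => dif_neg hmn
      comm := fun m => by
        rw [dNext_eq _ (show (ComplexShape.up ℤ).Rel m (m + 1) from rfl),
          prevD_eq _ (show (ComplexShape.up ℤ).Rel (m - 1) m from sub_add_cancel m 1),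
          dif_pos rfl, dif_pos (sub_add_cancel m 1), wordComplex_d rfl,
          wordComplex_d (sub_add_cancel m 1), HomologicalComplex.zero_f, add_zero]
        refine hom_ext_of_total fun g => ?_
        exact (LinearMap.congr_fun h' g.1).symm }
  rw [HomotopyCategory.eq_of_homotopy _ _ ho, Functor.map_zero]

/-- Criterion for a word complex to be isomorphic to the mapping cone of a single map. -/
theorem nonempty_iso_mappingCone {u : Word V ι} {v : Word V κ} {t : Word V ℓ} {p : ι} {q : κ}
    {f : List (Arr V)} {c : ι → k} {c' : κ → k} {d : ℓ → k} {hu : u.IsWalk rel}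
    {hv : v.IsWalk rel} {ht : t.IsWalk rel} {hf : IsSingleMap rel u v p q f}
    (α : (ℓ →₀ Alg k rel) →ₗ[Alg k rel] (ι →₀ Alg k rel))
    (β : (ℓ →₀ Alg k rel) →ₗ[Alg k rel] (κ →₀ Alg k rel))
    (hα : ∀ m, ∀ g ∈ term k rel t m, α g ∈ term k rel u (m + 1))
    (hβ : ∀ m, ∀ g ∈ term k rel t m, β g ∈ term k rel v m)
    (hαd : ∀ i, diff k rel c u (α (Finsupp.single i 1)) + α (row k rel d t i) = 0)
    (hβd : ∀ i, diff k rel c' v (β (Finsupp.single i 1)) +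
      singleTotal k rel p q f (α (Finsupp.single i 1)) = β (row k rel d t i))
    (hinj : ∀ m, ∀ g ∈ term k rel t m, α g = 0 → β g = 0 → g = 0)
    (hsurj : ∀ m, ∀ x ∈ term k rel u (m + 1), ∀ y ∈ term k rel v m,
      ∃ g ∈ term k rel t m, α g = x ∧ β g = y) :
    Nonempty (CochainComplex.mappingCone (wordSingleMap k rel c c' hu hv hf) ≅
      wordComplex k rel d t ht) := by
  have hs : ∀ (i : ℓ) (x : Alg k rel),
      (Finsupp.single i x : ℓ →₀ Alg k rel) = x • Finsupp.single i 1 := fun i x => by simp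
  have hα' : (diff k rel c u).comp α + α.comp (diff k rel d t) = 0 := by
    apply Finsupp.lhom_ext
    intro i x
    rw [hs, map_smul, LinearMap.add_apply, LinearMap.comp_apply, LinearMap.comp_apply, diff_single,
      one_smul, hαd, smul_zero]
    rfl
  have hβ' : (diff k rel c' v).comp β + (singleTotal k rel p q f).comp α =
      β.comp (diff k rel d t) := by
    apply Finsupp.lhom_ext
    intro i x
    rw [hs, map_smul, map_smul, LinearMap.add_apply, LinearMap.comp_apply, LinearMap.comp_apply,
      hβd, LinearMap.comp_apply, diff_single, one_smul]
  have hα1 : ∀ m n, m + 1 = n → ∀ g ∈ term k rel t m, α g ∈ term k rel u n := by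
    rintro m _ rfl
    exact hα m
  have hβ1 : ∀ m n, m + 0 = n → ∀ g ∈ term k rel t m, β g ∈ term k rel v n := by
    rintro m _ rfl
    rw [add_zero]
    exact hβ m
  let φ := wordSingleMap k rel c c' hu hv hf
  -- A map into the shift of the complex of `u` is a cocycle of degree one, and for that degree the
  -- cocycle condition is anticommutation with the differentials. This explains the sign in `hαd`.
  let A : CochainComplex.HomComplex.Cocycle (wordComplex k rel d t ht)
      (wordComplex k rel c u hu) 1 :=
    CochainComplex.HomComplex.Cocycle.mk
      (CochainComplex.HomComplex.Cochain.mk fun m n hmn => restrictHom α (hα1 m n hmn)) 2 rfl (by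
        ext m n hmn : 1
        rw [CochainComplex.HomComplex.δ_v 1 2 rfl _ m n hmn (m + 1) (m + 1) (by omega) rfl,
          wordComplex_d (by omega), wordComplex_d rfl, Int.negOnePow_even 2 (by decide), one_smul]
        refine hom_ext_of_total fun g => ?_
        exact LinearMap.congr_fun hα' g.1)
  let B : CochainComplex.HomComplex.Cochain (wordComplex k rel d t ht)
      (wordComplex k rel c' v hv) 0 :=
    CochainComplex.HomComplex.Cochain.mk fun m n hmn => restrictHom β (hβ1 m n hmn)
  have hAB : CochainComplex.HomComplex.δ 0 1 B +
      A.1.comp (CochainComplex.HomComplex.Cochain.ofHom φ) (add_zero 1) = 0 := by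
    ext m n hmn : 1
    rw [CochainComplex.HomComplex.Cochain.add_v,
      CochainComplex.HomComplex.δ_v 0 1 rfl _ m n hmn m n (by omega) hmn,
      CochainComplex.HomComplex.Cochain.comp_zero_cochain_v,
      CochainComplex.HomComplex.Cochain.ofHom_v,
      wordComplex_d hmn, wordComplex_d hmn, Int.negOnePow_odd 1 (by decide),
      Units.neg_smul, one_smul]
    refine hom_ext_of_total fun g => ?_
    have := LinearMap.congr_fun hβ' g.1
    simp only [LinearMap.add_apply, LinearMap.comp_apply] at this
    change (diff k rel c' v (β g.1) + -β (diff k rel d t g.1)) +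
      singleTotal k rel p q f (α g.1) = 0
    rw [← this]
    abel
  let F := CochainComplex.mappingCone.lift φ A B hAB
  have hF : ∀ m, IsIso (F.f m) := by
    intro m
    -- In each degree the lift is, up to the decomposition of the cone, the pair of `α` and `β`. The
    -- two halves of the inverse of `Θ` give the inverse of the component of `F`.
    let Θ : term k rel t m →ₗ[Alg k rel] term k rel u (m + 1) × term k rel v m :=
      (α.restrict (hα m)).prod (β.restrict (hβ m))
    have hΘ : Function.Bijective Θ := by
      constructor
      · rw [injective_iff_map_eq_zero]
        intro g hg
        have hg' := Prod.ext_iff.1 hg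
        exact Subtype.ext (hinj m g.1 g.2 (congrArg Subtype.val hg'.1)
          (congrArg Subtype.val hg'.2))
      · rintro ⟨x, y⟩
        obtain ⟨g, hg, h1, h2⟩ := hsurj m x.1 x.2 y.1 y.2
        exact ⟨⟨g, hg⟩, Prod.ext (Subtype.ext h1) (Subtype.ext h2)⟩
    let E := LinearEquiv.ofBijective Θ hΘ
    let a : (wordComplex k rel c u hu).X (m + 1) ⟶ (wordComplex k rel d t ht).X m :=
      ModuleCat.ofHom (E.symm.toLinearMap.comp (LinearMap.inl _ _ _))
    let b : (wordComplex k rel c' v hv).X m ⟶ (wordComplex k rel d t ht).X m :=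
      ModuleCat.ofHom (E.symm.toLinearMap.comp (LinearMap.inr _ _ _))
    have hE : ∀ z, Θ (E.symm z) = z := E.apply_symm_apply
    have h1 : a ≫ A.1.v m (m + 1) rfl = 𝟙 _ := hom_ext_of_total fun x =>
      congrArg (fun z => (z.1 : ι →₀ Alg k rel)) (hE (x, 0))
    have h2 : a ≫ B.v m m (add_zero m) = 0 := hom_ext_of_total fun x =>
      congrArg (fun z => (z.2 : κ →₀ Alg k rel)) (hE (x, 0))
    have h3 : b ≫ A.1.v m (m + 1) rfl = 0 := hom_ext_of_total fun x =>
      congrArg (fun z => (z.1 : ι →₀ Alg k rel)) (hE (0, x))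
    have h4 : b ≫ B.v m m (add_zero m) = 𝟙 _ := hom_ext_of_total fun x =>
      congrArg (fun z => (z.2 : κ →₀ Alg k rel)) (hE (0, x))
    have h5 : A.1.v m (m + 1) rfl ≫ a + B.v m m (add_zero m) ≫ b = 𝟙 _ := by
      refine hom_ext_of_total fun g => congrArg Subtype.val ?_
      change E.symm ((Θ g).1, 0) + E.symm (0, (Θ g).2) = g
      rw [← map_add, Prod.mk_add_mk, add_zero, zero_add]
      exact E.symm_apply_apply g
    refine ⟨(CochainComplex.mappingCone.fst φ).1.v m (m + 1) rfl ≫ a +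
      (CochainComplex.mappingCone.snd φ).v m m (add_zero m) ≫ b, ?_, ?_⟩
    · rw [Preadditive.comp_add, ← Category.assoc, ← Category.assoc,
        CochainComplex.mappingCone.lift_f_fst_v, CochainComplex.mappingCone.lift_f_snd_v, h5]
    · refine CochainComplex.mappingCone.ext_to φ m (m + 1) rfl ?_ ?_
      · rw [Category.assoc, CochainComplex.mappingCone.lift_f_fst_v, Preadditive.add_comp,
          Category.assoc, Category.assoc, h1, h3, Limits.comp_zero, add_zero, Category.comp_id,
          Category.id_comp]
      · rw [Category.assoc, CochainComplex.mappingCone.lift_f_snd_v, Preadditive.add_comp,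
          Category.assoc, Category.assoc, h2, h4, Limits.comp_zero, zero_add, Category.comp_id,
          Category.id_comp]
  have := HomologicalComplex.Hom.isIso_of_components F
  exact ⟨(asIso F).symm⟩

end Total

/-! ### The word of the mapping cone -/

section Cone

variable {V : Type v} [Quiver.{w} V] {rel : Arr V → Arr V → Prop}

/-- Adjacency to the right of a direct letter depends only on the last arrow of its list, so $f$ and
$f_Lf$, or $ff_R$ and $f_Lff_R$, can replace each other as left neighbours. -/
theorem Letter.adj_left_congr {l l' r : Letter V} (h : l.direct = true) (h' : l'.direct = true)
    (hp : l.path.getLast? = l'.path.getLast?) : l.Adj rel r ↔ l'.Adj rel r := by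
  cases hl : r.direct <;> simp [Letter.Adj, h, h', hl, hp]

theorem Letter.adj_right_congr {l r r' : Letter V} (h : r.direct = true) (h' : r'.direct = true)
    (hp : r.path.head? = r'.path.head?) : l.Adj rel r ↔ l.Adj rel r' := by
  cases hl : l.direct <;> simp [Letter.Adj, h, h', hl, hp]

/-- The inverse of the cyclic word `τ`, unrolled so that the node `q` gets the index `p - 1`. -/
def unroll {n : ℕ} (τ : Word V (ZMod n)) (p : ℤ) (q : ZMod n) : Word V ℤ where
  node := Set.univ
  vtx i := τ.vtx (q + (p - 1 - i : ℤ))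
  deg i := τ.deg (q + (p - 1 - i : ℤ))
  letter i := (τ.letter (q + (p - i : ℤ))).inv

variable {n : ℕ} {σ : Word V ℤ} {τ : Word V (ZMod n)} {p : ℤ} {q : ZMod n} {f : List (Arr V)}

theorem unroll_hasLetter (i : ℤ) : (unroll τ p q).HasLetter i := ⟨trivial, trivial⟩

theorem Word.IsHomotopyBand.hasLetter (hτ : τ.IsHomotopyBand rel) (i : ZMod n) :
    τ.HasLetter i := by
  simp [Word.HasLetter, hτ.node_eq]

theorem Word.IsHomotopyBand.unroll (hτ : τ.IsHomotopyBand rel) (p : ℤ) (q : ZMod n) :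
    (unroll τ p q).IsWalk rel where
  joins i _ := by
    have := (hτ.joins (q + (p - i : ℤ)) (hτ.hasLetter _)).inv
    rw [show q + ((p - i : ℤ) : ZMod n) - 1 = q + ((p - 1 - i : ℤ) : ZMod n) by
      push_cast; ring] at this
    simpa only [Gentle.unroll, show p - 1 - (i - 1) = p - i by ring] using this
  adj i _ _ := by
    have := hτ.adj (q + (p - (i + 1) : ℤ)) (hτ.hasLetter _) (hτ.hasLetter _)
    rw [show q + ((p - (i + 1) : ℤ) : ZMod n) + 1 = q + ((p - i : ℤ) : ZMod n) by
      push_cast; ring] at this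
    exact this.inv
  deg_eq i _ := by
    have := hτ.deg_eq (q + (p - i : ℤ)) (hτ.hasLetter _)
    rw [show q + ((p - i : ℤ) : ZMod n) - 1 = q + ((p - 1 - i : ℤ) : ZMod n) by
      push_cast; ring] at this
    simp only [Gentle.unroll, show p - 1 - (i - 1) = p - i by ring, this, Letter.inv_direct]
    cases (τ.letter (q + (p - i : ℤ))).direct <;> simp

theorem unroll_letter_sub (i : ℤ) :
    (unroll τ p q).letter (i - n) = (unroll τ p q).letter i := by
  simp only [unroll]
  congr 3
  push_cast
  simp

theorem unroll_vtx_sub (i : ℤ) : (unroll τ p q).vtx (i - n) = (unroll τ p q).vtx i := by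
  simp only [unroll]
  congr 2
  push_cast
  simp

theorem unroll_deg_sub (i : ℤ) : (unroll τ p q).deg (i - n) = (unroll τ p q).deg i := by
  simp only [unroll]
  congr 2
  push_cast
  simp

theorem unroll_letter_self : (unroll τ p q).letter p = (τ.letter q).inv := by
  simp [unroll]

theorem unroll_vtx_self : (unroll τ p q).vtx p = τ.vtx (q - 1) := by
  simp only [unroll]
  congr 1
  push_cast
  ring

theorem unroll_deg_self : (unroll τ p q).deg p = τ.deg (q - 1) := by
  simp only [unroll]
  congr 1
  push_cast
  ring

theorem unroll_vtx_pred : (unroll τ p q).vtx (p - 1) = τ.vtx q := by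
  simp [unroll]

theorem unroll_deg_pred : (unroll τ p q).deg (p - 1) = τ.deg q := by
  simp [unroll]

/-- A single letter would join a node to itself and change its degree by one. The bound $2$, rather
than $1$, leaves room for one letter past the first disagreement in the periodicity arguments below.
-/
theorem Word.IsHomotopyBand.two_le (hτ : τ.IsHomotopyBand rel) : 2 ≤ n := by
  by_contra h
  obtain rfl : n = 1 := by have := hτ.pos; omega
  have := hτ.deg_eq 0 (hτ.hasLetter 0)
  rw [Subsingleton.elim (0 - 1 : ZMod 1) 0] at this
  split_ifs at this <;> omega

theorem coneWord_node_of_le {i : ℤ} (h : p ≤ i) :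
    i ∈ (coneWord σ τ p q f).node ↔ i ∈ σ.node := by
  simp only [coneWord, Set.mem_ofPred_eq]
  constructor
  · rintro (h | h | h)
    exacts [h.2, by omega, by omega]
  · exact fun h' => Or.inl ⟨h, h'⟩

theorem coneWord_node_of_mem {i : ℤ} (h : p - n ≤ i) (h' : i < p) :
    i ∈ (coneWord σ τ p q f).node :=
  Or.inr (Or.inl ⟨h, h'⟩)

theorem coneWord_node_of_lt {i : ℤ} (h : i < p - n) :
    i ∈ (coneWord σ τ p q f).node ↔ i + n ∈ σ.node := by
  simp only [coneWord, Set.mem_ofPred_eq]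
  constructor
  · rintro (h | h | h)
    exacts [by omega, by omega, h.2]
  · exact fun h' => Or.inr (Or.inr ⟨h, h'⟩)

theorem coneWord_vtx_of_le {i : ℤ} (h : p ≤ i) : (coneWord σ τ p q f).vtx i = σ.vtx i := if_pos h

theorem coneWord_vtx_of_mem {i : ℤ} (h : p - n ≤ i) (h' : i < p) :
    (coneWord σ τ p q f).vtx i = (unroll τ p q).vtx i :=
  (if_neg h'.not_ge).trans (if_pos h)

theorem coneWord_vtx_of_lt {i : ℤ} (h : i < p - n) :
    (coneWord σ τ p q f).vtx i = σ.vtx (i + n) := by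
  simp only [coneWord]
  rw [if_neg (by omega), if_neg (by omega)]

theorem coneWord_deg_of_le {i : ℤ} (h : p ≤ i) :
    (coneWord σ τ p q f).deg i = σ.deg i - 1 := if_pos h

theorem coneWord_deg_of_mem {i : ℤ} (h : p - n ≤ i) (h' : i < p) :
    (coneWord σ τ p q f).deg i = (unroll τ p q).deg i :=
  (if_neg h'.not_ge).trans (if_pos h)

theorem coneWord_deg_of_lt {i : ℤ} (h : i < p - n) :
    (coneWord σ τ p q f).deg i = σ.deg (i + n) - 1 := by
  simp only [coneWord]
  rw [if_neg (by omega), if_neg (by omega)]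

theorem coneWord_letter_of_lt_left {i : ℤ} (h : p < i) :
    (coneWord σ τ p q f).letter i = σ.letter i := if_pos h

theorem coneWord_letter_self : (coneWord σ τ p q f).letter p = ⟨true, f⟩ := by
  simp [coneWord]

theorem coneWord_letter_of_mem {i : ℤ} (h : p - n < i) (h' : i < p) :
    (coneWord σ τ p q f).letter i = (unroll τ p q).letter i := by
  simp [coneWord, unroll, h, h'.not_gt, h'.ne]

theorem coneWord_letter_sub (hn : 0 < n) :
    (coneWord σ τ p q f).letter (p - n) =
      ⟨true, (τ.letter q).path ++ (σ.letter p).path.drop f.length⟩ := by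
  simp only [coneWord]
  rw [if_neg (by omega), if_neg (by omega), if_neg (by omega), if_pos trivial]

theorem coneWord_letter_of_lt {i : ℤ} (h : i < p - n) :
    (coneWord σ τ p q f).letter i = σ.letter (i + n) := by
  simp only [coneWord]
  rw [if_neg (by omega), if_neg (by omega), if_neg (by omega), if_neg (by omega)]

theorem coneWord_hasLetter_of_lt_left {i : ℤ} (h : p < i) :
    (coneWord σ τ p q f).HasLetter i ↔ σ.HasLetter i := by
  rw [Word.HasLetter, Word.HasLetter, coneWord_node_of_le h.le, coneWord_node_of_le (by omega)]

theorem coneWord_hasLetter_self (hn : 0 < n) (hp : p ∈ σ.node) :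
    (coneWord σ τ p q f).HasLetter p :=
  ⟨(coneWord_node_of_le le_rfl).2 hp, coneWord_node_of_mem (by omega) (by omega)⟩

theorem coneWord_hasLetter_of_mem {i : ℤ} (h : p - n < i) (h' : i < p) :
    (coneWord σ τ p q f).HasLetter i :=
  ⟨coneWord_node_of_mem h.le h', coneWord_node_of_mem (by omega) (by omega)⟩

theorem coneWord_hasLetter_sub (hn : 0 < n) (hp : p ∈ σ.node) :
    (coneWord σ τ p q f).HasLetter (p - n) ↔ σ.HasLetter p := by
  rw [Word.HasLetter, Word.HasLetter, coneWord_node_of_lt (i := p - n - 1) (by omega),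
    show p - n - 1 + n = p - 1 by ring]
  exact and_congr_left fun _ => iff_of_true (coneWord_node_of_mem (by omega) (by omega)) hp

theorem coneWord_hasLetter_of_lt {i : ℤ} (h : i < p - n) :
    (coneWord σ τ p q f).HasLetter i ↔ σ.HasLetter (i + n) := by
  rw [Word.HasLetter, Word.HasLetter, coneWord_node_of_lt h, coneWord_node_of_lt (by omega),
    show i - 1 + (n : ℤ) = i + n - 1 by ring]

/-- The hypotheses on the single map `f` that are used below, apart from those that concern only
the existence of the map. -/
structure Glueable (rel : Arr V → Arr V → Prop) (σ : Word V ℤ) (τ : Word V (ZMod n)) (p : ℤ)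
    (q : ZMod n) (f fL fR : List (Arr V)) : Prop where
  walk : σ.IsWalk rel
  band : τ.IsHomotopyBand rel
  mem : p ∈ σ.node
  deg_eq : σ.deg p = τ.deg q
  isPath : IsPath rel (σ.vtx p) (τ.vtx q) f
  inverse : (τ.letter q).direct = false
  path_τ : (τ.letter q).path = fL ++ f
  direct : σ.HasLetter p → (σ.letter p).direct = true
  path_σ : σ.HasLetter p → (σ.letter p).path = f ++ fR
  adj : σ.HasLetter (p + 1) → (σ.letter (p + 1)).Adj rel ⟨true, f⟩

namespace Glueable

variable {fL fR : List (Arr V)} (h : Glueable rel σ τ p q f fL fR)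

include h

theorem isPath_left : IsPath rel (τ.vtx (q - 1)) (τ.vtx q) (fL ++ f) :=
  h.path_τ ▸ (h.band.joins q (h.band.hasLetter q)).of_inverse h.inverse

theorem isPath_right (hs : σ.HasLetter p) : IsPath rel (σ.vtx p) (σ.vtx (p - 1)) (f ++ fR) :=
  h.path_σ hs ▸ (h.walk.joins p hs).of_direct (h.direct hs)

theorem deg_τ_pred : τ.deg (q - 1) = σ.deg p - 1 := by
  rw [h.band.deg_eq q (h.band.hasLetter q), if_neg (by simp [h.inverse]), h.deg_eq]

theorem deg_σ_pred (hs : σ.HasLetter p) : σ.deg (p - 1) = σ.deg p + 1 := by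
  rw [h.walk.deg_eq p hs, if_pos (h.direct hs)]

theorem unroll_letter : (unroll τ p q).letter p = ⟨true, fL ++ f⟩ := by
  rw [unroll_letter_self, Letter.inv, h.inverse, h.path_τ]
  rfl

theorem letter_sub (hs : σ.HasLetter p) :
    (coneWord σ τ p q f).letter (p - n) = ⟨true, fL ++ f ++ fR⟩ := by
  rw [coneWord_letter_sub h.band.pos, h.path_τ, h.path_σ hs, List.drop_left]

theorem adj_unroll : (⟨true, f⟩ : Letter V).Adj rel ((unroll τ p q).letter (p - 1)) := by
  have := (h.band.unroll p q).adj (p - 1) (unroll_hasLetter _) (unroll_hasLetter _)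
  rw [sub_add_cancel, h.unroll_letter] at this
  exact (Letter.adj_left_congr rfl rfl
    (List.getLast?_append_of_ne_nil _ h.isPath.ne_nil)).1 this

/-- Only the letters $p$ and $p-n$ are new. The junction of $\sigma_L$ and $f$ is the field `adj`.
The other junctions come from those of $\overline\tau$ and $\sigma$, because $f$ ends like $f_Lf$,
while $f_Lff_R$ begins like $f_Lf$ and ends like $ff_R$. -/
theorem isWalk_coneWord : (coneWord σ τ p q f).IsWalk rel := by
  have hn := h.band.two_le
  have hT := h.band.unroll p q
  refine ⟨fun i hi => ?_, fun i hi hi' => ?_, fun i hi => ?_⟩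
  · rcases lt_trichotomy p i with hpi | rfl | hpi
    · rw [coneWord_letter_of_lt_left hpi, coneWord_vtx_of_le hpi.le,
        coneWord_vtx_of_le (by omega)]
      exact h.walk.joins i ((coneWord_hasLetter_of_lt_left hpi).1 hi)
    · rw [coneWord_letter_self, coneWord_vtx_of_le le_rfl,
        coneWord_vtx_of_mem (by omega) (by omega), unroll_vtx_pred]
      exact h.isPath
    rcases lt_trichotomy (p - n) i with hpi' | rfl | hpi'
    · rw [coneWord_letter_of_mem hpi' hpi, coneWord_vtx_of_mem hpi'.le hpi,
        coneWord_vtx_of_mem (by omega) (by omega)]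
      exact hT.joins i (unroll_hasLetter i)
    · have hs := (coneWord_hasLetter_sub h.band.pos h.mem).1 hi
      rw [h.letter_sub hs, coneWord_vtx_of_mem le_rfl hpi, coneWord_vtx_of_lt (by omega),
        unroll_vtx_sub, unroll_vtx_self, show p - n - 1 + n = p - 1 by ring]
      exact h.isPath_left.glue h.isPath.ne_nil (h.isPath_right hs)
    · rw [coneWord_letter_of_lt hpi', coneWord_vtx_of_lt hpi', coneWord_vtx_of_lt (by omega),
        show i - 1 + (n : ℤ) = i + n - 1 by ring]
      exact h.walk.joins _ ((coneWord_hasLetter_of_lt hpi').1 hi)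
  · rcases lt_trichotomy p i with hpi | rfl | hpi
    · rw [coneWord_letter_of_lt_left hpi, coneWord_letter_of_lt_left (by omega)]
      exact h.walk.adj i ((coneWord_hasLetter_of_lt_left (by omega)).1 hi)
        ((coneWord_hasLetter_of_lt_left hpi).1 hi')
    · rw [coneWord_letter_self, coneWord_letter_of_lt_left (by omega)]
      exact h.adj ((coneWord_hasLetter_of_lt_left (by omega)).1 hi)
    rcases lt_trichotomy (p - n) i with hpi' | rfl | hpi'
    · rw [coneWord_letter_of_mem hpi' hpi]
      rcases eq_or_lt_of_le (show i ≤ p - 1 by omega) with rfl | hpi''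
      · rw [sub_add_cancel, coneWord_letter_self]
        exact h.adj_unroll
      · rw [coneWord_letter_of_mem (by omega) (by omega)]
        exact hT.adj i (unroll_hasLetter _) (unroll_hasLetter _)
    · have hs := (coneWord_hasLetter_sub h.band.pos h.mem).1 hi'
      have := hT.adj (p - n) (unroll_hasLetter _) (unroll_hasLetter _)
      rw [unroll_letter_sub, h.unroll_letter] at this
      rw [h.letter_sub hs, coneWord_letter_of_mem (by omega) (by omega)]
      exact (Letter.adj_right_congr rfl rfl
        (List.head?_append_of_ne_nil _ h.isPath_left.ne_nil)).2 this
    · have hi2 := (coneWord_hasLetter_of_lt hpi').1 hi'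
      rw [coneWord_letter_of_lt hpi']
      rcases eq_or_lt_of_le (show i ≤ p - n - 1 by omega) with rfl | hpi''
      · rw [show p - n - 1 + n = p - 1 by ring] at hi2 ⊢
        rw [sub_add_cancel] at hi ⊢
        have hs := (coneWord_hasLetter_sub h.band.pos h.mem).1 hi
        rw [h.letter_sub hs, List.append_assoc]
        have := h.walk.adj (p - 1)
        rw [sub_add_cancel] at this
        refine (Letter.adj_left_congr (h.direct hs) rfl ?_).1 (this hs hi2)
        rw [h.path_σ hs]
        exact .symm <| List.getLast?_append_of_ne_nil _ (h.isPath_right hs).ne_nil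
      · rw [coneWord_letter_of_lt (by omega), show i + 1 + (n : ℤ) = i + n + 1 by ring]
        have hi3 := (coneWord_hasLetter_of_lt (by omega)).1 hi
        rw [show i + 1 + (n : ℤ) = i + n + 1 by ring] at hi3
        exact h.walk.adj _ hi3 hi2
  · rcases lt_trichotomy p i with hpi | rfl | hpi
    · rw [coneWord_letter_of_lt_left hpi, coneWord_deg_of_le hpi.le,
        coneWord_deg_of_le (by omega),
        h.walk.deg_eq i ((coneWord_hasLetter_of_lt_left hpi).1 hi)]
      split_ifs <;> ring
    · rw [coneWord_letter_self, coneWord_deg_of_le le_rfl,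
        coneWord_deg_of_mem (by omega) (by omega), unroll_deg_pred, ← h.deg_eq, if_pos rfl]
      ring
    rcases lt_trichotomy (p - n) i with hpi' | rfl | hpi'
    · rw [coneWord_letter_of_mem hpi' hpi, coneWord_deg_of_mem hpi'.le hpi,
        coneWord_deg_of_mem (by omega) (by omega)]
      exact hT.deg_eq i (unroll_hasLetter i)
    · have hs := (coneWord_hasLetter_sub h.band.pos h.mem).1 hi
      rw [h.letter_sub hs, coneWord_deg_of_mem le_rfl hpi, coneWord_deg_of_lt (by omega),
        unroll_deg_sub, unroll_deg_self, show p - n - 1 + n = p - 1 by ring, if_pos rfl,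
        h.deg_τ_pred, h.deg_σ_pred hs]
      ring
    · rw [coneWord_letter_of_lt hpi', coneWord_deg_of_lt hpi', coneWord_deg_of_lt (by omega),
        show i - 1 + (n : ℤ) = i + n - 1 by ring,
        h.walk.deg_eq _ ((coneWord_hasLetter_of_lt hpi').1 hi)]
      split_ifs <;> ring

theorem isHomotopyString_coneWord (hσ : σ.IsHomotopyString rel) :
    (coneWord σ τ p q f).IsHomotopyString rel where
  toIsWalk := h.isWalk_coneWord
  nonempty := ⟨p, (coneWord_node_of_le le_rfl).2 h.mem⟩
  interval := by
    refine ⟨fun x hx y hy z hz => ?_⟩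
    obtain ⟨hz1, hz2⟩ := hz
    rcases le_or_gt p z with hpz | hpz
    · rw [coneWord_node_of_le (hpz.trans hz2)] at hy
      exact (coneWord_node_of_le hpz).2 (hσ.interval.out h.mem hy ⟨hpz, hz2⟩)
    rcases le_or_gt (p - n) z with hpz' | hpz'
    · exact coneWord_node_of_mem hpz' hpz
    · rw [coneWord_node_of_lt (by omega)] at hx
      exact (coneWord_node_of_lt hpz').2
        (hσ.interval.out hx h.mem ⟨by omega, by omega⟩)
  left_inf hb := by
    obtain ⟨m, hm⟩ := hσ.left_inf fun ⟨B, hB⟩ => hb ⟨max B p, fun i hi => by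
      rcases le_or_gt p i with hpi | hpi
      · exact le_max_of_le_left (hB ((coneWord_node_of_le hpi).1 hi))
      · exact le_max_of_le_right hpi.le⟩
    refine ⟨max m (p + 1), fun i hi => ?_⟩
    rw [coneWord_letter_of_lt_left (by omega)]
    exact hm i (by omega)
  right_inf hb := by
    obtain ⟨m, hm⟩ := hσ.right_inf fun ⟨B, hB⟩ => hb ⟨min (B - n) (p - n), fun i hi => by
      rcases le_or_gt (p - n) i with hpi | hpi
      · exact min_le_of_right_le hpi
      · have := hB ((coneWord_node_of_lt hpi).1 hi)
        exact min_le_of_left_le (by omega)⟩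
    refine ⟨min (m - n) (p - n - 1), fun i hi => ?_⟩
    rw [coneWord_letter_of_lt (by omega)]
    exact hm _ (by omega)

end Glueable

end Cone

/-! ### The graph maps from the cone word to the string -/

section Coefficients

variable {k : Type u} [Field k] {V : Type v} [Fintype V] [Quiver.{w} V]
  {rel : Arr V → Arr V → Prop}

theorem CommAt.of_reverse {u v : Word V ℤ} {a : ℤ → Alg k rel} {i : ℤ}
    (h : CommAt k rel u.reverse v.reverse a (1 - i)) :
    CommAt k rel u v (fun i => a (-i)) i := by
  obtain ⟨h1, h2⟩ := h
  rw [Word.fwd_reverse, Word.fwd_reverse, show 1 - (1 - i) = i by ring,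
    show 1 - i - 1 = -i by ring] at h1
  rw [Word.bwd_reverse, Word.bwd_reverse, show 1 - (1 - i) = i by ring,
    show 1 - i - 1 = -i by ring] at h2
  exact ⟨by simpa only [neg_sub] using h2, by simpa only [neg_sub] using h1⟩

theorem CompatAt.of_reverse {δ : ℤ} {u v : Word V ℤ} {x : Alg k rel} {i : ℤ}
    (h : CompatAt k rel δ u.reverse v.reverse x (-i)) : CompatAt k rel δ u v x i := by
  simpa only [CompatAt, Word.reverse, Set.mem_ofPred_eq, neg_neg] using h

theorem CommAt.congr {u v : Word V ℤ} {a b : ℤ → Alg k rel} {i : ℤ} (h : CommAt k rel u v a i)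
    (h1 : b i = a i) (h2 : b (i - 1) = a (i - 1)) : CommAt k rel u v b i :=
  ⟨by rw [h1, h2, h.fwd], by rw [h1, h2, h.bwd]⟩

/-- The word `u` with its indices moved to the left. -/
def Word.shift (u : Word V ℤ) (n : ℤ) : Word V ℤ where
  node := {i | i - n ∈ u.node}
  vtx i := u.vtx (i - n)
  deg i := u.deg (i - n)
  letter i := u.letter (i - n)

theorem Word.hasLetter_shift {u : Word V ℤ} {n i : ℤ} :
    (u.shift n).HasLetter i ↔ u.HasLetter (i - n) := by
  simp only [Word.HasLetter, Word.shift, Set.mem_ofPred_eq, show i - 1 - n = i - n - 1 by ring]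

theorem Word.IsWalk.shift {u : Word V ℤ} (hu : u.IsWalk rel) (n : ℤ) : (u.shift n).IsWalk rel where
  joins i h := by
    have := hu.joins _ (Word.hasLetter_shift.1 h)
    rwa [show i - n - 1 = i - 1 - n by ring] at this
  adj i h h' := by
    rw [Word.hasLetter_shift] at h h'
    rw [show i + 1 - n = i - n + 1 by ring] at h
    have := hu.adj _ h h'
    rwa [show i - n + 1 = i + 1 - n by ring] at this
  deg_eq i h := by
    have := hu.deg_eq _ (Word.hasLetter_shift.1 h)
    rwa [show i - n - 1 = i - 1 - n by ring] at this

theorem Word.fwd_shift (u : Word V ℤ) (n i : ℤ) :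
    (u.shift n).fwd k rel i = u.fwd k rel (i - n) :=
  Word.fwd_congr k Word.hasLetter_shift rfl

theorem Word.bwd_shift (u : Word V ℤ) (n i : ℤ) :
    (u.shift n).bwd k rel i = u.bwd k rel (i - n) :=
  Word.bwd_congr k Word.hasLetter_shift rfl

theorem Word.AgreeAt.trans {u v t : Word V ℤ} {i : ℤ} (h : u.AgreeAt v i) (h' : v.AgreeAt t i) :
    u.AgreeAt t i :=
  ⟨h.left, h'.right, h.letter.trans h'.letter⟩

theorem Word.AgreeAt.reverse {u v : Word V ℤ} {i : ℤ} (h : u.AgreeAt v (1 - i)) :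
    u.reverse.AgreeAt v.reverse i :=
  ⟨Word.hasLetter_reverse.2 h.left, Word.hasLetter_reverse.2 h.right, congrArg Letter.inv h.letter⟩

theorem Word.AgreeAt.of_reverse {u v : Word V ℤ} {i : ℤ}
    (h : u.reverse.AgreeAt v.reverse (1 - i)) : u.AgreeAt v i := by
  refine ⟨?_, ?_, ?_⟩
  · simpa using Word.hasLetter_reverse.1 h.left
  · simpa using Word.hasLetter_reverse.1 h.right
  · simpa [Word.reverse] using congrArg Letter.inv h.letter

theorem Word.AgreeAt.fwd {u v : Word V ℤ} {i : ℤ} (h : u.AgreeAt v i) :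
    u.fwd k rel i = v.fwd k rel i :=
  Word.fwd_congr k (iff_of_true h.left h.right) h.letter

theorem Word.AgreeAt.bwd {u v : Word V ℤ} {i : ℤ} (h : u.AgreeAt v i) :
    u.bwd k rel i = v.bwd k rel i :=
  Word.bwd_congr k (iff_of_true h.left h.right) h.letter

/-- An ending at $i$ involves the letters $i$ and $i-1$ of the source. Hence replacing the source
requires agreement one letter beyond the point where it stops agreeing with the target. -/
theorem Ends.congr {δ : ℤ} {u u' v : Word V ℤ} {i : ℤ} {w : Alg k rel}
    (h : Ends k rel δ u v i w) (h1 : u'.AgreeAt u i) (h2 : u'.AgreeAt u (i - 1))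
    (hm : u'.MatchAt 0 u (i - 1)) : Ends k rel δ u' v i w where
  fwd := by rw [h1.fwd, h.fwd]
  bwd := by rw [h1.bwd, h.bwd]
  next_fwd := h.next_fwd
  next_bwd := by rw [h2.bwd, h.next_bwd]
  compat hi hw := by
    have := h.compat h1.right.2 hw
    rw [hm.deg, add_zero] at this
    rwa [hm.vtx]

namespace Glueable

variable {n : ℕ} {σ : Word V ℤ} {τ : Word V (ZMod n)} {p : ℤ} {q : ZMod n} {f : List (Arr V)}
  {fL fR : List (Arr V)} (h : Glueable rel σ τ p q f fL fR) (hg : IsGentle rel)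

include h

theorem fwd_self : (coneWord σ τ p q f).fwd k rel p = eval k rel f := by
  rw [Word.fwd_of_direct k (coneWord_hasLetter_self h.band.pos h.mem) (by
    rw [coneWord_letter_self]), coneWord_letter_self]

theorem bwd_self : (coneWord σ τ p q f).bwd k rel p = 0 :=
  Word.bwd_of_direct k (by rw [coneWord_letter_self])

theorem bwd_σ : σ.bwd k rel p = 0 := by
  by_cases hs : σ.HasLetter p
  · exact Word.bwd_of_direct k (h.direct hs)
  · exact Word.bwd_of_not k hs

theorem bwd_sub : (coneWord σ τ p q f).bwd k rel (p - n) = 0 :=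
  Word.bwd_of_direct k (by rw [coneWord_letter_sub h.band.pos])

/-- If $\sigma_R$ is empty, the letter $p-n$ of the cone word does not exist either and both sides
vanish, so the two forms of $c$ can be treated together. -/
theorem fwd_sub : (coneWord σ τ p q f).fwd k rel (p - n) = eval k rel fL * σ.fwd k rel p := by
  by_cases hs : σ.HasLetter p
  · rw [Word.fwd_of_direct k ((coneWord_hasLetter_sub h.band.pos h.mem).2 hs) (by
      rw [h.letter_sub hs]), h.letter_sub hs, Word.fwd_of_direct k hs (h.direct hs), h.path_σ hs,
      ← eval_append, List.append_assoc]
  · rw [Word.fwd_of_not k hs, mul_zero]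
    exact Word.fwd_of_not k fun h' => hs ((coneWord_hasLetter_sub h.band.pos h.mem).1 h')

/-- To the right of $p$ the cone word first runs through one turn of $\overline\tau$. Its letter
$p-n$ is again $f_Lf$ as $f_R$ is trivial, and then it continues with $\sigma$ shifted by $n$. That
part of $\sigma$ already agrees with the unrolled band, which is periodic. As $n\ge 2$, the
agreement reaches one letter beyond $j$. -/
theorem unroll_agreeAt_of_right (hs : σ.HasLetter p) (hR : fR = []) {j : ℤ}
    (ha : ∀ i, j < i → i < p → (unroll τ p q).AgreeAt σ i) {i : ℤ} (hi : j - 1 ≤ i)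
    (hip : i < p) : (coneWord σ τ p q f).AgreeAt (unroll τ p q) i := by
  have hn := h.band.two_le
  refine ⟨?_, unroll_hasLetter i, ?_⟩ <;> rcases lt_trichotomy (p - n) i with hpi | rfl | hpi
  · exact coneWord_hasLetter_of_mem hpi hip
  · exact (coneWord_hasLetter_sub h.band.pos h.mem).2 hs
  · exact (coneWord_hasLetter_of_lt hpi).2 (ha _ (by omega) (by omega)).right
  · exact coneWord_letter_of_mem hpi hip
  · rw [h.letter_sub hs, unroll_letter_sub, h.unroll_letter, hR, List.append_nil]
  · rw [coneWord_letter_of_lt hpi, ← (ha _ (by omega) (by omega)).letter,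
      ← unroll_letter_sub, add_sub_cancel_right]

/-- With $f_R$ trivial, $\sigma_R=f$ leads from the node $p$ to the vertex of the node $q$, so
$\sigma$ and the unrolled band can be compared from $p-1$ on. -/
theorem matchAt_pred (hs : σ.HasLetter p) (hR : fR = []) :
    (unroll τ p q).MatchAt 1 σ (p - 1) := by
  have h1 := h.isPath_right hs
  rw [hR, List.append_nil] at h1
  refine ⟨hs.2, ?_, ?_⟩
  · rw [unroll_vtx_pred]
    exact (h.isPath.ends_unique h1).2
  · rw [unroll_deg_pred, h.deg_σ_pred hs, h.deg_eq]

/-- With $f_L$ trivial, $\overline{\tau_R}=f$, and the comparison can start at $p$ itself, going to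
the left. -/
theorem matchAt_self (hL : fL = []) : (unroll τ p q).MatchAt 1 σ p := by
  have h1 := h.isPath_left
  rw [hL, List.nil_append] at h1
  refine ⟨h.mem, ?_, ?_⟩
  · rw [unroll_vtx_self]
    exact (h1.ends_unique h.isPath).1
  · rw [unroll_deg_self, h.deg_τ_pred]
    ring

theorem coneWord_matchAt {i : ℤ} (hi : p ≤ i) (hi' : i ∈ (coneWord σ τ p q f).node) :
    (coneWord σ τ p q f).MatchAt 1 σ i :=
  ⟨(coneWord_node_of_le hi).1 hi', coneWord_vtx_of_le hi, by rw [coneWord_deg_of_le hi]; ring⟩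

theorem shift_matchAt {i : ℤ} (hi : i < p) (hi' : i ∈ ((coneWord σ τ p q f).shift n).node) :
    ((coneWord σ τ p q f).shift n).MatchAt 1 σ i := by
  refine ⟨?_, ?_, ?_⟩
  · simpa using (coneWord_node_of_lt (σ := σ) (τ := τ) (q := q) (f := f) (by omega)).1 hi'
  · change (coneWord σ τ p q f).vtx (i - n) = _
    rw [coneWord_vtx_of_lt (by omega), sub_add_cancel]
  · change _ = (coneWord σ τ p q f).deg (i - n) + 1
    rw [coneWord_deg_of_lt (by omega), sub_add_cancel, sub_add_cancel]

include hg

/-- The cone word has the letter $f$ where $\sigma$ has nothing, $ff_R$ or $f$. In the first case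
the map stops at once, in the second it ends with the component $f_R$. In the third the words agree
past $p$ and the unrolled band must be compared with $\sigma$, the alternative of a map back being
excluded by `hb`. -/
theorem exists_ends_right
    (hb : σ.HasLetter p → fR = [] → ¬ ∃ b, RightTail k rel (-1) σ (unroll τ p q) (p - 1) b) :
    ∃ j ≤ p, (∀ i, j < i → i ≤ p → (coneWord σ τ p q f).AgreeAt σ i) ∧
      ∃ w, Ends k rel 1 (coneWord σ τ p q f) σ j w := by
  have hc := h.isWalk_coneWord
  have hpc := coneWord_hasLetter_self (τ := τ) (q := q) (f := f) h.band.pos h.mem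
  by_cases hs : σ.HasLetter p; swap
  · exact ⟨p, le_rfl, fun i h1 h2 => absurd h1 (by omega), 0,
      ends_zero h.bwd_self (Word.fwd_of_not k hs)⟩
  by_cases hR : fR = []; swap
  · refine ⟨p, le_rfl, fun i h1 h2 => absurd h1 (by omega), eval k rel fR,
      ends_of_direct hg hc h.walk (h.coneWord_matchAt le_rfl hpc.1).deg hpc hs
        (by rw [coneWord_letter_self]) (h.direct hs) hR ?_⟩
    rw [coneWord_letter_self, h.path_σ hs]
  have hm := h.matchAt_pred hs hR
  rcases ends_or_exists_rightTail (k := k) (L := ⟨true, f⟩) (s := σ.vtx p) hg (h.band.unroll p q)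
      h.walk hm trivial (by rw [unroll_vtx_pred]; exact h.isPath) (fun _ => h.adj_unroll) (by
        intro h'
        have := h.walk.adj (p - 1)
        rw [sub_add_cancel] at this
        refine (Letter.adj_left_congr (h.direct hs) rfl ?_).1 (this hs h')
        rw [h.path_σ hs, hR, List.append_nil]) with ⟨j, hj, ha, w, hw⟩ | hb'
  · have ha' : ∀ i, j < i → i < p → (unroll τ p q).AgreeAt σ i :=
      fun i h1 h2 => ha i h1 (by omega)
    have hag := fun i => h.unroll_agreeAt_of_right hs hR ha' (i := i)
    refine ⟨j, by omega, fun i h1 h2 => ?_, w, ?_⟩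
    · rcases eq_or_lt_of_le h2 with rfl | h2
      · refine ⟨hpc, hs, ?_⟩
        have h3 := h.path_σ hs
        have h4 := h.direct hs
        rw [coneWord_letter_self]
        generalize σ.letter i = l at h3 h4
        obtain ⟨d, l⟩ := l
        rw [hR, List.append_nil] at h3
        rw [h3.symm, h4.symm]
      · exact (hag i (by omega) h2).trans (ha' i h1 h2)
    · refine hw.congr (hag j (by omega) (by omega)) (hag _ le_rfl (by omega)) ?_
      have hm0 : (coneWord σ τ p q f).MatchAt 0 (unroll τ p q) (p - 1) :=
        ⟨trivial, coneWord_vtx_of_mem (by have := h.band.two_le; omega) (by omega), by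
          rw [coneWord_deg_of_mem (by have := h.band.two_le; omega) (by omega), add_zero]⟩
      exact (Word.matchAt_of_agreeAt hc (h.band.unroll p q) hm0
        hpc.2 (by omega) (fun i h1 h2 => hag i (by omega) (by omega))).1
  · exact absurd hb' (hb hs hR)

theorem exists_right
    (hb : σ.HasLetter p → fR = [] → ¬ ∃ b, RightTail k rel (-1) σ (unroll τ p q) (p - 1) b) :
    ∃ (a : ℤ → Alg k rel) (K : ℤ), (∀ i, p ≤ i → a i = 1) ∧
      (∀ i, CommAt k rel (coneWord σ τ p q f) σ a i) ∧
      (∀ i, CompatAt k rel 1 (coneWord σ τ p q f) σ (a i) i) ∧ ∀ i < K, a i = 0 := by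
  have hc := h.isWalk_coneWord
  obtain ⟨j, hj, ha, w, hw⟩ := h.exists_ends_right (k := k) hg hb
  obtain ⟨a, hat, -, ha0⟩ := exists_rightTail_of_ends hc h.walk (h.coneWord_matchAt le_rfl) hj ha hw
  have h1 : ∀ i, i ≤ p → (if p ≤ i then 1 else a i) = a i := fun i hi => by
    split_ifs with hp
    · rw [le_antisymm hi hp, hat.one]
    · rfl
  refine ⟨fun i => if p ≤ i then 1 else a i, j - 1, fun i hi => if_pos hi, fun i => ?_,
    fun i => ?_, fun i hi => (h1 i (by omega)).trans (ha0 i hi)⟩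
  · rcases le_or_gt i p with hi | hi
    · exact (hat.comm i hi).congr (h1 i hi) (h1 _ (by omega))
    · exact .of_agreeAt (coneWord_hasLetter_of_lt_left hi) (coneWord_letter_of_lt_left hi)
        (if_pos hi.le) (if_pos (by omega))
  · rcases le_or_gt i p with hi | hi
    · change CompatAt k rel 1 _ _ (if p ≤ i then 1 else a i) i
      rw [h1 i hi]
      exact hat.compat i hi
    · change CompatAt k rel 1 _ _ (if p ≤ i then 1 else a i) i
      rw [if_pos hi.le]
      exact fun hi' => (h.coneWord_matchAt hi.le hi').compatAt hi'

omit hg in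
-- The mirror image: in the shifted cone word, the turn of $\overline\tau$ is preceded on the left
-- by $f$ at the index $p+n$, which is another copy of $\overline{\tau_R}$ as $f_L$ is trivial, and
-- then by the letters of $\sigma$ to the left of $p$, shifted by $n$.
theorem unroll_agreeAt_of_left (hL : fL = []) {j : ℤ}
    (ha : ∀ i, p < i → i < j → (unroll τ p q).AgreeAt σ i) {i : ℤ} (hi : i ≤ j + 1)
    (hip : p < i) : ((coneWord σ τ p q f).shift n).AgreeAt (unroll τ p q) i := by
  have hn := h.band.two_le
  refine ⟨Word.hasLetter_shift.2 ?_, unroll_hasLetter i, ?_⟩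
  · rcases lt_trichotomy (p + n) i with hpi | rfl | hpi
    · exact (coneWord_hasLetter_of_lt_left (by omega)).2 (ha _ (by omega) (by omega)).right
    · rw [add_sub_cancel_right]
      exact coneWord_hasLetter_self h.band.pos h.mem
    · exact coneWord_hasLetter_of_mem (by omega) (by omega)
  · rw [← unroll_letter_sub i]
    change (coneWord σ τ p q f).letter (i - n) = _
    rcases lt_trichotomy (p + n) i with hpi | rfl | hpi
    · rw [coneWord_letter_of_lt_left (by omega), ← (ha _ (by omega) (by omega)).letter]
    · rw [add_sub_cancel_right, coneWord_letter_self, h.unroll_letter, hL, List.nil_append]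
    · exact coneWord_letter_of_mem (by omega) (by omega)

/-- The letters $f_Lff_R$ of the cone word and $ff_R$ of $\sigma$ differ by $f_L$, which is the last
component. It is killed further on: an inverse $\sigma_L$ does not cancel with $f$, so
$f_L\overline{\sigma_L}$ contains a relation, and a direct neighbour in $\overline\tau$ meets $f_L$
in a relation. -/
theorem ends_left (hL : fL ≠ []) : Ends k rel 1 ((coneWord σ τ p q f).shift n).reverse σ.reverse
    (1 - p) (eval k rel fL) := by
  have hn := h.band.two_le
  have hp1 : 1 - (1 - p - 1) = p + 1 := by ring
  have hp2 : -(1 - p - 1) = p := by ring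
  refine ⟨?_, ?_, ?_, ?_, fun _ _ => ⟨?_, ?_, fun g _ => smul_mem_P k rel ?_ g⟩⟩
  · rw [Word.fwd_reverse, Word.fwd_reverse, sub_sub_cancel, h.bwd_σ, Word.bwd_shift, h.bwd_sub,
      zero_mul]
  · rw [Word.bwd_reverse, Word.bwd_reverse, sub_sub_cancel, Word.fwd_shift, h.fwd_sub]
  · rw [Word.fwd_reverse, hp1]
    by_cases hd : σ.HasLetter (p + 1) ∧ (σ.letter (p + 1)).direct = false
    · rw [Word.bwd_of_inverse k hd.1 hd.2]
      have ha := h.adj hd.1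
      rw [Letter.Adj, hd.2] at ha
      have hj := (h.walk.joins _ hd.1).of_inverse hd.2
      rw [add_sub_cancel_right] at hj
      exact eval_mul_eval_eq_zero k (hg.rel_of_head_ne h.isPath_left h.isPath hL hj ha.symm)
    · rw [Word.bwd, if_neg hd, mul_zero]
  · rw [Word.bwd_reverse, hp1, Word.fwd_shift]
    have hc := (h.band.unroll p q).adj p (unroll_hasLetter _) (unroll_hasLetter _)
    rw [h.unroll_letter, ← unroll_letter_sub,
      ← coneWord_letter_of_mem (σ := σ) (f := f) (by omega) (by omega)] at hc
    cases hd : ((coneWord σ τ p q f).letter (p + 1 - n)).direct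
    · rw [Word.fwd_of_inverse k hd, zero_mul]
    · rw [Letter.Adj, hd] at hc
      simp only [List.head?_append_of_ne_nil _ hL] at hc
      rw [Word.fwd_of_direct k (coneWord_hasLetter_of_mem (by omega) (by omega)) hd]
      exact eval_mul_eval_eq_zero k hc
  · simpa [Word.reverse] using h.mem
  · change σ.deg (-(1 - p - 1)) = (coneWord σ τ p q f).deg (-(1 - p - 1) - n) + 1
    rw [hp2, coneWord_deg_of_mem le_rfl (by omega), unroll_deg_sub, unroll_deg_self, h.deg_τ_pred,
      sub_add_cancel]
  · change eval k rel fL ∈ P k rel (σ.vtx (-(1 - p - 1)))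
    rw [hp2]
    exact eval_mem_P k rel (h.isPath_left.of_append_left h.isPath hL)

theorem exists_rightTail_left (hb : fL = [] →
      ¬ ∃ b, RightTail k rel (-1) σ.reverse (unroll τ p q).reverse (-p) b) :
    ∃ (a : ℤ → Alg k rel) (K : ℤ), a (-p) = eval k rel fL ∧
      (∀ i ≤ -p, CommAt k rel ((coneWord σ τ p q f).shift n).reverse σ.reverse a i) ∧
      (∀ i ≤ -p, CompatAt k rel 1 ((coneWord σ τ p q f).shift n).reverse σ.reverse (a i) i) ∧
      ∀ i < K, a i = 0 := by
  have hn := h.band.two_le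
  have hc := h.isWalk_coneWord
  have hT := (h.band.unroll p q).reverse
  by_cases hL : fL = []; swap
  · obtain ⟨a, hat, ha1, ha0⟩ := exists_rightTail_of_ends (hc.shift n).reverse h.walk.reverse
      (m := 1 - p) (fun hi => by
        have hm := h.shift_matchAt (i := p - 1) (by omega) (by simpa [Word.reverse] using hi)
        have e : -(1 - p) = p - 1 := by ring
        refine ⟨?_, ?_, ?_⟩
        · simpa [Word.reverse] using hm.node
        · simpa [Word.reverse] using hm.vtx
        · simpa [Word.reverse] using hm.deg) le_rfl (fun i h1 h2 => absurd h1 (by omega))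
      (h.ends_left (k := k) hg hL)
    rw [show 1 - p - 1 = -p by ring] at ha1
    exact ⟨a, 1 - p - 1, ha1, fun i hi => hat.comm i (by omega),
      fun i hi => hat.compat i (by omega), ha0⟩
  have hmT := h.matchAt_self hL
  have hm : (unroll τ p q).reverse.MatchAt 1 σ.reverse (-p) :=
    ⟨by simpa [Word.reverse] using hmT.node, by simpa [Word.reverse] using hmT.vtx,
      by simpa [Word.reverse] using hmT.deg⟩
  have hpf := h.isPath_left
  rw [hL, List.nil_append] at hpf
  -- Read from right to left, both words arrive at the node $p$ by $\overline f$. In $\sigma$ this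
  -- need not be an actual letter; only the adjacency of $\sigma_L$ with $f$ is used.
  rcases ends_or_exists_rightTail (k := k) (L := ⟨false, f⟩) (s := τ.vtx q) hg hT
      h.walk.reverse hm trivial (by
        simpa [Word.reverse, unroll_vtx_self, Letter.Joins] using hpf) (by
        intro _
        have := ((h.band.unroll p q).adj p (unroll_hasLetter _) (unroll_hasLetter _)).inv
        rw [h.unroll_letter, hL, List.nil_append] at this
        simp only [Word.reverse, sub_neg_eq_add, add_comm 1 p]
        exact this) (by
        intro h'
        have := Word.hasLetter_reverse.1 h'
        rw [sub_neg_eq_add, add_comm] at this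
        simp only [Word.reverse, sub_neg_eq_add, add_comm 1 p]
        exact (h.adj this).inv) with
    ⟨j, hj, ha, w, hw⟩ | hb'
  · have ha' : ∀ i, p < i → i < 1 - j → (unroll τ p q).AgreeAt σ i :=
      fun i h1 h2 => (ha (1 - i) (by omega) (by omega)).of_reverse
    have hag : ∀ i, j - 1 ≤ i → i ≤ -p →
        ((coneWord σ τ p q f).shift n).reverse.AgreeAt (unroll τ p q).reverse i :=
      fun i h1 h2 => (h.unroll_agreeAt_of_left hL ha' (by omega) (by omega)).reverse
    have hm0 : ((coneWord σ τ p q f).shift n).MatchAt 0 (unroll τ p q) p := by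
      refine ⟨trivial, ?_, ?_⟩
      · change (coneWord σ τ p q f).vtx (p - n) = _
        rw [coneWord_vtx_of_mem le_rfl (by omega), unroll_vtx_sub]
      · change _ = (coneWord σ τ p q f).deg (p - n) + 0
        rw [coneWord_deg_of_mem le_rfl (by omega), unroll_deg_sub, add_zero]
    have hm0' : ((coneWord σ τ p q f).shift n).reverse.MatchAt 0 (unroll τ p q).reverse (-p) :=
      ⟨trivial, by simpa [Word.reverse] using hm0.vtx, by simpa [Word.reverse] using hm0.deg⟩
    have hcn : -p ∈ ((coneWord σ τ p q f).shift n).reverse.node := by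
      change - -p - (n : ℤ) ∈ (coneWord σ τ p q f).node
      rw [neg_neg]
      exact coneWord_node_of_mem le_rfl (by omega)
    have he := hw.congr (hag j (by omega) hj) (hag _ le_rfl (by omega))
      (Word.matchAt_of_agreeAt (hc.shift n).reverse hT hm0' hcn (by omega)
        (fun i h1 h2 => hag i (by omega) h2)).1
    obtain ⟨a, hat, -, ha0⟩ := exists_rightTail_of_ends (hc.shift n).reverse h.walk.reverse
      (fun _ => ⟨hm.node, hm0'.vtx.trans hm.vtx, by rw [hm.deg, hm0'.deg]; ring⟩) hj
      (fun i h1 h2 => (hag i (by omega) h2).trans (ha i h1 h2)) he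
    exact ⟨a, j - 1, by rw [hat.one, hL]; rfl, hat.comm, hat.compat, ha0⟩
  · exact absurd hb' (hb hL)

theorem exists_left (hb : fL = [] →
      ¬ ∃ b, RightTail k rel (-1) σ.reverse (unroll τ p q).reverse (-p) b) :
    ∃ (b : ℤ → Alg k rel) (K : ℤ), b p = eval k rel fL ∧ (∀ i < p, b i = 1) ∧
      (∀ i, CommAt k rel ((coneWord σ τ p q f).shift n) σ b i) ∧
      (∀ i, CompatAt k rel 1 ((coneWord σ τ p q f).shift n) σ (b i) i) ∧ ∀ i > K, b i = 0 := by
  have hc := h.isWalk_coneWord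
  obtain ⟨a, K, hap, hcomm, hcompat, ha0⟩ := h.exists_rightTail_left (k := k) hg hb
  set b : ℤ → Alg k rel := fun i => if i < p then 1 else a (-i) with hbdef
  have b1 : ∀ i < p, b i = 1 := fun i hi => if_pos hi
  have b2 : ∀ i, p ≤ i → b i = a (-i) := fun i hi => if_neg (by omega)
  refine ⟨b, max (-K) p, (b2 p le_rfl).trans hap, b1, fun i => ?_, fun i => ?_, fun i hi => ?_⟩
  · rcases lt_trichotomy i p with hi | rfl | hi
    · refine .of_agreeAt ?_ ?_ (b1 i hi) (b1 _ (by omega))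
      · rw [Word.hasLetter_shift, coneWord_hasLetter_of_lt (by omega), sub_add_cancel]
      · exact (coneWord_letter_of_lt (by omega)).trans (by rw [sub_add_cancel])
    -- The letter $p$ carries the transition from $1$ to $f_L$, namely $f_L\cdot ff_R=f_Lff_R$.
    · refine ⟨?_, ?_⟩
      · rw [b1 _ (by omega), b2 _ le_rfl, hap, mul_one, Word.fwd_shift, h.fwd_sub]
      · rw [Word.bwd_shift, h.bwd_sub, h.bwd_σ, mul_zero, zero_mul]
    · exact (CommAt.of_reverse (hcomm (1 - i) (by omega))).congr (b2 i hi.le) (b2 _ (by omega))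
  · rcases lt_or_ge i p with hi | hi
    · rw [b1 i hi]
      exact fun hi' => (h.shift_matchAt hi hi').compatAt hi'
    · rw [b2 i hi]
      exact (hcompat (-i) (by omega)).of_reverse
  · rw [b2 i (by omega), ha0 _ (by omega)]

end Glueable

end Coefficients

/-! ### Folding the unrolled band, and null-homotopic single maps -/

/-- Solved from $0$ in both directions and then rescaled. It supplies the alternating signs as well
as the scalars along the unrolled band. -/
theorem exists_int_recursion {G : Type*} [CommGroup G] (r : ℤ → G) (m : ℤ) (x : G) :
    ∃ t : ℤ → G, t m = x ∧ ∀ i, t (i - 1) = r i * t i := by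
  obtain ⟨t, ht⟩ : ∃ t : ℤ → G, ∀ i, t (i - 1) = r i * t i := by
    refine ⟨fun i => Int.rec (fun n => Nat.rec 1 (fun j y => (r (j + 1))⁻¹ * y) n)
      (fun n => Nat.rec (r 0) (fun j y => r (Int.negSucc j) * y) n) i, fun i => ?_⟩
    rcases i with (_ | i) | i
    · exact (mul_one (r 0)).symm
    · rw [show Int.ofNat (i + 1) - 1 = Int.ofNat i by simp]
      exact (mul_inv_cancel_left _ _).symm
    · rw [show Int.negSucc i - 1 = Int.negSucc (i + 1) by omega]
  refine ⟨fun i => t i * ((t m)⁻¹ * x), mul_inv_cancel_left _ _, fun i => ?_⟩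
  change t (i - 1) * _ = _
  rw [ht, mul_assoc]

section Fold

variable {k : Type u} [Field k] {V : Type v} [Fintype V] [Quiver.{w} V]
  {rel : Arr V → Arr V → Prop} {n : ℕ} {σ : Word V ℤ} {τ : Word V (ZMod n)} {p : ℤ} {q : ZMod n}
  {f : List (Arr V)}

/-- The scalars `t i` turn the projection of the unrolled word onto the band with the scalars `c`
into a chain map. -/
structure IsFolding (c : ZMod n → kˣ) (τ : Word V (ZMod n)) (p : ℤ) (q : ZMod n)
    (t : ℤ → kˣ) : Prop where
  fwd : ∀ i, ((unroll τ p q).letter i).direct = true → t (i - 1) = c (q + (p - i : ℤ)) * t i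
  bwd : ∀ i, ((unroll τ p q).letter i).direct = false → t i = c (q + (p - i : ℤ)) * t (i - 1)

/-- The scalars live on the unrolled word and need not be periodic, so the product of the scalars
around the band imposes no condition. -/
theorem exists_isFolding (c : ZMod n → kˣ) (τ : Word V (ZMod n)) (p : ℤ) (q : ZMod n) (m : ℤ)
    (x : kˣ) : ∃ t : ℤ → kˣ, t m = x ∧ IsFolding c τ p q t := by
  obtain ⟨t, hm, ht⟩ := exists_int_recursion
    (fun i => if ((unroll τ p q).letter i).direct = true then c (q + (p - i : ℤ))
      else (c (q + (p - i : ℤ)))⁻¹) m x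
  refine ⟨t, hm, fun i hi => ?_, fun i hi => ?_⟩
  · rw [ht, if_pos hi]
  · rw [ht, if_neg (by simp [hi]), mul_inv_cancel_left]

theorem fwd_unroll (hτ : τ.IsHomotopyBand rel) (i : ℤ) :
    τ.fwd k rel (q + (p - i : ℤ)) = (unroll τ p q).bwd k rel i :=
  (Word.bwd_of_inv k (iff_of_true (unroll_hasLetter i) (hτ.hasLetter _)) rfl).symm

theorem bwd_unroll (hτ : τ.IsHomotopyBand rel) (i : ℤ) :
    τ.bwd k rel (q + (p - i : ℤ)) = (unroll τ p q).fwd k rel i :=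
  (Word.fwd_of_inv k (iff_of_true (unroll_hasLetter i) (hτ.hasLetter _)) rfl).symm

theorem diff_single_unroll (hτ : τ.IsHomotopyBand rel) {c : ZMod n → kˣ} {t : ℤ → kˣ}
    (ht : IsFolding c τ p q t) (i : ℤ) (x : Alg k rel) :
    diff k rel (fun i => (c i : k)) τ
      (Finsupp.single (q + (p - 1 - i : ℤ)) ((t i : k) • x)) =
      Finsupp.single (q + (p - 1 - (i + 1) : ℤ))
        ((t (i + 1) : k) • (x * (unroll τ p q).bwd k rel (i + 1))) +
      Finsupp.single (q + (p - 1 - (i - 1) : ℤ))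
        ((t (i - 1) : k) • (x * (unroll τ p q).fwd k rel i)) := by
  have e1 : q + ((p - 1 - i : ℤ) : ZMod n) - 1 = q + ((p - 1 - (i + 1) : ℤ) : ZMod n) := by
    push_cast; ring
  have e2 : q + ((p - 1 - i : ℤ) : ZMod n) + 1 = q + ((p - 1 - (i - 1) : ℤ) : ZMod n) := by
    push_cast; ring
  have e3 : q + ((p - 1 - i : ℤ) : ZMod n) = q + ((p - (i + 1) : ℤ) : ZMod n) := by
    push_cast; ring
  have e4 : q + ((p - 1 - (i - 1) : ℤ) : ZMod n) = q + ((p - i : ℤ) : ZMod n) := by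
    push_cast; ring
  rw [diff_single, row_eq, e1, e2, smul_add, Finsupp.smul_single, Finsupp.smul_single, smul_eq_mul,
    smul_eq_mul, smul_mul_smul_comm, smul_mul_smul_comm]
  congr 2
  · rw [e3, fwd_unroll hτ]
    cases hd : ((unroll τ p q).letter (i + 1)).direct
    · have := ht.bwd _ hd
      rw [add_sub_cancel_right] at this
      rw [this, mul_comm, Units.val_mul]
    · rw [Word.bwd_of_direct k hd, mul_zero, smul_zero, smul_zero]
  · rw [e4, bwd_unroll hτ]
    cases hd : ((unroll τ p q).letter i).direct
    · rw [Word.fwd_of_inverse k hd, mul_zero, smul_zero, smul_zero]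
    · rw [ht.fwd _ hd, mul_comm, Units.val_mul]

theorem row_one (u : Word V ℤ) (i : ℤ) : row k rel (fun _ => 1) u i =
    Finsupp.single (i - 1) (u.fwd k rel i) + Finsupp.single (i + 1) (u.bwd k rel (i + 1)) := by
  rw [row_eq, one_smul, one_smul]

theorem singleTotal_single {ι κ : Type} [CommRing ι] [CommRing κ] [DecidableEq ι] (p : ι) (q : κ)
    (f : List (Arr V)) (i : ι) (x : Alg k rel) :
    singleTotal k rel p q f (Finsupp.single i x) =
      if i = p then Finsupp.single q (x * eval k rel f) else 0 := by
  rw [singleTotal, Finsupp.linearCombination_single]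
  split_ifs
  · rw [Finsupp.smul_single, smul_eq_mul]
  · exact smul_zero _

/-- If the map from the string to the unrolled band with coefficients `b` commutes with the
differentials up to `±f`, then the single map given by `f` is null-homotopic. -/
theorem quotient_map_eq_zero_of_coefficients (hσ : σ.IsWalk rel) (hτ : τ.IsHomotopyBand rel)
    (c : ZMod n → kˣ) (hf : IsSingleMap rel σ τ p q f) (b : ℤ → Alg k rel) (ε : kˣ)
    (hb : ∀ i, CompatAt k rel (-1) σ (unroll τ p q) (b i) i)
    (hcomm : ∀ i ≠ p, CommAt k rel σ (unroll τ p q) b i)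
    (hbwd : σ.bwd k rel p * b p = b (p - 1) * (unroll τ p q).bwd k rel p)
    (hfwd : σ.fwd k rel p * b (p - 1) - b p * (unroll τ p q).fwd k rel p =
      (ε : k) • eval k rel f) :
    (HomotopyCategory.quotient (ModuleCat.{max u v w} (Alg k rel)) (ComplexShape.up ℤ)).map
      (wordSingleMap k rel (fun _ => 1) (fun i => (c i : k)) hσ hτ.toIsWalk hf) = 0 := by
  obtain ⟨t, -, ht⟩ := exists_isFolding c τ p q 0 1
  -- A diagonal map that commutes with the differentials contributes nothing to $Hd+dH$ once its
  -- signs alternate. The value at $p-1$ is chosen such that the remaining term at $p$ has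
  -- coefficient one.
  obtain ⟨s, hs, hs'⟩ := exists_int_recursion (fun _ => (-1 : kˣ)) (p - 1) (ε⁻¹ * (t (p - 1))⁻¹)
  have hs1 : ∀ i, (s (i - 1) : k) = -(s i : k) := fun i => by rw [hs' i]; simp
  have hs2 : ∀ i, (s (i + 1) : k) = -(s i : k) := fun i => by
    have := hs1 (i + 1)
    rw [add_sub_cancel_right] at this
    rw [this, neg_neg]
  have hall : ∀ i, σ.bwd k rel i * b i = b (i - 1) * (unroll τ p q).bwd k rel i := fun i => by
    rcases eq_or_ne i p with rfl | hi
    exacts [hbwd, (hcomm i hi).bwd]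
  refine quotient_map_wordSingleMap_eq_zero (Finsupp.linearCombination (Alg k rel) fun i =>
    Finsupp.single (q + (p - 1 - i : ℤ)) ((t i : k) • (s i : k) • b i)) ?_ ?_
  · intro m m' hm g hg
    refine linearCombination_mem_term (fun i hi hi' x hx => ?_) hg
    refine smul_single_mem_term hi hi' hx fun _ hy => ?_
    have hbi : b i ≠ 0 := fun h0 => hy (by rw [h0, smul_zero, smul_zero])
    obtain ⟨-, h1, h2⟩ := hb i hi hbi
    refine ⟨by rw [hτ.node_eq]; trivial, fun _ => ?_, fun g hg => ?_⟩
    · change (unroll τ p q).deg i = m'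
      omega
    · rw [mul_smul_comm, mul_smul_comm]
      exact ksmul_mem_P k rel (ksmul_mem_P k rel (h2 g hg) _) _
  · intro i
    have e : ∀ (x y : Alg k rel) (j : ZMod n) (r r' : k), x • Finsupp.single j (r • r' • y) =
        Finsupp.single j (r • r' • (x * y)) := fun x y j r r' => by
      rw [Finsupp.smul_single, smul_eq_mul, mul_smul_comm, mul_smul_comm]
    have key : ∀ (X Y : ZMod n) (x y z : Alg k rel) (r r' r'' : k),
        (Finsupp.single X (r • -r'' • x) + Finsupp.single Y (r' • -r'' • y)) +
        (Finsupp.single Y (r' • r'' • y) + Finsupp.single X (r • r'' • z)) =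
        Finsupp.single X (r • -r'' • (x - z)) := fun X Y x y z r r' r'' => by
      simp only [neg_smul, smul_neg, Finsupp.single_neg, smul_sub, Finsupp.single_sub]
      abel
    rw [row_one, map_add, Finsupp.linearCombination_single, Finsupp.linearCombination_single,
      Finsupp.linearCombination_single, one_smul, diff_single_unroll hτ ht, e, e, smul_mul_assoc,
      smul_mul_assoc, hall, add_sub_cancel_right, hs1, hs2, key, singleTotal_single, one_mul]
    rcases eq_or_ne i p with rfl | hi
    · rw [if_pos rfl, hfwd, ← hs1, hs]
      congr 1
      · simp
      · have ht0 := (t (i - 1)).ne_zero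
        have hε0 := ε.ne_zero
        simp only [Units.val_mul, Units.val_inv_eq_inv_val, smul_smul]
        rw [show (t (i - 1) : k) * ((ε : k)⁻¹ * (t (i - 1) : k)⁻¹ * ε) = 1 by field_simp, one_smul]
    · rw [if_neg hi, (hcomm i hi).fwd, sub_self, smul_zero, smul_zero, Finsupp.single_zero]

namespace Glueable

variable {fL fR : List (Arr V)} (h : Glueable rel σ τ p q f fL fR)

include h

theorem bwd_unroll_self : (unroll τ p q).bwd k rel p = 0 :=
  Word.bwd_of_direct k (by rw [h.unroll_letter])

/-- Continued by zero to the left of $p-1$, the map commutes with the differentials except at the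
letter $p$, where the defect is $\sigma_R=f$. -/
theorem not_rightTail (c : ZMod n → kˣ) (hf : IsSingleMap rel σ τ p q f)
    (hne : (HomotopyCategory.quotient (ModuleCat.{max u v w} (Alg k rel))
      (ComplexShape.up ℤ)).map (wordSingleMap k rel (fun _ => 1) (fun i => (c i : k)) h.walk
        h.band.toIsWalk hf) ≠ 0) (hs : σ.HasLetter p) (hR : fR = []) :
    ¬ ∃ b, RightTail k rel (-1) σ (unroll τ p q) (p - 1) b := by
  rintro ⟨b, hb⟩
  have h0 : ∀ i, p ≤ i → (if i < p then b i else 0) = 0 := fun i hi => if_neg (by omega)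
  have h1 : ∀ i < p, (if i < p then b i else 0) = b i := fun i hi => if_pos hi
  refine hne (quotient_map_eq_zero_of_coefficients h.walk h.band c hf
    (fun i => if i < p then b i else 0) 1 (fun i => ?_) (fun i hi => ?_) ?_ ?_)
  · split_ifs with hi
    · exact hb.compat i (by omega)
    · exact .zero
  · rcases lt_or_gt_of_ne hi with hi | hi
    · exact (hb.comm i (by omega)).congr (h1 i hi) (h1 _ (by omega))
    · exact .of_zero (h0 i hi.le) (h0 _ (by omega))
  · rw [h.bwd_σ, h.bwd_unroll_self, zero_mul, mul_zero]
  · rw [h0 p le_rfl, h1 _ (by omega), hb.one, zero_mul, sub_zero, mul_one,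
      Word.fwd_of_direct k hs (h.direct hs), h.path_σ hs, hR, List.append_nil, Units.val_one,
      one_smul]

/-- Continued by zero to the right of $p$, the map has its only defect at the letter $p$, now from
the side of the band: it is $-\overline{\tau_R}=-f$, which accounts for the sign $-1$. -/
theorem not_rightTail_reverse (c : ZMod n → kˣ) (hf : IsSingleMap rel σ τ p q f)
    (hne : (HomotopyCategory.quotient (ModuleCat.{max u v w} (Alg k rel))
      (ComplexShape.up ℤ)).map (wordSingleMap k rel (fun _ => 1) (fun i => (c i : k)) h.walk
        h.band.toIsWalk hf) ≠ 0) (hL : fL = []) :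
    ¬ ∃ b, RightTail k rel (-1) σ.reverse (unroll τ p q).reverse (-p) b := by
  rintro ⟨b, hb⟩
  have h0 : ∀ i < p, (if p ≤ i then b (-i) else 0) = 0 := fun i hi => if_neg (by omega)
  have h1 : ∀ i, p ≤ i → (if p ≤ i then b (-i) else 0) = b (-i) := fun i hi => if_pos hi
  refine hne (quotient_map_eq_zero_of_coefficients h.walk h.band c hf
    (fun i => if p ≤ i then b (-i) else 0) (-1) (fun i => ?_) (fun i hi => ?_) ?_ ?_)
  · split_ifs with hi
    · exact (hb.compat (-i) (by omega)).of_reverse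
    · exact .zero
  · rcases lt_or_gt_of_ne hi with hi | hi
    · exact .of_zero (h0 i hi) (h0 _ (by omega))
    · exact (CommAt.of_reverse (hb.comm (1 - i) (by omega))).congr (h1 i hi.le) (h1 _ (by omega))
  · rw [h.bwd_σ, h.bwd_unroll_self, zero_mul, mul_zero]
  · rw [h1 p le_rfl, h0 _ (by omega), hb.one, mul_zero, one_mul, zero_sub,
      Word.fwd_of_direct k (unroll_hasLetter p) (by rw [h.unroll_letter]), h.unroll_letter, hL,
      List.nil_append, Units.val_neg, Units.val_one, neg_one_smul]

end Glueable

/-- A letter to the left of `p` that cancels with a part of `f` makes the single map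
null-homotopic. -/
theorem quotient_map_eq_zero_of_prefix (hg : IsGentle rel) (hσ : σ.IsWalk rel)
    (hτ : τ.IsHomotopyBand rel) (c : ZMod n → k) (hf : IsSingleMap rel σ τ p q f)
    (hl : σ.HasLetter (p + 1)) (hd : (σ.letter (p + 1)).direct = false)
    (hq : (τ.letter q).direct = false) (hqf : f <:+ (τ.letter q).path) {x : List (Arr V)}
    (hx : x ≠ []) (hfx : f = (σ.letter (p + 1)).path ++ x) :
    (HomotopyCategory.quotient (ModuleCat.{max u v w} (Alg k rel)) (ComplexShape.up ℤ)).map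
      (wordSingleMap k rel (fun _ => 1) c hσ hτ.toIsWalk hf) = 0 := by
  have hpath := hf.isPath
  rw [hfx] at hpath
  obtain ⟨z, hz⟩ := hpath.of_append_right hx
  have hg' := (hσ.joins _ hl).of_inverse hd
  have hdeg := hσ.deg_eq _ hl
  rw [add_sub_cancel_right, if_neg (by simp [hd])] at hdeg
  -- With $f=\overline{\sigma_L}\,x$, the homotopy is the single component $x$ from the node $p+1$
  -- to $q$; composing it with the differential along $\sigma_L$ gives $f$.
  refine quotient_map_wordSingleMap_eq_zero (singleTotal k rel (p + 1) q x) ?_ ?_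
  · intro m m' hm g hg
    refine linearCombination_mem_term (fun i hi hi' y hy => ?_) hg
    split_ifs with hip
    · refine smul_single_mem_term hi hi' hy fun _ _ => ⟨hf.mem_right, fun _ => ?_, fun g _ =>
        smul_mem_P k rel (eval_mem_P k rel hz) g⟩
      rw [← hf.deg_eq, hdeg, ← hip, hi']
      omega
    · rw [smul_zero]
      exact Submodule.zero_mem _
  · intro i
    -- Nothing leaves $q$ along the inverse letter $\tau_R$. If $\tau_L$ is inverse, it meets the
    -- last arrow in the list of $\tau_R$ in a relation, and $x$ ends with the same arrow.
    have hτ0 : eval k rel x • row k rel c τ q = 0 := by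
      rw [row_eq, Word.fwd_of_inverse k hq, smul_zero, Finsupp.single_zero, zero_add,
        Finsupp.smul_single, smul_eq_mul, mul_smul_comm]
      cases hq' : (τ.letter (q + 1)).direct
      · have ha := hτ.adj q (hτ.hasLetter _) (hτ.hasLetter _)
        rw [Letter.Adj, hq', hq] at ha
        obtain ⟨y, hy⟩ := hqf
        simp only [← hy, hfx, ← List.append_assoc, List.getLast?_append_of_ne_nil _ hx] at ha
        rw [Word.bwd_of_inverse k (hτ.hasLetter _) hq', eval_mul_eval_eq_zero k ha, smul_zero,
          Finsupp.single_zero]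
      · rw [Word.bwd_of_direct k hq', mul_zero, smul_zero, Finsupp.single_zero]
    rw [row_one, map_add, singleTotal_single, singleTotal_single, singleTotal_single,
      singleTotal_single, one_mul, one_mul]
    -- A direct letter to the left of $\sigma_L$ does not cancel with it, so gentleness puts its
    -- product with $x$ into $I$.
    have h1 : (if i - 1 = p + 1 then
        Finsupp.single q (σ.fwd k rel i * eval k rel x) else 0) = 0 := by
      split_ifs with hi
      · obtain rfl : i = p + 1 + 1 := by omega
        by_cases hd' : σ.HasLetter (p + 1 + 1) ∧ (σ.letter (p + 1 + 1)).direct = true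
        · have ha := hσ.adj _ hd'.1 hl
          rw [Letter.Adj, hd'.2, hd] at ha
          have hj := (hσ.joins _ hd'.1).of_direct hd'.2
          rw [add_sub_cancel_right] at hj
          rw [Word.fwd_of_direct k hd'.1 hd'.2, eval_mul_eval_eq_zero k
            (hg.rel_of_getLast_ne hpath hg' hx hj ha.symm), Finsupp.single_zero]
        · rw [Word.fwd, if_neg hd', zero_mul, Finsupp.single_zero]
      · rfl
    have h2 : diff k rel c τ (if i = p + 1 then Finsupp.single q (eval k rel x) else 0) = 0 := by
      split_ifs with hi
      · rw [diff_single, hτ0]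
      · exact map_zero _
    rw [h1, h2, zero_add, add_zero]
    rcases eq_or_ne i p with rfl | hi
    · rw [if_pos rfl, if_pos rfl, Word.bwd_of_inverse k hl hd, ← eval_append, ← hfx]
    · rw [if_neg hi, if_neg (by omega)]

/-- What has to be proved is the adjacency of $\sigma_L$ with $f$. For direct $\sigma_L$ it is the
vanishing of $\sigma_Lf$; for inverse $\sigma_L$ a cancellation has to be excluded. -/
theorem exists_glueable (hg : IsGentle rel) (hσ : σ.IsWalk rel)
    (hτ : τ.IsHomotopyBand rel) (c : ZMod n → k) (hf : IsSingleMap rel σ τ p q f)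
    (hcompat : CompatiblyOriented σ τ p q f)
    (hne : (HomotopyCategory.quotient (ModuleCat.{max u v w} (Alg k rel))
      (ComplexShape.up ℤ)).map (wordSingleMap k rel (fun _ => 1) c hσ hτ.toIsWalk hf) ≠ 0) :
    ∃ fL fR, Glueable rel σ τ p q f fL fR := by
  obtain ⟨hq, fL, hL⟩ := hcompat.right_τ (hτ.hasLetter q)
  obtain ⟨fR, hR⟩ : ∃ fR, σ.HasLetter p → (σ.letter p).path = f ++ fR := by
    by_cases hs : σ.HasLetter p
    · obtain ⟨fR, h⟩ := (hcompat.right_σ hs).2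
      exact ⟨fR, fun _ => h.symm⟩
    · exact ⟨[], fun h => absurd h hs⟩
  refine ⟨fL, fR, hσ, hτ, hf.mem_left, hf.deg_eq, hf.isPath, hq, hL.symm,
    fun hs => (hcompat.right_σ hs).1, hR, fun hl => ?_⟩
  have hj := hσ.joins _ hl
  cases hd : (σ.letter (p + 1)).direct
  · have hj := hj.of_inverse hd
    rw [Letter.Adj, hd]
    intro heq
    change (σ.letter (p + 1)).path.head? = f.head? at heq
    -- If $\sigma_R$ exists, it begins like $f$, and $\sigma_L$ would cancel with it. If it is
    -- empty, $f$ and $\overline{\sigma_L}$ would be comparable: $f$ as an initial part contradicts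
    -- the orientation, and a proper initial part of $f$ makes $f^\bullet$ null-homotopic.
    by_cases hs : σ.HasLetter p
    · have ha := hσ.adj _ hl hs
      rw [Letter.Adj, hd, (hcompat.right_σ hs).1] at ha
      refine ha (heq.trans ?_)
      rw [hR hs, List.head?_append_of_ne_nil _ hf.isPath.ne_nil]
    · rcases prefix_or_prefix_of_head? hg.pre_free hj.chain hf.isPath.chain heq with ⟨x, hx⟩ | hx
      · refine hne (quotient_map_eq_zero_of_prefix hg hσ hτ c hf hl hd hq ⟨fL, hL⟩
          (x := x) ?_ hx.symm)
        rintro rfl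
        rw [List.append_nil] at hx
        exact hcompat.left_σ hl hd (hx ▸ List.prefix_rfl)
      · exact hcompat.left_σ hl hd hx
  · have hj := hj.of_direct hd
    rw [Letter.Adj, hd]
    exact rel_of_hasRel_append hj hf.isPath (hf.l1 hl hd)

end Fold

/-! ### The isomorphism between the string complex and the mapping cone -/

/-! ### Inverting $1+N$ for nilpotent $N$ -/

section Nilpotent

variable {R M : Type*} [Ring R] [AddCommGroup M] [Module R M]

/-- The geometric series for $(1+N)^{-1}$, as an induction: if $g$ solves the equation for $Nz$,
then $z-g$ solves it for $z$. The solution stays in `S`, so the argument applies to a single term of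
the complex. -/
theorem exists_add_eq_of_pow_eq_zero (N : Module.End R M) (S : Submodule R M)
    (hS : ∀ z ∈ S, N z ∈ S) (K : ℕ) :
    ∀ z ∈ S, (N ^ K) z = 0 → ∃ g ∈ S, g + N g = z := by
  induction K with
  | zero => exact fun z _ h => ⟨0, S.zero_mem, by simpa using h.symm⟩
  | succ K ih =>
    intro z hz h
    obtain ⟨g, hg, hgz⟩ := ih (N z) (hS z hz) (by rwa [pow_succ, Module.End.mul_apply] at h)
    refine ⟨z - g, S.sub_mem hz hg, ?_⟩
    rw [map_sub, ← hgz]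
    abel

theorem eq_zero_of_pow_eq_zero (N : Module.End R M) {g : M} (h : g + N g = 0) :
    ∀ K : ℕ, (N ^ K) g = 0 → g = 0
  | 0, hK => by simpa using hK
  | K + 1, hK => by
    refine eq_zero_of_pow_eq_zero N h K ?_
    rw [pow_succ, Module.End.mul_apply, eq_neg_of_add_eq_zero_right h, map_neg, neg_eq_zero] at hK
    exact hK

theorem pow_eq_zero_of_rank {ι : Type*} (N : Module.End R (ι →₀ R)) (ρ : ι → ℕ) (B : ℕ)
    (hρ : ∀ i, ρ i ≤ B)
    (h : ∀ i x, N (Finsupp.single i x) = 0 ∨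
      ∃ j y, N (Finsupp.single i x) = Finsupp.single j y ∧ ρ j < ρ i) : N ^ (B + 1) = 0 := by
  have key : ∀ (b : ℕ) i x, ρ i ≤ b → (N ^ (b + 1)) (Finsupp.single i x) = 0 := by
    intro b
    induction b with
    | zero =>
      intro i x hi
      rcases h i x with h0 | ⟨j, y, -, hj⟩
      · simpa using h0
      · omega
    | succ b ih =>
      intro i x hi
      rw [pow_succ, Module.End.mul_apply]
      rcases h i x with h0 | ⟨j, y, h1, hj⟩
      · rw [h0, map_zero]
      · rw [h1, ih j y (by omega)]
  exact Finsupp.lhom_ext fun i x => key B i x (hρ i)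

end Nilpotent

/-! ### The components of the comparison map -/

section Assembly

variable {k : Type u} [Field k] {V : Type v} [Fintype V] [Quiver.{w} V]
  {rel : Arr V → Arr V → Prop}

theorem smul_single_smul_mem_term {κ : Type} [CommRing κ] {v : Word V κ} {n : ℤ} {j : κ}
    {x y : Alg k rel} (s : k)
    (h : y ≠ 0 → j ∈ v.node ∧ v.deg j = n ∧ x * y ∈ P k rel (v.vtx j)) :
    x • Finsupp.single j (s • y) ∈ term k rel v n := by
  rw [Finsupp.smul_single, smul_eq_mul, mul_smul_comm]
  by_cases hy : y = 0
  · rw [hy, mul_zero, smul_zero, Finsupp.single_zero]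
    exact Submodule.zero_mem _
  · obtain ⟨h1, h2, h3⟩ := h hy
    exact single_mem_term k rel (ksmul_mem_P k rel h3 s) h1 h2

/-- The linear map with the components `x (i + m)` from `i` to `i + m`. -/
noncomputable def diagMap (m : ℤ) (x : ℤ → Alg k rel) :
    (ℤ →₀ Alg k rel) →ₗ[Alg k rel] (ℤ →₀ Alg k rel) :=
  Finsupp.linearCombination (Alg k rel) fun i => Finsupp.single (i + m) (x (i + m))

theorem diagMap_single (m : ℤ) (x : ℤ → Alg k rel) (i : ℤ) (y : Alg k rel) :
    diagMap m x (Finsupp.single i y) = Finsupp.single (i + m) (y * x (i + m)) := by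
  rw [diagMap, Finsupp.linearCombination_single, Finsupp.smul_single, smul_eq_mul]

theorem diff_diagMap {u v : Word V ℤ} {m : ℤ} {b : ℤ → Alg k rel} {s : ℤ → k}
    (hs : ∀ i, s (i - 1) = -s i) (h : ∀ i, CommAt k rel (u.shift m) v b i) (i : ℤ) :
    diff k rel (fun _ => 1) v (diagMap m (fun i => s i • b i) (Finsupp.single i 1)) +
      diagMap m (fun i => s i • b i) (row k rel (fun _ => 1) u i) = 0 := by
  have h1 := (h (i + m)).fwd
  have h2 := (h (i + m + 1)).bwd
  rw [Word.fwd_shift, add_sub_cancel_right] at h1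
  rw [Word.bwd_shift, show i + m + 1 - m = i + 1 by ring, add_sub_cancel_right] at h2
  have hs2 := hs (i + m + 1)
  rw [add_sub_cancel_right] at hs2
  rw [row_one, map_add, diagMap_single, diagMap_single, diagMap_single, diff_single, row_one,
    one_mul, smul_add, Finsupp.smul_single, Finsupp.smul_single, smul_eq_mul, smul_eq_mul,
    show i - 1 + m = i + m - 1 by ring, show i + 1 + m = i + m + 1 by ring, mul_smul_comm,
    mul_smul_comm, h1, h2, smul_mul_assoc, smul_mul_assoc, hs, hs2]
  simp only [neg_smul, Finsupp.single_neg]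
  abel

theorem diagMap_mem_term {u v : Word V ℤ} {m : ℤ} {b : ℤ → Alg k rel} {s : ℤ → k}
    (h : ∀ i, CompatAt k rel 1 (u.shift m) v (b i) i) (d : ℤ) {g : ℤ →₀ Alg k rel}
    (hg : g ∈ term k rel u d) : diagMap m (fun i => s i • b i) g ∈ term k rel v (d + 1) := by
  refine linearCombination_mem_term (fun i hi hd x hx => smul_single_smul_mem_term _ fun hb => ?_)
    hg
  have := h (i + m)
  simp only [CompatAt, Word.shift, Set.mem_ofPred_eq, add_sub_cancel_right, hd] at this
  obtain ⟨h1, h2, h3⟩ := this hi hb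
  exact ⟨h1, h2, h3 x hx⟩

namespace Glueable

variable {n : ℕ} {σ : Word V ℤ} {τ : Word V (ZMod n)} {p : ℤ} {q : ZMod n} {f : List (Arr V)}
  {fL fR : List (Arr V)}

/-- The projection from the word of the cone to the band. -/
noncomputable def toBand (p : ℤ) (q : ZMod n) (t : ℤ → kˣ) :
    (ℤ →₀ Alg k rel) →ₗ[Alg k rel] (ZMod n →₀ Alg k rel) :=
  Finsupp.linearCombination (Alg k rel) fun i =>
    if p - n ≤ i ∧ i < p then Finsupp.single (q + (p - 1 - i : ℤ)) ((t i : k) • 1) else 0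

theorem toBand_single_of_mem {t : ℤ → kˣ} {i : ℤ} (h : p - n ≤ i ∧ i < p) (x : Alg k rel) :
    toBand p q t (Finsupp.single i x) =
      Finsupp.single (q + (p - 1 - i : ℤ)) ((t i : k) • x) := by
  rw [toBand, Finsupp.linearCombination_single, if_pos h, Finsupp.smul_single, smul_eq_mul,
    mul_smul_comm, mul_one]

theorem toBand_single_of_not {t : ℤ → kˣ} {i : ℤ} (h : ¬ (p - n ≤ i ∧ i < p)) (x : Alg k rel) :
    toBand p q t (Finsupp.single i x) = 0 := by
  rw [toBand, Finsupp.linearCombination_single, if_neg h, smul_zero]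

theorem add_cast_mem (i : ℤ) :
    q + ((p - 1 - (p - n - i) : ℤ) : ZMod n) = q + ((i - 1 : ℤ) : ZMod n) := by
  push_cast
  simp

variable (h : Glueable rel σ τ p q f fL fR)

include h

theorem toBand_mem_term (t : ℤ → kˣ) (m : ℤ) {g : ℤ →₀ Alg k rel}
    (hg : g ∈ term k rel (coneWord σ τ p q f) m) : toBand p q t g ∈ term k rel τ m := by
  refine linearCombination_mem_term (fun i hi hd x hx => ?_) hg
  split_ifs with hm
  · refine smul_single_smul_mem_term _ fun _ => ⟨by rw [h.band.node_eq]; trivial, ?_, ?_⟩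
    · rw [coneWord_deg_of_mem hm.1 hm.2] at hd
      exact hd
    · rw [coneWord_vtx_of_mem hm.1 hm.2] at hx
      rwa [mul_one]
  · rw [smul_zero]
    exact Submodule.zero_mem _

/-- At $p$ the map $f$ is matched by the first letter $f$ of the glued part, which requires `hte`.
Inside the turn the projection is a chain map. At $p-n$ the band differential has a component $f_Lf$
back to the node $q$, while the cone word leaves the turn there; this component is cancelled by $b_p
f=f_Lf$, and that determines `ν`. -/
theorem diff_toBand {c : ZMod n → kˣ} {t e : ℤ → kˣ} {ν : kˣ} (ht : IsFolding c τ p q t)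
    (hte : t (p - 1) = e p) (hν : ν = -(t (p - n) * c q * (e p)⁻¹)) {a b : ℤ → Alg k rel}
    (ha : a p = 1) (hb : b p = eval k rel fL) (i : ℤ) :
    diff k rel (fun i => (c i : k)) τ (toBand p q t (Finsupp.single i 1)) +
      singleTotal k rel p q f ((diagMap 0 (fun i => (e i : k) • a i) +
        diagMap n (fun i => ((ν * e i : kˣ) : k) • b i)) (Finsupp.single i 1)) =
    toBand p q t (row k rel (fun _ => 1) (coneWord σ τ p q f) i) := by
  have hn := h.band.two_le
  rw [LinearMap.add_apply, map_add, diagMap_single, diagMap_single, add_zero, one_mul, one_mul,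
    singleTotal_single, singleTotal_single, row_one, map_add]
  have hidx : q + ((p - 1 - (p - 1) : ℤ) : ZMod n) = q := by simp
  rcases lt_trichotomy p i with hi | rfl | hi
  · rw [if_neg (by omega), if_neg (by omega), toBand_single_of_not (by omega),
      toBand_single_of_not (by omega), toBand_single_of_not (by omega), map_zero, add_zero,
      add_zero]
  · rw [if_pos rfl, if_neg (by omega), toBand_single_of_not (by omega),
      toBand_single_of_mem (by omega), toBand_single_of_not (by omega), map_zero, ha, h.fwd_self,
      hte, hidx, smul_mul_assoc, one_mul, zero_add]
  have hfb : ∀ j, p - n < j → j < p → (coneWord σ τ p q f).AgreeAt (unroll τ p q) j :=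
    fun j h1 h2 => ⟨coneWord_hasLetter_of_mem h1 h2, unroll_hasLetter j,
      coneWord_letter_of_mem h1 h2⟩
  have hbwd : ∀ j, p - n ≤ j → j < p → toBand p q t
      (Finsupp.single (j + 1) ((coneWord σ τ p q f).bwd k rel (j + 1))) =
      Finsupp.single (q + (p - 1 - (j + 1) : ℤ))
        ((t (j + 1) : k) • (unroll τ p q).bwd k rel (j + 1)) := fun j h1 h2 => by
    rcases eq_or_lt_of_le (show j + 1 ≤ p by omega) with h3 | h3
    · rw [h3, h.bwd_self, h.bwd_unroll_self, smul_zero, Finsupp.single_zero, Finsupp.single_zero,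
        map_zero]
    · rw [toBand_single_of_mem ⟨by omega, h3⟩, (hfb _ (by omega) h3).bwd]
  rcases lt_trichotomy (p - n) i with hi' | rfl | hi'
  · rw [if_neg (by omega), if_neg (by omega), toBand_single_of_mem ⟨hi'.le, hi⟩,
      diff_single_unroll h.band ht, hbwd i hi'.le hi, toBand_single_of_mem (by omega),
      (hfb i hi' hi).fwd, one_mul, one_mul, add_zero, add_zero, add_comm]
  · rw [if_neg (by omega), if_pos (by omega), toBand_single_of_mem ⟨le_rfl, hi⟩,
      diff_single_unroll h.band ht, hbwd _ le_rfl hi, toBand_single_of_not (by omega), one_mul,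
      one_mul, zero_add, zero_add, sub_add_cancel, hb, add_cast_mem]
    have hl : (unroll τ p q).letter (p - n) = ⟨true, fL ++ f⟩ := by
      rw [unroll_letter_sub, h.unroll_letter]
    have ht' := ht.fwd (p - n) (by rw [hl])
    rw [show q + ((p - (p - n) : ℤ) : ZMod n) = q by simp] at ht'
    rw [Word.fwd_of_direct k (unroll_hasLetter _) (by rw [hl]), hl, ht', eval_append, hν,
      smul_mul_assoc, sub_self, Int.cast_zero, add_zero, add_assoc, ← Finsupp.single_add,
      ← add_smul]
    have he := (e p).ne_zero
    rw [show ((c q * t (p - n) : kˣ) : k) +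
      ((-(t (p - n) * c q * (e p)⁻¹) * e p : kˣ) : k) = 0 by
        push_cast; field_simp; ring, zero_smul, Finsupp.single_zero, add_zero]
  · rw [if_neg (by omega), if_neg (by omega), toBand_single_of_not (by omega),
      toBand_single_of_not (i := i - 1) (by omega), map_zero, add_zero, add_zero, zero_add]
    rcases eq_or_lt_of_le (show i + 1 ≤ p - n by omega) with h3 | h3
    · rw [h3, h.bwd_sub, Finsupp.single_zero, map_zero]
    · rw [toBand_single_of_not (by omega)]

end Glueable

end Assembly

/-! ### Bijectivity of the comparison map -/

section Inverse

variable {k : Type u} [Field k] {V : Type v} [Fintype V] [Quiver.{w} V]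
  {rel : Arr V → Arr V → Prop} {n : ℕ} {σ : Word V ℤ} {τ : Word V (ZMod n)} {p : ℤ} {q : ZMod n}
  {f fL fR : List (Arr V)}

/-- The inclusion of the string into the word of the cone, with scalars. -/
noncomputable def ofString (n : ℕ) (p : ℤ) (e : ℤ → kˣ) (ν : kˣ) :
    (ℤ →₀ Alg k rel) →ₗ[Alg k rel] (ℤ →₀ Alg k rel) :=
  Finsupp.linearCombination (Alg k rel) fun i =>
    if p ≤ i then Finsupp.single i (((e i)⁻¹ : kˣ) • 1)
    else Finsupp.single (i - n) (((ν * e i)⁻¹ : kˣ) • 1)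

/-- The projection from the word of the cone to the string, with scalars. -/
noncomputable def stringPart (n : ℕ) (p : ℤ) (e : ℤ → kˣ) (ν : kˣ) :
    (ℤ →₀ Alg k rel) →ₗ[Alg k rel] (ℤ →₀ Alg k rel) :=
  Finsupp.linearCombination (Alg k rel) fun i =>
    if p ≤ i then Finsupp.single i (e i • 1)
    else if i < p - n then Finsupp.single (i + n) ((ν * e (i + n)) • 1) else 0

/-- The inclusion of the band into the word of the cone, with scalars. -/
noncomputable def ofBand (p : ℤ) (q : ZMod n) (t : ℤ → kˣ) :
    (ZMod n →₀ Alg k rel) →ₗ[Alg k rel] (ℤ →₀ Alg k rel) :=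
  Finsupp.linearCombination (Alg k rel) fun j =>
    Finsupp.single (p - 1 - (j - q).val) ((t (p - 1 - (j - q).val))⁻¹ • 1)

/-- The part of the comparison map that moves the right part of the string to the right. -/
noncomputable def moveRight (n : ℕ) (p : ℤ) (ν : kˣ) (a : ℤ → Alg k rel) :
    Module.End (Alg k rel) (ℤ →₀ Alg k rel) :=
  Finsupp.linearCombination (Alg k rel) fun i =>
    if i < p then Finsupp.single (i - n) (ν⁻¹ • a i) else 0

/-- The part of the comparison map that moves the left part of the string to the left. -/
noncomputable def moveLeft (n : ℕ) (p : ℤ) (ν : kˣ) (b : ℤ → Alg k rel) :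
    Module.End (Alg k rel) (ℤ →₀ Alg k rel) :=
  Finsupp.linearCombination (Alg k rel) fun i =>
    if p - n ≤ i then Finsupp.single (i + n) (ν • b (i + n)) else 0

theorem units_smul_single (x y : Alg k rel) {ι : Type} (i : ι) (s : kˣ) :
    x • Finsupp.single i (s • y) = Finsupp.single i (s • (x * y)) := by
  rw [Finsupp.smul_single, smul_eq_mul, mul_smul_comm]

theorem ofString_single_of_le {e : ℤ → kˣ} {ν : kˣ} {i : ℤ} (hi : p ≤ i) (x : Alg k rel) :
    ofString n p e ν (Finsupp.single i x) = Finsupp.single i ((e i)⁻¹ • x) := by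
  rw [ofString, Finsupp.linearCombination_single, if_pos hi, units_smul_single, mul_one]

theorem ofString_single_of_lt {e : ℤ → kˣ} {ν : kˣ} {i : ℤ} (hi : i < p) (x : Alg k rel) :
    ofString n p e ν (Finsupp.single i x) = Finsupp.single (i - n) ((ν * e i)⁻¹ • x) := by
  rw [ofString, Finsupp.linearCombination_single, if_neg (by omega), units_smul_single, mul_one]

theorem stringPart_single_of_le {e : ℤ → kˣ} {ν : kˣ} {i : ℤ} (hi : p ≤ i) (x : Alg k rel) :
    stringPart n p e ν (Finsupp.single i x) = Finsupp.single i (e i • x) := by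
  rw [stringPart, Finsupp.linearCombination_single, if_pos hi, units_smul_single, mul_one]

theorem stringPart_single_of_lt {e : ℤ → kˣ} {ν : kˣ} {i : ℤ} (hi : i < p - n) (x : Alg k rel) :
    stringPart n p e ν (Finsupp.single i x) = Finsupp.single (i + n) ((ν * e (i + n)) • x) := by
  rw [stringPart, Finsupp.linearCombination_single, if_neg (by omega), if_pos hi,
    units_smul_single, mul_one]

theorem stringPart_single_of_mem {e : ℤ → kˣ} {ν : kˣ} {i : ℤ} (hi : p - n ≤ i) (hi' : i < p)
    (x : Alg k rel) : stringPart n p e ν (Finsupp.single i x) = 0 := by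
  rw [stringPart, Finsupp.linearCombination_single, if_neg (by omega), if_neg (by omega), smul_zero]

theorem ofBand_single {t : ℤ → kˣ} (j : ZMod n) (x : Alg k rel) :
    ofBand p q t (Finsupp.single j x) =
      Finsupp.single (p - 1 - ((j - q).val : ℤ)) ((t (p - 1 - (j - q).val))⁻¹ • x) := by
  rw [ofBand, Finsupp.linearCombination_single, units_smul_single, mul_one]

theorem moveRight_single_of_lt {ν : kˣ} {a : ℤ → Alg k rel} {i : ℤ} (hi : i < p) (x : Alg k rel) :
    moveRight n p ν a (Finsupp.single i x) = Finsupp.single (i - n) (ν⁻¹ • (x * a i)) := by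
  rw [moveRight, Finsupp.linearCombination_single, if_pos hi, units_smul_single]

theorem moveRight_single_of_le {ν : kˣ} {a : ℤ → Alg k rel} {i : ℤ} (hi : p ≤ i) (x : Alg k rel) :
    moveRight n p ν a (Finsupp.single i x) = 0 := by
  rw [moveRight, Finsupp.linearCombination_single, if_neg (by omega), smul_zero]

theorem moveLeft_single_of_le {ν : kˣ} {b : ℤ → Alg k rel} {i : ℤ} (hi : p - n ≤ i)
    (x : Alg k rel) :
    moveLeft n p ν b (Finsupp.single i x) = Finsupp.single (i + n) (ν • (x * b (i + n))) := by
  rw [moveLeft, Finsupp.linearCombination_single, if_pos hi, units_smul_single]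

theorem moveLeft_single_of_lt {ν : kˣ} {b : ℤ → Alg k rel} {i : ℤ} (hi : i < p - n)
    (x : Alg k rel) : moveLeft n p ν b (Finsupp.single i x) = 0 := by
  rw [moveLeft, Finsupp.linearCombination_single, if_neg (by omega), smul_zero]

/-- Each application lowers the index by $n>0$, and the coefficients vanish below $K$. The rank
counts the remaining indices down to $K$ inclusively, so that it can still drop at $K$. -/
theorem moveRight_pow_eq_zero (hn : 0 < n) (ν : kˣ) {a : ℤ → Alg k rel} {K : ℤ}
    (ha : ∀ i < K, a i = 0) : ∃ B, moveRight n p ν a ^ B = 0 := by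
  refine ⟨_, pow_eq_zero_of_rank _ (fun i => if i < p then (i - K + 1).toNat else 0)
    (p - K + 1).toNat (fun i => ?_) (fun i x => ?_)⟩
  · split_ifs <;> omega
  · by_cases hi : i < p; swap
    · exact Or.inl (moveRight_single_of_le (by omega) x)
    · rw [moveRight_single_of_lt hi]
      by_cases hK : i < K
      · exact Or.inl (by rw [ha i hK, mul_zero, smul_zero, Finsupp.single_zero])
      · refine Or.inr ⟨_, _, rfl, ?_⟩
        rw [if_pos hi, if_pos (by omega)]
        omega

theorem moveLeft_pow_eq_zero (hn : 0 < n) (ν : kˣ) {b : ℤ → Alg k rel} {K : ℤ}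
    (hb : ∀ i > K, b i = 0) : ∃ B, moveLeft n p ν b ^ B = 0 := by
  refine ⟨_, pow_eq_zero_of_rank _ (fun i => if p - n ≤ i then (K - i).toNat else 0)
    (K - p + n).toNat (fun i => ?_) (fun i x => ?_)⟩
  · split_ifs <;> omega
  · by_cases hi : p - n ≤ i; swap
    · exact Or.inl (moveLeft_single_of_lt (by omega) x)
    · rw [moveLeft_single_of_le hi]
      by_cases hK : i + n > K
      · exact Or.inl (by rw [hb _ hK, mul_zero, smul_zero, Finsupp.single_zero])
      · refine Or.inr ⟨_, _, rfl, ?_⟩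
        rw [if_pos hi, if_pos (by omega)]
        omega

/-- The second factor lands in indices $\ge p$, which the first one kills. Hence $(1+R)(1+L)=1+R+L$,
and no mixed term has to be matched. -/
theorem moveRight_moveLeft (ν : kˣ) (a b : ℤ → Alg k rel) (g : ℤ →₀ Alg k rel) :
    moveRight n p ν a (moveLeft n p ν b g) = 0 := by
  have : (moveRight n p ν a).comp (moveLeft n p ν b) = 0 := by
    refine Finsupp.lhom_ext fun i x => ?_
    rw [LinearMap.comp_apply]
    by_cases hi : p - n ≤ i
    · rw [moveLeft_single_of_le hi, moveRight_single_of_le (by omega)]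
      rfl
    · rw [moveLeft_single_of_lt (by omega), map_zero]
      rfl
  exact LinearMap.congr_fun this g

theorem stringPart_ofString (e : ℤ → kˣ) (ν : kˣ) (g : ℤ →₀ Alg k rel) :
    stringPart n p e ν (ofString n p e ν g) = g := by
  have : (stringPart n p e ν).comp (ofString (rel := rel) n p e ν) =
      LinearMap.id := by
    refine Finsupp.lhom_ext fun i x => ?_
    rw [LinearMap.comp_apply]
    by_cases hi : p ≤ i
    · rw [ofString_single_of_le hi, stringPart_single_of_le hi, smul_inv_smul]
      rfl
    · rw [ofString_single_of_lt (by omega), stringPart_single_of_lt (by omega), sub_add_cancel,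
        smul_inv_smul]
      rfl
  exact LinearMap.congr_fun this g

theorem toBand_ofString (e t : ℤ → kˣ) (ν : kˣ) (q : ZMod n) (g : ℤ →₀ Alg k rel) :
    Glueable.toBand p q t (ofString n p e ν g) = 0 := by
  have : (Glueable.toBand p q t).comp (ofString (rel := rel) n p e ν) = 0 := by
    refine Finsupp.lhom_ext fun i x => ?_
    rw [LinearMap.comp_apply]
    by_cases hi : p ≤ i
    · rw [ofString_single_of_le hi, Glueable.toBand_single_of_not (by omega)]
      rfl
    · rw [ofString_single_of_lt (by omega), Glueable.toBand_single_of_not (by omega)]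
      rfl
  exact LinearMap.congr_fun this g

theorem stringPart_ofBand (hn : 0 < n) (e t : ℤ → kˣ) (ν : kˣ) (q : ZMod n)
    (g : ZMod n →₀ Alg k rel) : stringPart n p e ν (ofBand p q t g) = 0 := by
  have : NeZero n := ⟨hn.ne'⟩
  have : (stringPart n p e ν).comp (ofBand (rel := rel) p q t) = 0 := by
    refine Finsupp.lhom_ext fun j x => ?_
    have := ZMod.val_lt (j - q)
    rw [LinearMap.comp_apply, ofBand_single, stringPart_single_of_mem (by omega) (by omega)]
    rfl
  exact LinearMap.congr_fun this g

theorem toBand_ofBand (hn : 0 < n) (t : ℤ → kˣ) (q : ZMod n) (g : ZMod n →₀ Alg k rel) :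
    Glueable.toBand p q t (ofBand p q t g) = g := by
  have : NeZero n := ⟨hn.ne'⟩
  have : (Glueable.toBand p q t).comp (ofBand (rel := rel) p q t) =
      LinearMap.id := by
    refine Finsupp.lhom_ext fun j x => ?_
    have := ZMod.val_lt (j - q)
    rw [LinearMap.comp_apply, ofBand_single, Glueable.toBand_single_of_mem (by omega),
      ← Units.smul_def, smul_inv_smul, sub_sub_cancel, Int.cast_natCast, ZMod.natCast_zmod_val,
      add_sub_cancel]
    rfl
  exact LinearMap.congr_fun this g

/-- The comparison map is the product of the two unipotent maps, up to a diagonal map. -/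
theorem ofString_add_ofBand (hn : 0 < n) (e t : ℤ → kˣ) (ν : kˣ) (q : ZMod n)
    {a b : ℤ → Alg k rel} (ha : ∀ i, p ≤ i → a i = 1) (hb : ∀ i < p, b i = 1)
    (g : ℤ →₀ Alg k rel) :
    ofString n p e ν ((diagMap 0 (fun i => (e i : k) • a i) +
        diagMap n (fun i => ((ν * e i : kˣ) : k) • b i)) g) +
      ofBand p q t (Glueable.toBand p q t g) =
    (g + moveLeft n p ν b g) + moveRight n p ν a (g + moveLeft n p ν b g) := by
  have : NeZero n := ⟨hn.ne'⟩
  rw [map_add (moveRight n p ν a), moveRight_moveLeft, add_zero]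
  have : (ofString n p e ν).comp (diagMap 0 (fun i => (e i : k) • a i) +
        diagMap n (fun i => ((ν * e i : kˣ) : k) • b i)) +
      (ofBand p q t).comp (Glueable.toBand p q t) =
      LinearMap.id + moveLeft n p ν b + moveRight n p ν a := by
    refine Finsupp.lhom_ext fun i x => ?_
    simp only [LinearMap.add_apply, LinearMap.comp_apply, map_add, diagMap_single, add_zero,
      LinearMap.id_apply, ← Units.smul_def, mul_smul_comm]
    rcases lt_or_ge i p with hi | hi
    · rw [ofString_single_of_lt hi, moveRight_single_of_lt hi, smul_smul,
        show (ν * e i)⁻¹ * e i = ν⁻¹ by rw [mul_inv, inv_mul_cancel_right]]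
      rcases lt_or_ge i (p - n) with hi' | hi'
      · rw [ofString_single_of_lt (by omega), moveLeft_single_of_lt hi',
          Glueable.toBand_single_of_not (by omega), hb _ (by omega), map_zero, inv_smul_smul,
          add_sub_cancel_right, mul_one, add_zero, add_zero, add_comm]
      · have hv : (((p - 1 - i : ℤ) : ZMod n).val : ℤ) = p - 1 - i := by
          rw [ZMod.val_intCast, Int.emod_eq_of_lt (by omega) (by omega)]
        rw [ofString_single_of_le (by omega), moveLeft_single_of_le hi',
          Glueable.toBand_single_of_mem ⟨hi', hi⟩, ofBand_single, add_sub_cancel_left, hv,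
          sub_sub_cancel, ← Units.smul_def, inv_smul_smul, smul_smul,
          show (e (i + n))⁻¹ * (ν * e (i + n)) = ν by rw [mul_comm ν, inv_mul_cancel_left]]
        abel
    · rw [ofString_single_of_le hi, moveRight_single_of_le hi, ofString_single_of_le (by omega),
        moveLeft_single_of_le (by omega), Glueable.toBand_single_of_not (by omega), ha i hi,
        mul_one, inv_smul_smul, smul_smul, map_zero,
        show (e (i + n))⁻¹ * (ν * e (i + n)) = ν by rw [mul_comm ν, inv_mul_cancel_left]]
  exact LinearMap.congr_fun this g

namespace Glueable

variable (h : Glueable rel σ τ p q f fL fR)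

include h

theorem ofString_mem_term (e : ℤ → kˣ) (ν : kˣ) (m : ℤ) {g : ℤ →₀ Alg k rel}
    (hg : g ∈ term k rel σ (m + 1)) :
    ofString n p e ν g ∈ term k rel (coneWord σ τ p q f) m := by
  refine linearCombination_mem_term (fun i hi hd x hx => ?_) hg
  split_ifs with hm
  · refine smul_single_smul_mem_term (k := k) _ fun _ =>
      ⟨(coneWord_node_of_le hm).2 hi, ?_, ?_⟩
    · rw [coneWord_deg_of_le hm, hd, add_sub_cancel_right]
    · rwa [mul_one, coneWord_vtx_of_le hm]
  · refine smul_single_smul_mem_term (k := k) _ fun _ =>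
      ⟨(coneWord_node_of_lt (by omega)).2 (by rwa [sub_add_cancel]), ?_, ?_⟩
    · rw [coneWord_deg_of_lt (by omega), sub_add_cancel, hd, add_sub_cancel_right]
    · rwa [mul_one, coneWord_vtx_of_lt (by omega), sub_add_cancel]

theorem ofBand_mem_term (t : ℤ → kˣ) (m : ℤ) {g : ZMod n →₀ Alg k rel}
    (hg : g ∈ term k rel τ m) : ofBand p q t g ∈ term k rel (coneWord σ τ p q f) m := by
  have : NeZero n := ⟨h.band.pos.ne'⟩
  refine linearCombination_mem_term (fun j hj hd x hx => ?_) hg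
  have hv := ZMod.val_lt (j - q)
  have hidx : q + ((p - 1 - (p - 1 - ((j - q).val : ℤ)) : ℤ) : ZMod n) = j := by
    rw [sub_sub_cancel, Int.cast_natCast, ZMod.natCast_zmod_val, add_sub_cancel]
  refine smul_single_smul_mem_term (k := k) _ fun _ =>
    ⟨coneWord_node_of_mem (by omega) (by omega), ?_, ?_⟩
  · rw [coneWord_deg_of_mem (by omega) (by omega)]
    exact (congrArg τ.deg hidx).trans hd
  · rw [coneWord_vtx_of_mem (by omega) (by omega), mul_one]
    exact (congrArg τ.vtx hidx).symm ▸ hx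

theorem moveRight_mem_term (ν : kˣ) {a : ℤ → Alg k rel}
    (ha : ∀ i, CompatAt k rel 1 (coneWord σ τ p q f) σ (a i) i) (m : ℤ) {g : ℤ →₀ Alg k rel}
    (hg : g ∈ term k rel (coneWord σ τ p q f) m) :
    moveRight n p ν a g ∈ term k rel (coneWord σ τ p q f) m := by
  refine linearCombination_mem_term (fun i hi hd x hx => ?_) hg
  split_ifs with hm
  · refine smul_single_smul_mem_term (k := k) _ fun h0 => ?_
    obtain ⟨h1, h2, h3⟩ := ha i hi h0
    refine ⟨(coneWord_node_of_lt (by omega)).2 (by rwa [sub_add_cancel]), ?_, ?_⟩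
    · rw [coneWord_deg_of_lt (by omega), sub_add_cancel, h2, hd, add_sub_cancel_right]
    · rw [coneWord_vtx_of_lt (by omega), sub_add_cancel]
      exact h3 x hx
  · rw [smul_zero]
    exact Submodule.zero_mem _

theorem moveLeft_mem_term (ν : kˣ) {b : ℤ → Alg k rel}
    (hb : ∀ i, CompatAt k rel 1 ((coneWord σ τ p q f).shift n) σ (b i) i) (m : ℤ)
    {g : ℤ →₀ Alg k rel} (hg : g ∈ term k rel (coneWord σ τ p q f) m) :
    moveLeft n p ν b g ∈ term k rel (coneWord σ τ p q f) m := by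
  refine linearCombination_mem_term (fun i hi hd x hx => ?_) hg
  split_ifs with hm
  · refine smul_single_smul_mem_term (k := k) _ fun h0 => ?_
    have := hb (i + n)
    simp only [CompatAt, Word.shift, Set.mem_ofPred_eq, add_sub_cancel_right, hd] at this
    obtain ⟨h1, h2, h3⟩ := this hi h0
    refine ⟨(coneWord_node_of_le (by omega)).2 h1, ?_, ?_⟩
    · rw [coneWord_deg_of_le (by omega), h2, add_sub_cancel_right]
    · rw [coneWord_vtx_of_le (by omega)]
      exact h3 x hx
  · rw [smul_zero]
    exact Submodule.zero_mem _

theorem nonempty_iso (hg : IsGentle rel) (c : ZMod n → kˣ) (hf : IsSingleMap rel σ τ p q f)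
    (hne : (HomotopyCategory.quotient (ModuleCat.{max u v w} (Alg k rel))
      (ComplexShape.up ℤ)).map (wordSingleMap k rel (fun _ => 1) (fun i => (c i : k)) h.walk
        h.band.toIsWalk hf) ≠ 0) :
    Nonempty (CochainComplex.mappingCone (wordSingleMap k rel (fun _ => 1) (fun i => (c i : k))
        h.walk h.band.toIsWalk hf) ≅
      wordComplex k rel (fun _ => 1) (coneWord σ τ p q f) h.isWalk_coneWord) := by
  have hn := h.band.pos
  obtain ⟨a, K, ha1, ha2, ha3, ha4⟩ := h.exists_right (k := k) hg (h.not_rightTail c hf hne)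
  obtain ⟨b, L, hb0, hb1, hb2, hb3, hb4⟩ := h.exists_left (k := k) hg
    (h.not_rightTail_reverse c hf hne)
  obtain ⟨e, -, he⟩ := exists_int_recursion (fun _ => (-1 : kˣ)) 0 1
  -- The scalar at $p-1$ makes the square at the letter $f$ commute; `ν` then cancels the closing
  -- component of the band at $p-n$.
  obtain ⟨t, hte, ht⟩ := exists_isFolding c τ p q (p - 1) (e p)
  obtain ⟨ν, hν⟩ : ∃ ν : kˣ, ν = -(t (p - n) * c q * (e p)⁻¹) := ⟨_, rfl⟩
  have he1 : ∀ i, (e (i - 1) : k) = -(e i : k) := fun i => by rw [he i]; simp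
  have he2 : ∀ i, ((ν * e (i - 1) : kˣ) : k) = -((ν * e i : kˣ) : k) := fun i => by
    rw [he i]; simp
  have ha2' : ∀ i, CommAt k rel ((coneWord σ τ p q f).shift 0) σ a i := fun i =>
    ⟨by rw [Word.fwd_shift, sub_zero, (ha2 i).fwd], by rw [Word.bwd_shift, sub_zero, (ha2 i).bwd]⟩
  have ha3' : ∀ i, CompatAt k rel 1 ((coneWord σ τ p q f).shift 0) σ (a i) i := fun i => by
    simpa only [CompatAt, Word.shift, Set.mem_ofPred_eq, sub_zero] using ha3 i
  obtain ⟨A, hA⟩ := moveRight_pow_eq_zero (p := p) hn ν ha4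
  obtain ⟨B, hB⟩ := moveLeft_pow_eq_zero (p := p) hn ν hb4
  have hkey := ofString_add_ofBand (p := p) hn e t ν q ha1 hb1
  refine nonempty_iso_mappingCone (diagMap 0 (fun i => (e i : k) • a i) +
        diagMap n (fun i => ((ν * e i : kˣ) : k) • b i)) (toBand p q t)
    (fun m g hg => Submodule.add_mem _ (diagMap_mem_term ha3' m hg) (diagMap_mem_term hb3 m hg))
    (fun m g hg => h.toBand_mem_term t m hg) (fun i => ?_)
    (h.diff_toBand ht hte hν (ha1 p le_rfl) hb0) ?_ ?_
  · rw [LinearMap.add_apply, LinearMap.add_apply, map_add, add_add_add_comm,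
      diff_diagMap he1 ha2', diff_diagMap he2 hb2, add_zero]
  · intro m g _ h1 h2
    have h3 := hkey g
    rw [h1, h2, map_zero, map_zero, add_zero] at h3
    -- The factors are removed from the outside: first $1+R$, then $1+L$.
    have h4 := eq_zero_of_pow_eq_zero _ h3.symm A (by rw [hA]; rfl)
    exact eq_zero_of_pow_eq_zero _ h4 B (by rw [hB]; rfl)
  · intro m x hx y hy
    -- A preimage is obtained by applying $(1+L)^{-1}(1+R)^{-1}$ to the naive one.
    obtain ⟨g₁, hg₁, h1⟩ := exists_add_eq_of_pow_eq_zero (moveRight n p ν a)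
      (term k rel (coneWord σ τ p q f) m) (fun z hz => h.moveRight_mem_term ν ha3 m hz) A
      (ofString n p e ν x + ofBand p q t y)
      (Submodule.add_mem _ (h.ofString_mem_term e ν m hx) (h.ofBand_mem_term t m hy))
      (by rw [hA]; rfl)
    obtain ⟨g, hg, h2⟩ := exists_add_eq_of_pow_eq_zero (moveLeft n p ν b)
      (term k rel (coneWord σ τ p q f) m) (fun z hz => h.moveLeft_mem_term ν hb3 m hz) B
      g₁ hg₁ (by rw [hB]; rfl)
    have h3 := hkey g
    rw [h2, h1] at h3
    refine ⟨g, hg, ?_, ?_⟩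
    -- The identity only equates sums of a string part and a band part; the two projections separate
    -- them.
    · have := congrArg (stringPart n p e ν) h3
      simpa only [map_add, stringPart_ofString, stringPart_ofBand hn, add_zero] using this
    · have := congrArg (toBand p q t) h3
      simpa only [map_add, toBand_ofString, toBand_ofBand hn, zero_add] using this

end Glueable

theorem nonempty_iso_of_compatiblyOriented (hg : IsGentle rel) (hσ : σ.IsHomotopyString rel)
    (hτ : τ.IsHomotopyBand rel) (c : ZMod n → k) (hc : ∀ i, c i ≠ 0)
    (hf : IsSingleMap rel σ τ p q f) (hcompat : CompatiblyOriented σ τ p q f)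
    (hne : (HomotopyCategory.quotient (ModuleCat.{max u v w} (Alg k rel))
      (ComplexShape.up ℤ)).map
        (wordSingleMap k rel (fun _ => 1) c hσ.toIsWalk hτ.toIsWalk hf) ≠ 0) :
    ∃ hs : (coneWord σ τ p q f).IsHomotopyString rel,
      Nonempty (CochainComplex.mappingCone (wordSingleMap k rel (fun _ => 1) c hσ.toIsWalk
        hτ.toIsWalk hf) ≅ stringComplex k rel (coneWord σ τ p q f) hs) := by
  obtain ⟨fL, fR, h⟩ := exists_glueable hg hσ.toIsWalk hτ c hf hcompat hne
  obtain ⟨c, rfl⟩ : ∃ c' : ZMod n → kˣ, c = fun i => (c' i : k) :=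
    ⟨fun i => Units.mk0 _ (hc i), rfl⟩
  exact ⟨h.isHomotopyString_coneWord hσ, h.nonempty_iso hg c hf hne⟩

end Inverse

end Gentle

theorem mainTheorem11 {k : Type u} [Field k] [IsAlgClosed k]
    {V : Type v} [Fintype V] [Quiver.{w} V]
    (rel : Gentle.Arr V → Gentle.Arr V → Prop) (hgentle : Gentle.IsGentle rel)
    (σ : Gentle.Word V ℤ) (hσ : σ.IsHomotopyString rel)
    {n : ℕ} (τ : Gentle.Word V (ZMod n)) (hτ : τ.IsHomotopyBand rel)
    (μ : k) (hμ : μ ≠ 0) (j : ZMod n) (hj : (τ.letter j).direct = true)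
    (p : ℤ) (q : ZMod n) (f : List (Gentle.Arr V))
    (hf : Gentle.IsSingleMap rel σ τ p q f)
    (hcompat : Gentle.CompatiblyOriented σ τ p q f)
    (hne : (HomotopyCategory.quotient (ModuleCat.{max u v w} (Gentle.Alg k rel))
      (ComplexShape.up ℤ)).map (Gentle.singleMap k rel hσ hτ μ j hf) ≠ 0) :
    ∃ hc : (Gentle.coneWord σ τ p q f).IsHomotopyString rel,
      Nonempty
        ((HomotopyCategory.quotient (ModuleCat.{max u v w} (Gentle.Alg k rel))
            (ComplexShape.up ℤ)).obj
          (CochainComplex.mappingCone (Gentle.singleMap k rel hσ hτ μ j hf)) ≅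
        (HomotopyCategory.quotient (ModuleCat.{max u v w} (Gentle.Alg k rel))
            (ComplexShape.up ℤ)).obj
          (Gentle.stringComplex k rel (Gentle.coneWord σ τ p q f) hc)) := by
  obtain ⟨hc, ⟨e⟩⟩ := Gentle.nonempty_iso_of_compatiblyOriented hgentle hσ hτ _
    (fun i => by split_ifs <;> simp [hμ]) hf hcompat hne
  exact ⟨hc, ⟨Functor.mapIso _ e⟩⟩
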